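/- All rings are unital and not necessarily commutative (the zero ring is allowed); modules are left modules. A ringed space is a topological space with a sheaf of such rings. **The space $NC\mathrm{Spec}(A)$.** For a ring $A$ and a subset $E\subseteq A$ let $\alpha_E: A\to loc(A,E)$ be the universal ring homomorphism which makes all elements of $E$ invertible. For finite subsets $E,F\subseteq A$ write $E\preceq F$ if $\alpha_F(e)$ is a unit for all $e\in E$; then there is a unique homomorphism $p_{FE}: loc(A,E)\to loc(A,F)$ under $A$. Let $L(A)$ be the poset of equivalence classes $A_E$ of finite subsets of $A$ for this preorder, with the Alexandrov topology (open sets are the upper sets) and the sheaf of rings with value $loc(A,E)$ on $U_E=\{A_F: A_F\ge A_E\}$ and restriction maps $p_{FE}$. $NC\mathrm{Spec}(A)$ is the soberification of $L(A)$ (its points are the irreducible closed subsets $C$ of $L(A)$, its open sets are the sets $\widetilde U=\{C : C\cap U\neq\varnothing\}$, $U$ open in $L(A)$), with the corresponding sheaf of rings $\mathcal O(\widetilde U)=\mathcal O(U)$. A ring homomorphism $\theta: A\to B$ induces a morphism $NC\mathrm{Spec}(B)\to NC\mathrm{Spec}(A)$, given by $C\mapsto \{A_E : B_{\theta(E)}\in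 C\}$ on points and by the maps $loc(A,E)\to loc(B,\theta(E))$ on sections. A left $A$-module $N$ defines a sheaf $\widetilde N$ of left modules on $NC\mathrm{Spec}(A)$ with $\widetilde N(\widetilde{U_E})=loc(A,E)\otimes_A N$ and restriction maps $p_{FE}\otimes 1$. **Quasicoherent sheaves.** For a ringed space $X$, $\mathrm{Qcoh}(X)$ is the full subcategory of the category of sheaves of left $\mathcal O_X$-modules on those $\mathcal M$ for which there is an open cover $X=\bigcup_i U_i$ with $(U_i,\mathcal O_X|_{U_i})\cong NC\mathrm{Spec}(A_i)$ for some rings $A_i$ and, under these isomorphisms, $\mathcal M|_{U_i}\cong\widetilde{M_i}$ for some left $A_i$-modules $M_i$. **The space $X$.** Let $n\in\mathbb N$, let $\lambda(i,j)\in\mathbb C\setminus\{0\}$ for $1\le i<j\le n$, and let $R=\mathbb C_\lambda[x_1,\dots,x_n]$ be the $\mathbb C$-algebra generated by $x_1,\dots,x_n$ subject to $x_ix_j=\lambda(i,j)x_jx_i$ for $i<j$, graded by $\deg x_i=1$. Let $R_i=R[x_i^{-1}]_0$ and $R_{ij}=R_{ji}=R[x_i^{-1},x_j^{-1}]_0$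 be the degree zero components of the localizations of $R$ at $x_i$ and at $\{x_i,x_j\}$. The ring $R_{ij}$ is the Ore localization of $R_i$ at the powers of $x_jx_i^{-1}$ and that of $R_j$ at the powers of $x_ix_j^{-1}$, and $NC\mathrm{Spec}(R_{ij})$ is thereby an open subspace of both $NC\mathrm{Spec}(R_i)$ and $NC\mathrm{Spec}(R_j)$. Let $X$ be the ringed space obtained by gluing $NC\mathrm{Spec}(R_1),\dots,NC\mathrm{Spec}(R_n)$ along the $NC\mathrm{Spec}(R_{ij})$. **Graded modules modulo torsion.** Let $R\text{-}\mathrm{GrMod}$ be the category of $\mathbb Z$-graded left $R$-modules and degree-preserving $R$-linear maps, and let $R\text{-}\mathrm{Tors}$ be its full subcategory of those $M$ such that for every $m\in M$ there is $N\in\mathbb N$ with $R_dm=0$ for all $d\ge N$. Let $\frac{R-\mathrm{GrMod}}{R-\mathrm{Tors}}$ be the quotient category, i.e. the localization of $R\text{-}\mathrm{GrMod}$ at the morphisms whose kernel and cokernel lie in $R\text{-}\mathrm{Tors}$. **Proposition.** The category $\mathrm{Qcoh}(X)$ is equivalent to $\frac{R-\mathrm{GrMod}}{R-\mathrm{Tors}}$.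 -/

import Mathlib

open CategoryTheory TopologicalSpace Opposite
open scoped TensorProduct

noncomputable section

namespace NCGeom

/-! ### Universal localization of a ring at a subset -/

/-- The relations defining the localization of `R` at `A`: the generators `inl r` form a copy of
the ring `R`, and the generator `inr a` is a two-sided inverse of `inl a`. -/
inductive LocRel (R : Type) [Ring R] (A : Set R) :
    FreeAlgebra ℤ (R ⊕ A) → FreeAlgebra ℤ (R ⊕ A) → Prop
  | one : LocRel R A (FreeAlgebra.ι ℤ (Sum.inl 1)) 1
  | add (r s : R) : LocRel R A (FreeAlgebra.ι ℤ (Sum.inl (r + s)))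
      (FreeAlgebra.ι ℤ (Sum.inl r) + FreeAlgebra.ι ℤ (Sum.inl s))
  | mul (r s : R) : LocRel R A (FreeAlgebra.ι ℤ (Sum.inl (r * s)))
      (FreeAlgebra.ι ℤ (Sum.inl r) * FreeAlgebra.ι ℤ (Sum.inl s))
  | mul_inv (a : A) : LocRel R A
      (FreeAlgebra.ι ℤ (Sum.inl (a : R)) * FreeAlgebra.ι ℤ (Sum.inr a)) 1
  | inv_mul (a : A) : LocRel R A
      (FreeAlgebra.ι ℤ (Sum.inr a) * FreeAlgebra.ι ℤ (Sum.inl (a : R))) 1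

/-- The localization `loc(R, A)` of a (not necessarily commutative) ring `R` at a subset `A`. -/
def Loc (R : Type) [Ring R] (A : Set R) : Type := RingQuot (LocRel R A)

instance (R : Type) [Ring R] (A : Set R) : Ring (Loc R A) :=
  inferInstanceAs (Ring (RingQuot (LocRel R A)))

namespace Loc

variable {R S T : Type} [Ring R] [Ring S] [Ring T]

/-- The quotient map from the free ring to the localization. -/
def mk (R : Type) [Ring R] (A : Set R) : FreeAlgebra ℤ (R ⊕ A) →+* Loc R A :=
  RingQuot.mkRingHom (LocRel R A)

theorem mk_rel {A : Set R} {x y : FreeAlgebra ℤ (R ⊕ A)} (h : LocRel R A x y) :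
    mk R A x = mk R A y :=
  RingQuot.mkRingHom_rel h

/-- The canonical ring homomorphism `α_A : R → loc(R, A)`. -/
def of (R : Type) [Ring R] (A : Set R) : R →+* Loc R A :=
  { toFun := fun r => mk R A (FreeAlgebra.ι ℤ (Sum.inl r))
    map_one' := by rw [mk_rel LocRel.one, map_one]
    map_mul' := fun r s => by rw [mk_rel (LocRel.mul r s), map_mul]
    map_add' := fun r s => by rw [mk_rel (LocRel.add r s), map_add]
    map_zero' := by
      have h := mk_rel (A := A) (LocRel.add (0 : R) 0)
      rw [add_zero, map_add] at h
      exact left_eq_add.mp h }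
/-- The inverse of `α_A(a)` in `loc(R, A)`. -/
def inv {A : Set R} (a : A) : Loc R A := mk R A (FreeAlgebra.ι ℤ (Sum.inr a))

theorem of_mul_inv {A : Set R} (a : A) : of R A a * inv a = 1 := by
  change mk R A _ * mk R A _ = 1
  rw [← map_mul, mk_rel (LocRel.mul_inv a), map_one]

theorem inv_mul_of {A : Set R} (a : A) : inv a * of R A a = 1 := by
  change mk R A _ * mk R A _ = 1
  rw [← map_mul, mk_rel (LocRel.inv_mul a), map_one]

theorem isUnit_of {A : Set R} {a : R} (ha : a ∈ A) : IsUnit (of R A a) :=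
  ⟨⟨of R A a, inv ⟨a, ha⟩, of_mul_inv ⟨a, ha⟩, inv_mul_of ⟨a, ha⟩⟩, rfl⟩

/-- The universal property of `loc(R, A)`: existence. -/
def lift {A : Set R} (θ : R →+* S) (h : ∀ a ∈ A, IsUnit (θ a)) : Loc R A →+* S :=
  RingQuot.lift (r := LocRel R A)
    ⟨((FreeAlgebra.lift ℤ (Sum.elim θ fun a : A => (((h a a.2).unit⁻¹ : Sˣ) : S)) :
        FreeAlgebra ℤ (R ⊕ A) →ₐ[ℤ] S) : FreeAlgebra ℤ (R ⊕ A) →+* S), by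
      intro x y hxy
      induction hxy <;> simp⟩

@[simp]
theorem lift_of {A : Set R} (θ : R →+* S) (h : ∀ a ∈ A, IsUnit (θ a)) (r : R) :
    lift θ h (of R A r) = θ r := by
  change RingQuot.lift _ (RingQuot.mkRingHom _ _) = _
  rw [RingQuot.lift_mkRingHom_apply]
  simp

/-- The universal property of `loc(R, A)`: uniqueness. -/
theorem hom_ext {A : Set R} {f g : Loc R A →+* S}
    (h : ∀ r, f (of R A r) = g (of R A r)) : f = g := by
  have hinv : ∀ a : A, f (inv a) = g (inv a) := fun a => by
    have h1 : f (inv a) * f (of R A a) = 1 := by rw [← map_mul, inv_mul_of, map_one]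
    have h2 : g (of R A a) * g (inv a) = 1 := by rw [← map_mul, of_mul_inv, map_one]
    calc f (inv a) = f (inv a) * (g (of R A a) * g (inv a)) := by rw [h2, mul_one]
      _ = g (inv a) := by rw [← h, ← mul_assoc, h1, one_mul]
  refine RingQuot.ringQuot_ext (R := FreeAlgebra ℤ (R ⊕ A)) (r := LocRel R A) f g ?_
  refine RingHom.toIntAlgHom_injective (FreeAlgebra.hom_ext ?_)
  funext x
  rcases x with r | a
  · exact h r
  · exact hinv a

/-- The ring homomorphism `loc(R, A) → loc(S, B)` induced by `θ : R → S` whenever `θ(A)` becomes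
invertible in `loc(S, B)`. -/
def map {A : Set R} {B : Set S} (θ : R →+* S) (h : ∀ a ∈ A, IsUnit (of S B (θ a))) :
    Loc R A →+* Loc S B :=
  lift ((of S B).comp θ) h

@[simp]
theorem map_of {A : Set R} {B : Set S} (θ : R →+* S) (h : ∀ a ∈ A, IsUnit (of S B (θ a)))
    (r : R) : map θ h (of R A r) = of S B (θ r) := by
  simp [map]

theorem map_inv {A : Set R} {B : Set S} (θ : R →+* S) (h : ∀ a ∈ A, IsUnit (of S B (θ a)))
    (a : A) (hb : θ a ∈ B) : map θ h (inv a) = inv ⟨θ a, hb⟩ := by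
  have h1 : map θ h (inv a) * of S B (θ a) = 1 := by
    rw [← map_of θ h, ← map_mul, inv_mul_of, map_one]
  have h2 := of_mul_inv (⟨θ a, hb⟩ : B)
  calc map θ h (inv a) = map θ h (inv a) * (of S B (θ a) * inv ⟨θ a, hb⟩) := by
        rw [h2, mul_one]
    _ = inv ⟨θ a, hb⟩ := by rw [← mul_assoc, h1, one_mul]

end Loc

/-! ### The localization semilattice -/

/-- The set `L₀(R)` of finite subsets of `R`, to be preordered by `A ≼ B` if and only if all
elements of `A` become units in `loc(R, B)` (and not by inclusion). -/
structure L0 (R : Type) where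
  /-- the underlying finite subset -/
  fin : Finset R

/-- The localization of `R` at a finite subset. -/
abbrev LocF {R : Type} [Ring R] (F : L0 R) : Type := Loc R (F.fin : Set R)

section

variable {R S T : Type} [Ring R] [Ring S] [Ring T]

instance : LE (L0 R) := ⟨fun A B => ∀ a ∈ (A.fin : Set R), IsUnit (Loc.of R (B.fin : Set R) a)⟩

/-- The map `p_{BA} : loc(R, A) → loc(R, B)` for `A ≼ B`. -/
def pMap {A B : L0 R} (h : A ≤ B) : LocF A →+* LocF B := Loc.lift (Loc.of R _) h

@[simp]
theorem pMap_of {A B : L0 R} (h : A ≤ B) (r : R) :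
    pMap h (Loc.of R _ r) = Loc.of R _ r := Loc.lift_of _ _ _

instance : Preorder (L0 R) where
  le_refl A := fun _ ha => Loc.isUnit_of ha
  le_trans A B C hAB hBC := fun a ha => by
    simpa using (hAB a ha).map (pMap hBC)

@[simp]
theorem pMap_refl (A : L0 R) (x : LocF A) : pMap (le_refl A) x = x := by
  have : pMap (le_refl A) = RingHom.id _ := Loc.hom_ext (by simp)
  rw [this]; rfl

@[simp]
theorem pMap_pMap {A B C : L0 R} (h : A ≤ B) (h' : B ≤ C) (x : LocF A) :
    pMap h' (pMap h x) = pMap (h.trans h') x := by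
  have : (pMap h').comp (pMap h) = pMap (h.trans h') := Loc.hom_ext (by simp)
  rw [← this]; rfl

/-- The poset `L(R)` of equivalence classes of finite subsets of `R`. -/
abbrev LPoset (R : Type) [Ring R] : Type := Antisymmetrization (L0 R) (· ≤ ·)

/-- `L(R)` with its Alexandrov topology, whose open sets are the upper sets. -/
abbrev LSpace (R : Type) [Ring R] : Type := Topology.WithUpperSet (LPoset R)

/-- The class `R_F` of a finite subset `F` of `R`. -/
def L0.cls (F : L0 R) : LSpace R := Topology.WithUpperSet.toUpperSet (toAntisymmetrization _ F)

theorem cls_le {F G : L0 R} : F.cls ≤ G.cls ↔ F ≤ G := toAntisymmetrization_le_toAntisymmetrization_iff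

theorem exists_cls (x : LSpace R) : ∃ F : L0 R, F.cls = x := by
  obtain ⟨F, hF⟩ := Quotient.exists_rep (Topology.WithUpperSet.ofUpperSet x)
  exact ⟨F, hF⟩

open Classical in
/-- The union of two finite subsets. -/
def L0.union (F G : L0 R) : L0 R := ⟨F.fin ∪ G.fin⟩

theorem L0.le_union_left (F G : L0 R) : F ≤ F.union G := fun a ha =>
  Loc.isUnit_of (by
    have : a ∈ F.fin := ha
    simp [L0.union, this])

theorem L0.le_union_right (F G : L0 R) : G ≤ F.union G := fun a ha =>
  Loc.isUnit_of (by
    have : a ∈ G.fin := ha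
    simp [L0.union, this])

open Classical in
/-- The image of a finite subset under a ring homomorphism. -/
def L0.image (θ : R →+* S) (F : L0 R) : L0 S := ⟨F.fin.image θ⟩

theorem L0.image_le_iff {θ : R →+* S} {F : L0 R} {G : L0 S} :
    F.image θ ≤ G ↔ ∀ a ∈ (F.fin : Set R), IsUnit (Loc.of S (G.fin : Set S) (θ a)) := by
  constructor
  · intro h a ha
    exact h _ (by simpa [L0.image] using ⟨a, ha, rfl⟩)
  · intro h b hb
    obtain ⟨a, ha, rfl⟩ : ∃ a ∈ F.fin, θ a = b := by simpa [L0.image] using hb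
    exact h a ha

/-- The map `loc(R, F) → loc(S, G)` induced by `θ : R → S` for `θ(F) ≼ G`. -/
def locMap (θ : R →+* S) {F : L0 R} {G : L0 S} (h : F.image θ ≤ G) : LocF F →+* LocF G :=
  Loc.map θ (L0.image_le_iff.mp h)

@[simp]
theorem locMap_of (θ : R →+* S) {F : L0 R} {G : L0 S} (h : F.image θ ≤ G) (r : R) :
    locMap θ h (Loc.of R _ r) = Loc.of S _ (θ r) := Loc.map_of _ _ _

theorem L0.image_mono (θ : R →+* S) {F G : L0 R} (h : F ≤ G) : F.image θ ≤ G.image θ := by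
  rw [L0.image_le_iff]
  intro a ha
  simpa using (h a ha).map (locMap θ (le_refl (G.image θ)))

theorem L0.image_union_le {θ : R →+* S} {F G : L0 R} {H : L0 S} (hF : F.image θ ≤ H)
    (hG : G.image θ ≤ H) : (F.union G).image θ ≤ H := by
  rw [L0.image_le_iff] at *
  intro a ha
  have : a ∈ F.fin ∨ a ∈ G.fin := by simpa [L0.union] using ha
  exact this.elim (hF a) (hG a)

theorem locMap_pMap (θ : R →+* S) {F G : L0 R} {H : L0 S} (h : F ≤ G) (hG : G.image θ ≤ H)
    (x : LocF F) : locMap θ hG (pMap h x) = locMap θ ((L0.image_mono θ h).trans hG) x := by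
  have : (locMap θ hG).comp (pMap h) = locMap θ ((L0.image_mono θ h).trans hG) :=
    Loc.hom_ext (by simp)
  rw [← this]; rfl

theorem pMap_locMap (θ : R →+* S) {F : L0 R} {G H : L0 S} (hF : F.image θ ≤ G) (h : G ≤ H)
    (x : LocF F) : pMap h (locMap θ hF x) = locMap θ (hF.trans h) x := by
  have : (pMap h).comp (locMap θ hF) = locMap θ (hF.trans h) := Loc.hom_ext (by simp)
  rw [← this]; rfl

/-- The order-preserving map `t_θ : L(R) → L(S)`, `R_F ↦ S_{θ(F)}`. -/
def tMap (θ : R →+* S) : LSpace R → LSpace S := fun x =>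
  Topology.WithUpperSet.toUpperSet
    (OrderHom.antisymmetrization ⟨L0.image θ, fun _ _ h => L0.image_mono θ h⟩
      (Topology.WithUpperSet.ofUpperSet x))

@[simp]
theorem tMap_cls (θ : R →+* S) (F : L0 R) : tMap θ F.cls = (F.image θ).cls := rfl

theorem tMap_mono (θ : R →+* S) : Monotone (tMap θ) := fun _ _ h =>
  OrderHom.monotone (OrderHom.antisymmetrization
    (⟨L0.image θ, fun _ _ h => L0.image_mono θ h⟩ : L0 R →o L0 S)) h

end

/-! ### Soberification -/

/-- The set of irreducible closed subsets of a topological space, to be equipped with the topology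
whose open sets are the sets `{C | C ∩ U ≠ ∅}` for `U` open. -/
def Sober (X : Type) [TopologicalSpace X] : Type := IrreducibleCloseds X

namespace Sober

variable {X : Type} [TopologicalSpace X]

/-- The closed subset underlying a point of the soberification. -/
def carrier (C : Sober X) : Set X := IrreducibleCloseds.carrier C

/-- The set `Ũ` of irreducible closed subsets which meet `U`. -/
def tilde (U : Set X) : Set (Sober X) := {C | (C.carrier ∩ U).Nonempty}

instance : TopologicalSpace (Sober X) where
  IsOpen V := ∃ U : Set X, IsOpen U ∧ V = tilde U
  isOpen_univ := ⟨Set.univ, isOpen_univ, by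
    ext C
    obtain ⟨x, hx⟩ := C.isIrreducible'.1
    exact ⟨fun _ => ⟨x, hx, trivial⟩, fun _ => trivial⟩⟩
  isOpen_inter := by
    rintro _ _ ⟨U, hU, rfl⟩ ⟨V, hV, rfl⟩
    refine ⟨U ∩ V, hU.inter hV, ?_⟩
    ext C
    constructor
    · rintro ⟨h1, h2⟩
      exact C.isIrreducible'.2 U V hU hV h1 h2
    · rintro ⟨x, hx, hxU, hxV⟩
      exact ⟨⟨x, hx, hxU⟩, ⟨x, hx, hxV⟩⟩
  isOpen_sUnion := by
    intro s hs
    refine ⟨⋃₀ {U | IsOpen U ∧ tilde U ∈ s}, isOpen_sUnion fun U hU => hU.1, ?_⟩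
    ext C
    constructor
    · rintro ⟨V, hV, hC⟩
      obtain ⟨U, hU, rfl⟩ := hs V hV
      obtain ⟨x, hx, hxU⟩ := hC
      exact ⟨x, hx, U, ⟨hU, hV⟩, hxU⟩
    · rintro ⟨x, hx, U, ⟨_, hU⟩, hxU⟩
      exact ⟨tilde U, hU, x, hx, hxU⟩

/-- The canonical map `x ↦ closure {x}` from a space to its soberification. -/
def pt (x : X) : Sober X := ⟨closure {x}, isIrreducible_singleton.closure, isClosed_closure⟩

end Sober

/-! ### A sheaf criterion -/

/-- A presheaf of types whose sections over `V` are the families of elements of `T j`, for those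
`j` with `p j ∈ V`, satisfying a binary compatibility condition for pairs `(j, k)` with
`p k` in every open set that contains `p j`, is a sheaf. -/
theorem isSheaf_families {X : TopCat.{0}} (P : TopCat.Presheaf (Type) X) {J : Type} (p : J → X)
    (T : J → Type) (r : J → J → Prop) (hr : ∀ j k, r j k → ∀ V : Opens X, p j ∈ V → p k ∈ V)
    (c : ∀ j k, r j k → T j → T k → Prop)
    (ev : ∀ V : Opens X, P.obj (op V) → ∀ j, p j ∈ V → T j)
    (ev_inj : ∀ V s t, (∀ j h, ev V s j h = ev V t j h) → s = t)
    (ev_c : ∀ V s j k h hj hk, c j k h (ev V s j hj) (ev V s k hk))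
    (ev_surj : ∀ (V : Opens X) (f : ∀ j, p j ∈ V → T j),
      (∀ j k h hj hk, c j k h (f j hj) (f k hk)) → ∃ s, ∀ j h, ev V s j h = f j h)
    (ev_res : ∀ (U V : Opens X) (i : U ⟶ V) s j h, ev U (P.map i.op s) j h = ev V s j (i.le h)) :
    P.IsSheaf := by
  refine TopCat.Presheaf.isSheaf_of_isSheafUniqueGluing_types P ?_
  intro ι U sf hsf
  have hex : ∀ j, p j ∈ iSup U → ∃ i, p j ∈ U i := fun j h => Opens.mem_iSup.mp h
  choose i hi using hex
  have key : ∀ j (a b : ι) (ha : p j ∈ U a) (hb : p j ∈ U b),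
      ev _ (sf a) j ha = ev _ (sf b) j hb := by
    intro j a b ha hb
    have hab : p j ∈ U a ⊓ U b := ⟨ha, hb⟩
    have h := congrArg (fun t => ev _ t j hab) (hsf a b)
    have h1 := ev_res _ _ (Opens.infLELeft (U a) (U b)) (sf a) j hab
    have h2 := ev_res _ _ (Opens.infLERight (U a) (U b)) (sf b) j hab
    exact h1.symm.trans (h.trans h2)
  obtain ⟨s, hs⟩ := ev_surj (iSup U) (fun j h => ev _ (sf (i j h)) j (hi j h)) (by
    intro j k hjk hj hk
    have hk' : p k ∈ U (i j hj) := hr j k hjk _ (hi j hj)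
    rw [key k (i k hk) (i j hj) (hi k hk) hk']
    exact ev_c _ _ _ _ hjk _ _)
  refine ⟨s, fun a => ?_, fun t ht => ?_⟩
  · refine ev_inj _ _ _ fun j hj => ?_
    have h1 := ev_res _ _ (Opens.leSupr U a) s j hj
    refine h1.trans ((hs _ _).trans (key _ _ _ _ _))
  · refine ev_inj _ _ _ fun j hj => ?_
    rw [hs]
    have h1 := ev_res _ _ (Opens.leSupr U (i j hj)) t j (hi j hj)
    refine h1.symm.trans ?_
    exact congrArg (fun t => ev _ t j (hi j hj)) (ht (i j hj))

/-! ### The ringed space `NCSpec(R)` -/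

/-- The category of (not necessarily commutative) ringed spaces. -/
abbrev RSpace : Type 1 := AlgebraicGeometry.SheafedSpace.{1, 0, 0} RingCat.{0}

section NCSpec

variable {R S T : Type} [Ring R] [Ring S] [Ring T]

/-- The underlying space `S(L(R))` of `NCSpec(R)`. -/
abbrev NCTop (R : Type) [Ring R] : TopCat.{0} := TopCat.of (Sober (LSpace R))

/-- The point `closure {R_F}` of `NCSpec(R)`. -/
def L0.pt (F : L0 R) : NCTop R := Sober.pt F.cls

theorem mem_carrier_of_le {C : Sober (LSpace R)} {x y : LSpace R} (hx : x ∈ C.carrier)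
    (h : y ≤ x) : y ∈ C.carrier :=
  (Topology.IsUpperSet.isClosed_iff_isLower.mp C.isClosed') h hx

theorem mem_carrier_pt {F : L0 R} {x : LSpace R} :
    x ∈ (Sober.carrier F.pt : Set (LSpace R)) ↔ x ≤ F.cls := by
  change x ∈ closure {F.cls} ↔ _
  rw [Topology.IsUpperSet.closure_singleton]
  rfl

theorem pt_mem_of_le {F G : L0 R} (h : F ≤ G) (V : Opens (NCTop R)) (hF : F.pt ∈ V) :
    G.pt ∈ V := by
  obtain ⟨V, U, hU, rfl⟩ := V
  obtain ⟨x, hx, hxU⟩ := hF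
  exact ⟨x, mem_carrier_pt.mpr ((mem_carrier_pt.mp hx).trans (cls_le.mpr h)), hxU⟩

theorem exists_pt_mem {C : NCTop R} {V : Opens (NCTop R)} (hC : C ∈ V) :
    ∃ F : L0 R, F.cls ∈ (Sober.carrier C : Set (LSpace R)) ∧ F.pt ∈ V := by
  obtain ⟨V, U, hU, rfl⟩ := V
  obtain ⟨x, hx, hxU⟩ := hC
  obtain ⟨F, rfl⟩ := exists_cls x
  exact ⟨F, hx, F.cls, mem_carrier_pt.mpr le_rfl, hxU⟩

theorem mem_of_pt_mem {C : NCTop R} {V : Opens (NCTop R)} {F : L0 R}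
    (hF : F.cls ∈ (Sober.carrier C : Set (LSpace R))) (hV : F.pt ∈ V) : C ∈ V := by
  obtain ⟨V, U, hU, rfl⟩ := V
  obtain ⟨x, hx, hxU⟩ := hV
  exact ⟨x, mem_carrier_of_le hF (mem_carrier_pt.mp hx), hxU⟩

/-- The ring of sections of the structure sheaf of `NCSpec(R)` over `V`: compatible families of
elements of the rings `loc(R, F)`, where `R_F` runs through the open subset of `L(R)` which
corresponds to `V`. In particular the sections over the basic open set of `F` are `loc(R, F)`. -/
def ncSec (R : Type) [Ring R] (V : Opens (NCTop R)) :
    Subring (∀ F : {F : L0 R // F.pt ∈ V}, LocF F.1) where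
  carrier := {s | ∀ (F G : {F : L0 R // F.pt ∈ V}) (h : F.1 ≤ G.1), pMap h (s F) = s G}
  mul_mem' hs ht := fun F G h => by simp [hs F G h, ht F G h]
  one_mem' := fun F G h => by simp
  add_mem' hs ht := fun F G h => by simp [hs F G h, ht F G h]
  zero_mem' := fun F G h => by simp
  neg_mem' hs := fun F G h => by simp [hs F G h]

/-- Restriction of sections. -/
def ncRes {U V : Opens (NCTop R)} (i : U ≤ V) : ncSec R V →+* ncSec R U where
  toFun s := ⟨fun F => s.1 ⟨F.1, i F.2⟩, fun F G h => s.2 ⟨F.1, i F.2⟩ ⟨G.1, i G.2⟩ h⟩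
  map_one' := rfl
  map_mul' _ _ := rfl
  map_zero' := rfl
  map_add' _ _ := rfl

/-- The structure presheaf of `NCSpec(R)`. -/
def ncPresheaf (R : Type) [Ring R] : TopCat.Presheaf RingCat.{0} (NCTop R) where
  obj V := RingCat.of (ncSec R V.unop)
  map i := RingCat.ofHom (ncRes i.unop.le)
  map_id _ := rfl
  map_comp _ _ := rfl

theorem ncPresheaf_isSheaf (R : Type) [Ring R] : (ncPresheaf R).IsSheaf := by
  rw [TopCat.Presheaf.isSheaf_iff_isSheaf_comp (forget RingCat)]
  refine isSheaf_families _ (J := L0 R) L0.pt (fun F => LocF F) (· ≤ ·)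
    (fun _ _ h V => pt_mem_of_le h V) (fun _ _ h a b => pMap h a = b)
    (fun V s F h => (show ncSec R V from s).1 ⟨F, h⟩) ?_ ?_ ?_ ?_
  · intro V s t h
    exact Subtype.ext (funext fun F => h F.1 F.2)
  · intro V s F G h hF hG
    exact (show ncSec R V from s).2 ⟨F, hF⟩ ⟨G, hG⟩ h
  · intro V f hf
    exact ⟨(⟨fun F => f F.1 F.2, fun F G h => hf F.1 G.1 h F.2 G.2⟩ : ncSec R V),
      fun _ _ => rfl⟩
  · intro U V i s j h
    rfl

/-- The ringed space `NCSpec(R)`. -/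
def NCSpec (R : Type) [Ring R] : RSpace where
  carrier := NCTop R
  presheaf := ncPresheaf R
  IsSheaf := ncPresheaf_isSheaf R

/-- The map `C ↦ t_θ⁻¹(C)` from `NCSpec(S)` to `NCSpec(R)` induced by `θ : R → S`. -/
def hatFun (θ : R →+* S) (C : NCTop S) : NCTop R where
  carrier := tMap θ ⁻¹' C.carrier
  isClosed' := by
    rw [Topology.IsUpperSet.isClosed_iff_isLower]
    exact fun x y h hx => mem_carrier_of_le hx (tMap_mono θ h)
  isIrreducible' := by
    constructor
    · obtain ⟨x, hx⟩ := C.isIrreducible'.1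
      obtain ⟨G, rfl⟩ := exists_cls x
      refine ⟨(⟨∅⟩ : L0 R).cls, mem_carrier_of_le hx ?_⟩
      rw [tMap_cls, cls_le, L0.image_le_iff]
      simp
    · rintro U V hU hV ⟨x, hx, hxU⟩ ⟨y, hy, hyV⟩
      obtain ⟨F, rfl⟩ := exists_cls x
      obtain ⟨G, rfl⟩ := exists_cls y
      have hup : ∀ z : LSpace S, IsOpen {w | z ≤ w} := fun z => by
        rw [Topology.IsUpperSet.isOpen_iff_isUpperSet]
        exact fun a b hab ha => le_trans (show z ≤ a from ha) hab
      obtain ⟨z, hz, hz1, hz2⟩ := C.isIrreducible'.2 _ _ (hup (F.image θ).cls)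
        (hup (G.image θ).cls) ⟨_, hx, le_refl (F.image θ).cls⟩ ⟨_, hy, le_refl (G.image θ).cls⟩
      obtain ⟨H, rfl⟩ := exists_cls z
      rw [Topology.IsUpperSet.isOpen_iff_isUpperSet] at hU hV
      refine ⟨(F.union G).cls, mem_carrier_of_le hz ?_,
        hU (cls_le.mpr (F.le_union_left G)) hxU, hV (cls_le.mpr (F.le_union_right G)) hyV⟩
      rw [tMap_cls, cls_le]
      exact L0.image_union_le (cls_le.mp hz1) (cls_le.mp hz2)

theorem cls_mem_hatFun {θ : R →+* S} {C : NCTop S} {F : L0 R} :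
    F.cls ∈ (Sober.carrier (hatFun θ C) : Set (LSpace R)) ↔
      (F.image θ).cls ∈ (Sober.carrier C : Set (LSpace S)) := Iff.rfl

theorem hatFun_continuous (θ : R →+* S) : Continuous (hatFun θ) := by
  refine continuous_def.mpr fun V hV => ?_
  refine ⟨{y | ∃ F : L0 R, F.pt ∈ V ∧ (F.image θ).cls ≤ y}, ?_, ?_⟩
  · rw [Topology.IsUpperSet.isOpen_iff_isUpperSet]
    rintro a b hab ⟨F, hF, h⟩
    exact ⟨F, hF, h.trans hab⟩
  · ext C
    constructor
    · intro hC
      obtain ⟨F, hF, hFV⟩ := exists_pt_mem (V := ⟨V, hV⟩) hC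
      exact ⟨(F.image θ).cls, hF, F, hFV, le_rfl⟩
    · rintro ⟨y, hy, F, hF, h⟩
      exact mem_of_pt_mem (V := ⟨V, hV⟩) (F := F)
        (cls_mem_hatFun.mpr (mem_carrier_of_le hy h)) hF

/-- The continuous map underlying `NCSpec(θ)`. -/
def ncBase (θ : R →+* S) : NCTop S ⟶ NCTop R := TopCat.ofHom ⟨hatFun θ, hatFun_continuous θ⟩

theorem exists_image_le {θ : R →+* S} {G : L0 S} {V : Opens (NCTop R)}
    (h : G.pt ∈ (Opens.map (ncBase θ)).obj V) : ∃ F : L0 R, F.image θ ≤ G ∧ F.pt ∈ V := by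
  obtain ⟨F, hF, hV⟩ := exists_pt_mem (C := hatFun θ G.pt) (V := V) h
  exact ⟨F, cls_le.mp (mem_carrier_pt.mp (cls_mem_hatFun.mp hF)), hV⟩

theorem locMap_eq_of_sec {θ : R →+* S} {G : L0 S} {V : Opens (NCTop R)} (s : ncSec R V)
    (F F' : {F : L0 R // F.pt ∈ V}) (h : F.1.image θ ≤ G) (h' : F'.1.image θ ≤ G) :
    locMap θ h (s.1 F) = locMap θ h' (s.1 F') := by
  have hu := L0.image_union_le h h'
  let H : {F : L0 R // F.pt ∈ V} :=
    ⟨F.1.union F'.1, pt_mem_of_le (F.1.le_union_left F'.1) V F.2⟩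
  have h1 := locMap_pMap θ (F.1.le_union_left F'.1) hu (s.1 F)
  have h2 := locMap_pMap θ (F.1.le_union_right F'.1) hu (s.1 F')
  rw [s.2 F H (F.1.le_union_left F'.1)] at h1
  rw [s.2 F' H (F.1.le_union_right F'.1)] at h2
  exact h1.symm.trans h2

/-- A choice of an `F` with `θ(F) ≼ G` at which sections over `V` are defined. -/
def pick (θ : R →+* S) (V : Opens (NCTop R))
    (G : {G : L0 S // G.pt ∈ (Opens.map (ncBase θ)).obj V}) : {F : L0 R // F.pt ∈ V} :=
  ⟨(exists_image_le G.2).choose, (exists_image_le G.2).choose_spec.2⟩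

theorem pick_spec (θ : R →+* S) (V : Opens (NCTop R))
    (G : {G : L0 S // G.pt ∈ (Opens.map (ncBase θ)).obj V}) :
    (pick θ V G).1.image θ ≤ G.1 :=
  (exists_image_le G.2).choose_spec.1

/-- The map on sections of `NCSpec(θ)` over `V`: its component at `G` is the image of the
component at `F` under `loc(R, F) → loc(S, G)`, for any `F` with `θ(F) ≼ G` at which the given
section is defined. -/
def ncMapSec (θ : R →+* S) (V : Opens (NCTop R)) :
    ncSec R V →+* ncSec S ((Opens.map (ncBase θ)).obj V) where
  toFun s := ⟨fun G => locMap θ (pick_spec θ V G) (s.1 (pick θ V G)), fun G H h => by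
    rw [pMap_locMap]
    exact locMap_eq_of_sec s _ _ _ _⟩
  map_one' := Subtype.ext (funext fun _ => map_one _)
  map_mul' _ _ := Subtype.ext (funext fun _ => map_mul _ _ _)
  map_zero' := Subtype.ext (funext fun _ => map_zero _)
  map_add' _ _ := Subtype.ext (funext fun _ => map_add _ _ _)

theorem ncMapSec_apply (θ : R →+* S) (V : Opens (NCTop R)) (s : ncSec R V)
    (G : {G : L0 S // G.pt ∈ (Opens.map (ncBase θ)).obj V}) (F : {F : L0 R // F.pt ∈ V})
    (h : F.1.image θ ≤ G.1) : (ncMapSec θ V s).1 G = locMap θ h (s.1 F) :=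
  locMap_eq_of_sec s _ _ _ _

/-- The morphism of ringed spaces `NCSpec(S) → NCSpec(R)` induced by `θ : R → S`. -/
def NCSpec.map (θ : R →+* S) : NCSpec S ⟶ NCSpec R :=
  InducedCategory.homMk
    { base := ncBase θ
      c :=
        { app := fun V => RingCat.ofHom (ncMapSec θ V.unop)
          naturality := by
            intro U V i
            ext s
            refine Subtype.ext (funext fun G => ?_)
            obtain ⟨F, hF, hFV⟩ := exists_image_le G.2
            have h1 := ncMapSec_apply θ V.unop (ncRes i.unop.le s) G ⟨F, hFV⟩ hF
            have h2 := ncMapSec_apply θ U.unop s ⟨G.1, i.unop.le G.2⟩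
              ⟨F, i.unop.le hFV⟩ hF
            exact h1.trans h2.symm } }

end NCSpec

/-! ### Extension of scalars and the sheaf associated to a module -/

section Modules

variable {R S T : Type} [Ring R] [Ring S] [Ring T]

/-- The subgroup of `S ⊗_ℤ M` generated by the elements `s θ(r) ⊗ m - s ⊗ r m`, which is an
`S`-submodule for the left action. -/
def tensorRel (θ : R →+* S) (M : Type) [AddCommGroup M] [Module R M] : Submodule S (S ⊗[ℤ] M) :=
  Submodule.span S {x | ∃ (s : S) (r : R) (m : M),
    x = (s * θ r) ⊗ₜ[ℤ] m - s ⊗ₜ[ℤ] (r • m)}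

/-- The left `S`-module `S ⊗_R M`, where `R` acts on `S` from the right through `θ : R → S`. -/
abbrev Ext (θ : R →+* S) (M : Type) [AddCommGroup M] [Module R M] : Type :=
  (S ⊗[ℤ] M) ⧸ tensorRel θ M

/-- The element `s ⊗ m` of `S ⊗_R M`. -/
def Ext.tmul (θ : R →+* S) {M : Type} [AddCommGroup M] [Module R M] (s : S) (m : M) : Ext θ M :=
  Submodule.Quotient.mk (s ⊗ₜ[ℤ] m)

variable {M : Type} [AddCommGroup M] [Module R M]

theorem Ext.induction {θ : R →+* S} {p : Ext θ M → Prop} (x : Ext θ M)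
    (htmul : ∀ s m, p (Ext.tmul θ s m)) (hadd : ∀ x y, p x → p y → p (x + y)) : p x := by
  obtain ⟨x, rfl⟩ := Submodule.Quotient.mk_surjective _ x
  induction x using TensorProduct.induction_on with
  | zero => simpa [Ext.tmul] using htmul 0 0
  | tmul s m => exact htmul s m
  | add x y hx hy => exact hadd _ _ hx hy

/-- The map `g ⊗ 1 : S ⊗_ℤ M → T ⊗_ℤ M`, as a semilinear map. -/
def tensorMap (g : S →+* T) (M : Type) [AddCommGroup M] : (S ⊗[ℤ] M) →ₛₗ[g] (T ⊗[ℤ] M) where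
  toFun := TensorProduct.map g.toAddMonoidHom.toIntLinearMap (LinearMap.id : M →ₗ[ℤ] M)
  map_add' := map_add _
  map_smul' s x := by
    induction x using TensorProduct.induction_on with
    | zero => simp
    | tmul t m => simp [TensorProduct.smul_tmul']
    | add x y hx hy => simp only [smul_add, map_add, hx, hy]

/-- The map `g ⊗ 1 : S ⊗_R M → T ⊗_R M` for a homomorphism `g : S → T` of rings under `R`. -/
def Ext.map {θ : R →+* S} {θ' : R →+* T} (g : S →+* T) (h : ∀ r, g (θ r) = θ' r)
    (M : Type) [AddCommGroup M] [Module R M] : Ext θ M →ₛₗ[g] Ext θ' M :=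
  Submodule.mapQ (tensorRel θ M) (tensorRel θ' M) (tensorMap g M) (by
    rw [tensorRel, Submodule.span_le]
    rintro _ ⟨s, r, m, rfl⟩
    refine Submodule.subset_span ⟨g s, r, m, ?_⟩
    simp [tensorMap, h])

@[simp]
theorem Ext.map_tmul {θ : R →+* S} {θ' : R →+* T} (g : S →+* T) (h : ∀ r, g (θ r) = θ' r)
    (s : S) (m : M) : Ext.map g h M (Ext.tmul θ s m) = Ext.tmul θ' (g s) m := rfl

/-- The left `loc(R, F)`-module `loc(R, F) ⊗_R M`. -/
abbrev LocMod (F : L0 R) (M : Type) [AddCommGroup M] [Module R M] : Type :=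
  Ext (Loc.of R (F.fin : Set R)) M

/-- The map `p_{GF} ⊗ 1 : loc(R, F) ⊗_R M → loc(R, G) ⊗_R M` for `F ≼ G`. -/
def pMod {F G : L0 R} (h : F ≤ G) (M : Type) [AddCommGroup M] [Module R M] :
    LocMod F M →ₛₗ[pMap h] LocMod G M :=
  Ext.map (pMap h) (pMap_of h) M

/-- The sections of `M̃` over `V`: compatible families of elements of `loc(R, F) ⊗_R M`, where
`R_F` runs through the open subset of `L(R)` which corresponds to `V`. In particular the sections
over the basic open set of `F` are `loc(R, F) ⊗_R M`. -/
def tildeSec (M : Type) [AddCommGroup M] [Module R M] (V : Opens (NCTop R)) :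
    AddSubgroup (∀ F : {F : L0 R // F.pt ∈ V}, LocMod F.1 M) where
  carrier := {s | ∀ (F G : {F : L0 R // F.pt ∈ V}) (h : F.1 ≤ G.1), pMod h M (s F) = s G}
  add_mem' hs ht := fun F G h => by simp [hs F G h, ht F G h]
  zero_mem' := fun F G h => by simp
  neg_mem' hs := fun F G h => by simp [hs F G h]

instance (M : Type) [AddCommGroup M] [Module R M] (V : Opens (NCTop R)) :
    Module (ncSec R V) (tildeSec (R := R) M V) where
  smul r s := ⟨fun F => r.1 F • s.1 F, fun F G h => by
    rw [LinearMap.map_smulₛₗ, r.2 F G h, s.2 F G h]⟩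
  one_smul s := Subtype.ext (funext fun _ => one_smul _ _)
  mul_smul a b s := Subtype.ext (funext fun _ => mul_smul _ _ _)
  smul_zero a := Subtype.ext (funext fun _ => smul_zero _)
  smul_add a s t := Subtype.ext (funext fun _ => smul_add _ _ _)
  add_smul a b s := Subtype.ext (funext fun _ => add_smul _ _ _)
  zero_smul s := Subtype.ext (funext fun _ => zero_smul _ _)

/-- Restriction of sections of `M̃`. -/
def tildeRes (M : Type) [AddCommGroup M] [Module R M] {U V : Opens (NCTop R)} (i : U ≤ V) :
    tildeSec (R := R) M V →+ tildeSec (R := R) M U where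
  toFun s := ⟨fun F => s.1 ⟨F.1, i F.2⟩, fun F G h => s.2 ⟨F.1, i F.2⟩ ⟨G.1, i G.2⟩ h⟩
  map_zero' := rfl
  map_add' _ _ := rfl

/-- The presheaf of abelian groups underlying `M̃`. -/
def tildePresheaf (R : Type) [Ring R] (M : Type) [AddCommGroup M] [Module R M] :
    TopCat.Presheaf Ab.{0} (NCTop R) where
  obj V := AddCommGrpCat.of (tildeSec (R := R) M V.unop)
  map i := AddCommGrpCat.ofHom (tildeRes M i.unop.le)
  map_id _ := rfl
  map_comp _ _ := rfl

theorem tildePresheaf_isSheaf (R : Type) [Ring R] (M : Type) [AddCommGroup M] [Module R M] :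
    (tildePresheaf R M).IsSheaf := by
  rw [TopCat.Presheaf.isSheaf_iff_isSheaf_comp (forget Ab)]
  refine isSheaf_families _ (J := L0 R) L0.pt (fun F => LocMod F M) (· ≤ ·)
    (fun _ _ h V => pt_mem_of_le h V) (fun _ _ h a b => pMod h M a = b)
    (fun V s F h => (show tildeSec (R := R) M V from s).1 ⟨F, h⟩) ?_ ?_ ?_ ?_
  · intro V s t h
    exact Subtype.ext (funext fun F => h F.1 F.2)
  · intro V s F G h hF hG
    exact (show tildeSec (R := R) M V from s).2 ⟨F, hF⟩ ⟨G, hG⟩ h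
  · intro V f hf
    exact ⟨(⟨fun F => f F.1 F.2, fun F G h => hf F.1 G.1 h F.2 G.2⟩ : tildeSec (R := R) M V),
      fun _ _ => rfl⟩
  · intro U V i s j h
    rfl

instance (M : Type) [AddCommGroup M] [Module R M] (V : (Opens (NCTop R))ᵒᵖ) :
    Module ((ncPresheaf R).obj V) ((tildePresheaf R M).obj V) :=
  inferInstanceAs (Module (ncSec R V.unop) (tildeSec (R := R) M V.unop))

/-- The category of sheaves of left `𝒪_X`-modules on a ringed space `X`. -/
abbrev OMod (X : RSpace) : Type 1 := SheafOfModules.{0} X.sheaf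

/-- Morphisms of sheaves of left `𝒪_X`-modules. -/
instance (X : RSpace) : Category.{0, 1} (OMod X) := SheafOfModules.instCategory.{0, 0, 0, 0}

/-- The sheaf `M̃` of left modules on `NCSpec(R)` associated to a left `R`-module `M`. -/
def tildeMod (R : Type) [Ring R] (M : Type) [AddCommGroup M] [Module R M] : OMod (NCSpec R) where
  val := PresheafOfModules.ofPresheaf (R := ncPresheaf R) (tildePresheaf R M)
    (fun _ _ _ _ _ => rfl)
  isSheaf := tildePresheaf_isSheaf R M

end Modules

/-! ### Quasicoherent sheaves -/

/-- The direct image functor on sheaves of modules along a morphism of ringed spaces. -/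
def pushMod {X Y : RSpace} (f : X ⟶ Y) : OMod X ⥤ OMod Y :=
  SheafOfModules.pushforward (F := Opens.map f.hom.base) (S := Y.sheaf) (R := X.sheaf) ⟨f.hom.c⟩

/-- The open subspace of a ringed space on an open subset. -/
abbrev openSub (X : RSpace) (U : Opens X) : RSpace := X.restrict U.isOpenEmbedding

/-- The restriction of sheaves of modules to an open subspace. -/
def resMod (X : RSpace) (U : Opens X) : OMod X ⥤ OMod (openSub X U) :=
  haveI : U.isOpenEmbedding.isOpenMap.functor.IsContinuous
      (Opens.grothendieckTopology (openSub X U)) (Opens.grothendieckTopology X) :=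
    U.isOpenEmbedding.functor_isContinuous
  SheafOfModules.pushforward (F := U.isOpenEmbedding.isOpenMap.functor)
    (S := (openSub X U).sheaf) (R := X.sheaf) ⟨𝟙 _⟩

/-- A sheaf of left `𝒪_X`-modules is quasicoherent if `X` has an open cover by open subspaces `U`
with `U ≅ NCSpec(A)` for some ring `A`, over each of which it corresponds to `Ñ` for some left
`A`-module `N`. -/
def IsQcoh (X : RSpace) : ObjectProperty (OMod X) := fun 𝓜 =>
  ∃ (ι : Type) (U : ι → Opens X), (⨆ i, U i) = ⊤ ∧ ∀ i, ∃ (A : RingCat.{0})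
    (e : openSub X (U i) ≅ NCSpec A) (N : ModuleCat.{0} A),
    Nonempty ((pushMod e.hom).obj ((resMod X (U i)).obj 𝓜) ≅ tildeMod A N)

/-- The category of quasicoherent sheaves of left modules, a full subcategory of the category of
sheaves of left modules. -/
abbrev Qcoh (X : RSpace) : Type 1 := (IsQcoh X).FullSubcategory

/-! ### Gluing of ringed spaces -/

section Equalizer

variable {X : TopCat.{0}} {I K : Type} (F : I → TopCat.Presheaf RingCat.{0} X)
  (G : K → TopCat.Presheaf RingCat.{0} X) (l r : K → I)
  (a : ∀ k, F (l k) ⟶ G k) (b : ∀ k, F (r k) ⟶ G k)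

/-- Families of sections `s i` of `F i` over `U` such that `a k (s (l k)) = b k (s (r k))` for
all `k`. -/
def eqSec (U : Opens X) : Subring (∀ i, (F i).obj (op U)) where
  carrier := {s | ∀ k, ((a k).app (op U)).hom (s (l k)) = ((b k).app (op U)).hom (s (r k))}
  mul_mem' hs ht := fun k => by simp [hs k, ht k]
  one_mem' := fun k => by simp
  add_mem' hs ht := fun k => by simp [hs k, ht k]
  zero_mem' := fun k => by simp
  neg_mem' hs := fun k => by simp [hs k]

/-- Restriction of compatible families. -/
def eqRes {U V : Opens X} (i : U ⟶ V) : eqSec F G l r a b V →+* eqSec F G l r a b U where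
  toFun s := ⟨fun j => ((F j).map i.op).hom (s.1 j), fun k => by
    have h1 := ConcreteCategory.congr_hom ((a k).naturality i.op) (s.1 (l k))
    have h2 := ConcreteCategory.congr_hom ((b k).naturality i.op) (s.1 (r k))
    exact h1.trans ((congrArg ((G k).map i.op).hom (s.2 k)).trans h2.symm)⟩
  map_one' := Subtype.ext (funext fun _ => map_one _)
  map_mul' _ _ := Subtype.ext (funext fun _ => map_mul _ _ _)
  map_zero' := Subtype.ext (funext fun _ => map_zero _)
  map_add' _ _ := Subtype.ext (funext fun _ => map_add _ _ _)

/-- The presheaf of compatible families. -/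
def eqPresheaf : TopCat.Presheaf RingCat.{0} X where
  obj U := RingCat.of (eqSec F G l r a b U.unop)
  map i := RingCat.ofHom (eqRes F G l r a b i.unop)
  map_id U := RingCat.hom_ext (RingHom.ext fun s => Subtype.ext (funext fun j =>
    ConcreteCategory.congr_hom ((F j).map_id U) (s.1 j)))
  map_comp i i' := RingCat.hom_ext (RingHom.ext fun s => Subtype.ext (funext fun j =>
    ConcreteCategory.congr_hom ((F j).map_comp i i') (s.1 j)))

theorem eqPresheaf_isSheaf (hF : ∀ i, (F i).IsSheaf) (hG : ∀ k, (G k).IsSheaf) :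
    (eqPresheaf F G l r a b).IsSheaf := by
  rw [TopCat.Presheaf.isSheaf_iff_isSheafUniqueGluing]
  intro ι U sf hsf
  have hex := fun j => (hF j).isSheafUniqueGluing U
    (fun x => (show eqSec F G l r a b (U x) from sf x).1 j)
    (fun x y => congrFun (congrArg Subtype.val (hsf x y)) j)
  choose s hs hu using hex
  refine ⟨(⟨s, fun k => ?_⟩ : eqSec F G l r a b (iSup U)), fun x => ?_, fun t ht => ?_⟩
  · refine TopCat.Sheaf.eq_of_locally_eq ⟨G k, hG k⟩ U _ _ fun x => ?_
    have h1 := ConcreteCategory.congr_hom ((a k).naturality (Opens.leSupr U x).op) (s (l k))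
    have h2 := ConcreteCategory.congr_hom ((b k).naturality (Opens.leSupr U x).op) (s (r k))
    have e1 := congrArg ((a k).app (op (U x))).hom (hs (l k) x)
    have e2 := congrArg ((b k).app (op (U x))).hom (hs (r k) x)
    have e3 := (show eqSec F G l r a b (U x) from sf x).2 k
    exact h1.symm.trans (e1.trans (e3.trans (e2.symm.trans h2)))
  · exact Subtype.ext (funext fun j => hs j x)
  · exact Subtype.ext (funext fun j => hu j _ fun x =>
      congrFun (congrArg Subtype.val (ht x)) j)

end Equalizer

section Glue

variable {I : Type} (X : I → RSpace) (V : I → I → RSpace) (f : ∀ i j, V i j ⟶ X i)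
  (g : ∀ i j, V i j ⟶ X j)

/-- The relation on the disjoint union of the spaces `X i` that identifies the two images of every
point of `V i j`. -/
inductive GlueRel : (Σ i, X i) → (Σ i, X i) → Prop
  | mk (i j : I) (v : V i j) : GlueRel ⟨i, (f i j).hom.base v⟩ ⟨j, (g i j).hom.base v⟩

/-- The quotient space of the disjoint union of the spaces `X i` by the equivalence relation
generated by `GlueRel`. -/
def glueTop : TopCat.{0} := TopCat.of (Quot (GlueRel X V f g))

/-- The canonical map from `X i` to the glued space. -/
def gluePi (i : I) : (X i).carrier ⟶ glueTop X V f g :=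
  TopCat.ofHom ⟨fun x => Quot.mk _ ⟨i, x⟩, continuous_quot_mk.comp continuous_sigmaMk⟩

theorem gluePi_comp (i j : I) (U : Opens (glueTop X V f g)) :
    (Opens.map (f i j).hom.base).obj ((Opens.map (gluePi X V f g i)).obj U) =
      (Opens.map (g i j).hom.base).obj ((Opens.map (gluePi X V f g j)).obj U) := by
  ext v
  have h : Quot.mk (GlueRel X V f g) ⟨i, (f i j).hom.base v⟩ =
      Quot.mk (GlueRel X V f g) ⟨j, (g i j).hom.base v⟩ := Quot.sound (GlueRel.mk i j v)
  exact iff_of_eq (congrArg (· ∈ U) h)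

/-- The direct image on the glued space of the structure sheaf of `X i`. -/
def glueF (i : I) : TopCat.Presheaf RingCat.{0} (glueTop X V f g) :=
  (Opens.map (gluePi X V f g i)).op ⋙ (X i).presheaf

/-- The direct image on the glued space of the structure sheaf of `V i j`. -/
def glueG (k : I × I) : TopCat.Presheaf RingCat.{0} (glueTop X V f g) :=
  (Opens.map (gluePi X V f g k.1)).op ⋙ (Opens.map (f k.1 k.2).hom.base).op ⋙
    (V k.1 k.2).presheaf

/-- Pull-back of sections along `f i j`. -/
def glueL (k : I × I) : glueF X V f g k.1 ⟶ glueG X V f g k :=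
  Functor.whiskerLeft (Opens.map (gluePi X V f g k.1)).op (f k.1 k.2).hom.c

/-- Pull-back of sections along `g i j`. -/
def glueR (k : I × I) : glueF X V f g k.2 ⟶ glueG X V f g k where
  app U := (g k.1 k.2).hom.c.app (op ((Opens.map (gluePi X V f g k.2)).obj U.unop)) ≫
    (V k.1 k.2).presheaf.map (homOfLE (gluePi_comp X V f g k.1 k.2 U.unop).le).op
  naturality U U' i := by
    have h := (g k.1 k.2).hom.c.naturality ((Opens.map (gluePi X V f g k.2)).op.map i)
    dsimp [glueF, glueG] at h ⊢
    rw [reassoc_of% h, Category.assoc, ← Functor.map_comp, ← Functor.map_comp]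
    rfl

/-- The ringed space obtained by gluing the ringed spaces `X i` along the ringed spaces `V i j`,
which are mapped to `X i` by `f i j` and to `X j` by `g i j` (in applications both maps are
isomorphisms onto open subspaces, whose points and sections are identified by the composite
isomorphism). The sections over `U` are the families of sections of the `X i` over the
preimages of `U` whose pull-backs to the spaces `V i j` agree. -/
def glueSpace : RSpace where
  carrier := glueTop X V f g
  presheaf := eqPresheaf (glueF X V f g) (glueG X V f g) Prod.fst Prod.snd (glueL X V f g)
    (glueR X V f g)
  IsSheaf := eqPresheaf_isSheaf _ _ _ _ _ _
    (fun i => TopCat.Sheaf.pushforward_sheaf_of_sheaf (gluePi X V f g i) (X i).IsSheaf)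
    (fun k => TopCat.Sheaf.pushforward_sheaf_of_sheaf (gluePi X V f g k.1)
      (TopCat.Sheaf.pushforward_sheaf_of_sheaf (f k.1 k.2).hom.base (V k.1 k.2).IsSheaf))

end Glue

/-! ### Skew-polynomial rings -/

section Skew

variable (n : ℕ) (lam : Fin n → Fin n → ℂ)

/-- The relations `x_i x_j = λ(i, j) x_j x_i` for `i < j`. -/
inductive SkewRel : FreeAlgebra ℂ (Fin n) → FreeAlgebra ℂ (Fin n) → Prop
  | comm (i j : Fin n) (h : i < j) : SkewRel (FreeAlgebra.ι ℂ i * FreeAlgebra.ι ℂ j)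
      (lam i j • (FreeAlgebra.ι ℂ j * FreeAlgebra.ι ℂ i))

/-- The skew-polynomial ring `ℂ_λ[x_1, …, x_n]`. Only the values `lam i j` with `i < j` matter. -/
def SkewPoly : Type := RingQuot (SkewRel n lam)

instance : Ring (SkewPoly n lam) := inferInstanceAs (Ring (RingQuot (SkewRel n lam)))

instance : Algebra ℂ (SkewPoly n lam) := inferInstanceAs (Algebra ℂ (RingQuot (SkewRel n lam)))

variable {n}

/-- The generator `x_i`. -/
def SkewPoly.x (i : Fin n) : SkewPoly n lam :=
  RingQuot.mkAlgHom ℂ (SkewRel n lam) (FreeAlgebra.ι ℂ i)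

variable (n)

/-- The homogeneous component of degree `d`: the linear span of the products of `d` generators. -/
def SkewPoly.deg (d : ℕ) : Submodule ℂ (SkewPoly n lam) :=
  Submodule.span ℂ (Set.range (SkewPoly.x lam)) ^ d

variable {n}

/-- The grading induced on a localization of the skew-polynomial ring at a set `A` of homogeneous
elements: `LocDeg lam A m y` says that `y` is homogeneous of degree `m`. These are the smallest
additive subgroups such that `α_A` preserves degrees, the inverse of an element of degree `d` has
degree `-d`, and degrees add up in products. -/
inductive LocDeg (A : Set (SkewPoly n lam)) : ℤ → Loc (SkewPoly n lam) A → Prop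
  | of {d : ℕ} {r : SkewPoly n lam} (h : r ∈ SkewPoly.deg n lam d) :
      LocDeg A d (Loc.of _ A r)
  | inv {d : ℕ} (a : A) (h : (a : SkewPoly n lam) ∈ SkewPoly.deg n lam d) :
      LocDeg A (-d) (Loc.inv a)
  | add {m : ℤ} {y z : Loc (SkewPoly n lam) A} (hy : LocDeg A m y) (hz : LocDeg A m z) :
      LocDeg A m (y + z)
  | neg {m : ℤ} {y : Loc (SkewPoly n lam) A} (hy : LocDeg A m y) : LocDeg A m (-y)
  | mul {k m : ℤ} {y z : Loc (SkewPoly n lam) A} (hy : LocDeg A k y) (hz : LocDeg A m z) :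
      LocDeg A (k + m) (y * z)

theorem one_mem_deg : (1 : SkewPoly n lam) ∈ SkewPoly.deg n lam 0 := by
  rw [SkewPoly.deg, pow_zero]
  exact Submodule.one_le.mp le_rfl

/-- The degree zero component of a localization of the skew-polynomial ring, as a subring. -/
def degZero (A : Set (SkewPoly n lam)) : Subring (Loc (SkewPoly n lam) A) where
  carrier := {y | LocDeg lam A 0 y}
  mul_mem' hy hz := by simpa using LocDeg.mul hy hz
  one_mem' := by simpa using LocDeg.of (A := A) (one_mem_deg lam)
  add_mem' hy hz := LocDeg.add hy hz
  zero_mem' := by simpa using LocDeg.of (A := A) (SkewPoly.deg n lam 0).zero_mem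
  neg_mem' hy := LocDeg.neg hy

theorem isUnit_of_subset {A B : Set (SkewPoly n lam)} (h : A ⊆ B) :
    ∀ a ∈ A, IsUnit (Loc.of _ B (RingHom.id (SkewPoly n lam) a)) := fun _ ha =>
  Loc.isUnit_of (h ha)

theorem LocDeg.map {A B : Set (SkewPoly n lam)} (h : A ⊆ B) {m : ℤ}
    {y : Loc (SkewPoly n lam) A} (hy : LocDeg lam A m y) :
    LocDeg lam B m (Loc.map (RingHom.id _) (isUnit_of_subset lam h) y) := by
  induction hy with
  | of hr => rw [Loc.map_of]; exact LocDeg.of hr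
  | inv a ha =>
    rw [Loc.map_inv (RingHom.id _) _ a (h a.2)]
    exact LocDeg.inv ⟨a, h a.2⟩ ha
  | add _ _ h1 h2 => rw [map_add]; exact LocDeg.add h1 h2
  | neg _ h1 => rw [map_neg]; exact LocDeg.neg h1
  | mul _ _ h1 h2 => rw [map_mul]; exact LocDeg.mul h1 h2

/-- The canonical map between degree zero components for `A ⊆ B`. -/
def degZeroMap {A B : Set (SkewPoly n lam)} (h : A ⊆ B) : degZero lam A →+* degZero lam B :=
  (Loc.map (RingHom.id _) (isUnit_of_subset lam h)).restrict (degZero lam A) (degZero lam B)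
    (fun _ hy => LocDeg.map lam h hy)

/-- The ring `R_i = R[x_i⁻¹]_0`. -/
abbrev chartRing (i : Fin n) : Type := degZero lam {SkewPoly.x lam i}

/-- The ring `R_ij = R[x_i⁻¹, x_j⁻¹]_0`, which is the Ore localization of `R_i` at the powers of
`x_j x_i⁻¹` and the Ore localization of `R_j` at the powers of `x_i x_j⁻¹`. -/
abbrev overlapRing (i j : Fin n) : Type := degZero lam {SkewPoly.x lam i, SkewPoly.x lam j}

/-- The localization map `R_i → R_ij`. -/
def chartMapL (i j : Fin n) : chartRing lam i →+* overlapRing lam i j :=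
  degZeroMap lam (by simp)

/-- The localization map `R_j → R_ij`. -/
def chartMapR (i j : Fin n) : chartRing lam j →+* overlapRing lam i j :=
  degZeroMap lam (by simp)

variable (n)

/-- The noncommutative projective space `X` obtained by gluing the ringed spaces `NCSpec(R_i)`
along the ringed spaces `NCSpec(R_ij)`. -/
def ncProj : RSpace :=
  glueSpace (fun i : Fin n => NCSpec (chartRing lam i)) (fun i j => NCSpec (overlapRing lam i j))
    (fun i j => NCSpec.map (chartMapL lam i j)) (fun i j => NCSpec.map (chartMapR lam i j))

/-! ### Graded modules modulo torsion -/

/-- A `ℤ`-graded left module over the skew-polynomial ring. -/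
structure GrMod where
  /-- the underlying abelian group -/
  carrier : Type
  [group : AddCommGroup carrier]
  [module : Module (SkewPoly n lam) carrier]
  /-- the homogeneous component of degree `k` -/
  deg : ℤ → AddSubgroup carrier
  isInternal : DirectSum.IsInternal deg
  smul_mem : ∀ (d : ℕ) (k : ℤ) (r : SkewPoly n lam) (m : carrier),
    r ∈ SkewPoly.deg n lam d → m ∈ deg k → r • m ∈ deg (d + k)

attribute [instance] GrMod.group GrMod.module

variable {n lam}

/-- Morphisms of graded modules: the linear maps which preserve degrees. -/
@[ext]
structure GrMod.Hom (M N : GrMod n lam) where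
  /-- the underlying linear map -/
  lin : M.carrier →ₗ[SkewPoly n lam] N.carrier
  map_deg : ∀ (k : ℤ) (m : M.carrier), m ∈ M.deg k → lin m ∈ N.deg k

instance : Category (GrMod n lam) where
  Hom := GrMod.Hom
  id _ := ⟨LinearMap.id, fun _ _ h => h⟩
  comp f g := ⟨g.lin.comp f.lin, fun _ _ h => g.map_deg _ _ (f.map_deg _ _ h)⟩

variable (n lam)

/-- A module over the skew-polynomial ring is torsion if each of its elements is killed by all
homogeneous elements of sufficiently large degree. -/
def IsTors (M : Type) [AddCommGroup M] [Module (SkewPoly n lam) M] : Prop :=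
  ∀ m : M, ∃ N : ℕ, ∀ d : ℕ, N ≤ d → ∀ r ∈ SkewPoly.deg n lam d, r • m = 0

/-- The morphisms of graded modules whose kernel and cokernel are torsion. -/
def torsIso : MorphismProperty (GrMod n lam) := fun _ _ f =>
  IsTors n lam (LinearMap.ker (GrMod.Hom.lin f)) ∧
    IsTors n lam (_ ⧸ LinearMap.range (GrMod.Hom.lin f))

/-- The quotient category of graded left modules by torsion modules: the localization (with its
strict universal property) of the category of graded modules with respect to the morphisms whose
kernel and cokernel are torsion. -/
abbrev GrModModTors : Type 1 := (torsIso n lam).Localization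

end Skew

end NCGeom

end

/-! For a nonempty set A of generators write R_A for the degree zero part of R localized at A. Both
categories are compared with the category `DMod` of descent data: modules M_A over the rings R_A,
with restriction maps M_A → M_B for A ⊆ B that are extensions of scalars.

Every generator is a normal element of R: it can be moved past any element at the cost of rescaling
the variables. Hence the monomials in A satisfy the left Ore conditions, and R_A → R_B is the Ore
localization at the fractions x_i⁻ᵈ y, with x_i in A and y a monomial of degree d in B
(`isOre_res`).

The space X is controlled by nodes, which are pairs (A, F) of a set of generators and a finite
subset F of R_A, up to maps of nodes that induce isomorphisms loc(R_A, F) → loc(R_B, G) (`Weak`).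
These are stable under joins (`Weak.pushout`), and every node can be moved to any smaller set of
generators (`exists_weak`). It follows that the point of a node has a smallest open neighbourhood
(`nbhd_le_iff`), that the charts are open embeddings, and that the structure sheaf takes the value
loc(R_A, F) on this neighbourhood (`ev_nbhd_bijective`). A smallest neighbourhood lies inside some
member of any open cover. So for a quasicoherent sheaf, whatever affine cover witnesses it,
restriction between smallest neighbourhoods is extension of scalars (`IsQcoh.isBC`). Taking sections
over the intersections of charts therefore gives a fully faithful functor `toDMod`. It is
essentially surjective because the compatible families of a descent datum over the nodes form a
sheaf, which on the i-th chart is the sheaf of the module M_i (`chartModIso`).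

On the graded side, `lambda` sends M to the degree zero parts of its localizations, and its right
adjoint `gamma` collects the global sections of all twists. Serre's argument applies: after
multiplication by a high power of x_i a section over the i-th chart extends globally
(`exists_gamma_eq`), and a global section vanishing on that chart is killed by a power of x_i
(`eventually_op_eq_zero`). So the counit is invertible and `lambda` is a localization at the
morphisms that it inverts. Those are the morphisms with torsion kernel and cokernel (`torsIso_eq`),
since an element is torsion exactly when a power of each generator kills it (`tors_iff`). -/

noncomputable section

namespace NCGeom

/-! ### Base change along a ring homomorphism -/

section BaseChange

variable {A B C : Type} [Ring A] [Ring B] [Ring C]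

/-- A map `f : M → N`, semilinear along `θ : A → B`, exhibits `N` as the extension of scalars of
`M` along `θ`. -/
structure IsBC (θ : A →+* B) {M N : Type} [AddCommGroup M] [AddCommGroup N] [Module A M]
    [Module B N] (f : M →+ N) : Prop where
  map_smul : ∀ a m, f (a • m) = θ a • f m
  exists_lift : ∀ {Q : Type} [AddCommGroup Q] [Module B Q] (g : M →+ Q),
    (∀ a m, g (a • m) = θ a • g m) → ∃ h : N →ₗ[B] Q, ∀ m, h (f m) = g m
  hom_ext : ∀ {Q : Type} [AddCommGroup Q] [Module B Q] (h h' : N →ₗ[B] Q),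
    (∀ m, h (f m) = h' (f m)) → h = h'

namespace IsBC

variable {θ : A →+* B} {φ : B →+* C} {M N P : Type} [AddCommGroup M] [AddCommGroup N]
  [AddCommGroup P] [Module A M] [Module B N] [Module C P] {f : M →+ N} {g : N →+ P}

theorem comp (hf : IsBC θ f) (hg : IsBC φ g) : IsBC (φ.comp θ) (g.comp f) where
  map_smul a m := by simp [hf.map_smul, hg.map_smul]
  exists_lift {Q} _ _ q hq := by
    let : Module B Q := Module.compHom Q φ
    obtain ⟨h, hh⟩ := hf.exists_lift q hq
    obtain ⟨h', hh'⟩ := hg.exists_lift h.toAddMonoidHom (fun b n => h.map_smul b n)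
    exact ⟨h', fun m => (hh' (f m)).trans (hh m)⟩
  hom_ext {Q} _ _ h h' hh := by
    refine hg.hom_ext h h' fun n => ?_
    let : Module B Q := Module.compHom Q φ
    let k : N →ₗ[B] Q :=
      { toFun := fun n => h (g n)
        map_add' := by simp
        map_smul' := fun b n => by rw [hg.map_smul, h.map_smul]; rfl }
    let k' : N →ₗ[B] Q :=
      { toFun := fun n => h' (g n)
        map_add' := by simp
        map_smul' := fun b n => by rw [hg.map_smul, h'.map_smul]; rfl }
    exact LinearMap.congr_fun (hf.hom_ext k k' hh) n

/-- The extension is the one supplied by the composite; the uniqueness clause for `f` shows that it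
has the right values on all of N and not only on the image of `f`. -/
theorem cancel (hf : IsBC θ f) (hgf : IsBC (φ.comp θ) (g.comp f))
    (hg : ∀ b n, g (b • n) = φ b • g n) : IsBC φ g where
  map_smul := hg
  exists_lift {Q} _ _ q hq := by
    obtain ⟨h, hh⟩ := hgf.exists_lift (q.comp f) (fun a m => by simp [hf.map_smul, hq])
    refine ⟨h, fun n => ?_⟩
    let : Module B Q := Module.compHom Q φ
    let k : N →ₗ[B] Q :=
      { toFun := fun n => h (g n)
        map_add' := by simp
        map_smul' := fun b n => by rw [hg, h.map_smul]; rfl }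
    let k' : N →ₗ[B] Q :=
      { toFun := q
        map_add' := by simp
        map_smul' := fun b n => hq b n }
    exact LinearMap.congr_fun (hf.hom_ext k k' hh) n
  hom_ext h h' hh := hgf.hom_ext h h' fun m => hh (f m)

/-- Through θ⁻¹ the module M is already a B-module, so the identity of M extends to a map N → M,
which is inverse to `f`. -/
theorem bijective (hf : IsBC θ f) (hθ : Function.Bijective θ) : Function.Bijective f := by
  let e := RingEquiv.ofBijective θ hθ
  let : Module B M := Module.compHom M (e.symm : B →+* A)
  have he : ∀ a : A, e.symm (θ a) = a := fun a => e.symm_apply_apply a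
  have he' : ∀ b : B, θ (e.symm b) = b := fun b => e.apply_symm_apply b
  have hs : ∀ (b : B) (m : M), b • m = e.symm b • m := fun _ _ => rfl
  obtain ⟨h, hh⟩ := hf.exists_lift (AddMonoidHom.id M) (fun a m => by
    simp only [AddMonoidHom.id_apply, hs, he])
  let k : N →ₗ[B] N :=
    { toFun := fun n => f (h n)
      map_add' := by simp
      map_smul' := fun b n => by
        rw [h.map_smul, hs, hf.map_smul, he']; rfl }
  have hk : k = LinearMap.id := hf.hom_ext _ _ fun m => congrArg f (hh m)
  refine ⟨fun m m' hm => ?_, fun n => ⟨h n, LinearMap.congr_fun hk n⟩⟩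
  rw [← AddMonoidHom.id_apply M m, ← hh m, hm, hh m']; rfl

theorem of_bijective (hθ : Function.Bijective θ) (hf : Function.Bijective f)
    (h : ∀ a m, f (a • m) = θ a • f m) : IsBC θ f where
  map_smul := h
  exists_lift {Q} _ _ q hq := by
    let e := AddEquiv.ofBijective f hf
    have he : ∀ m, e.symm (f m) = m := fun m => e.symm_apply_apply m
    refine ⟨{ toFun := fun n => q (e.symm n), map_add' := by simp, map_smul' := ?_ },
      fun m => congrArg q (he m)⟩
    intro b n
    obtain ⟨a, rfl⟩ := hθ.2 b
    obtain ⟨m, rfl⟩ := hf.2 n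
    simp only [RingHom.id_apply]
    rw [← h, he, he, hq]
  hom_ext g g' hg := LinearMap.ext fun n => by
    obtain ⟨m, rfl⟩ := hf.2 n
    exact hg m

/-- Transport of a base change along semilinear isomorphisms. -/
theorem transport {A' B' : Type} [Ring A'] [Ring B'] {M' N' : Type} [AddCommGroup M']
    [AddCommGroup N'] [Module A' M'] [Module B' N'] {θ' : A' →+* B'} {f' : M' →+ N'}
    (hf : IsBC θ f) {a : A →+* A'} {b : B →+* B'} (ha : Function.Bijective a)
    (hb : Function.Bijective b) (hθ : ∀ x, b (θ x) = θ' (a x)) {α : M →+ M'} {β : N →+ N'}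
    (hα : Function.Bijective α) (hβ : Function.Bijective β)
    (hα' : ∀ x m, α (x • m) = a x • α m) (hβ' : ∀ x m, β (x • m) = b x • β m)
    (hfα : ∀ m, β (f m) = f' (α m)) : IsBC θ' f' := by
  have h1 := hf.comp (of_bijective hb hβ hβ')
  have e1 : b.comp θ = θ'.comp a := RingHom.ext hθ
  have e2 : β.comp f = f'.comp α := AddMonoidHom.ext hfα
  rw [e1, e2] at h1
  refine (of_bijective ha hα hα').cancel h1 fun x m => ?_
  obtain ⟨x, rfl⟩ := ha.2 x
  obtain ⟨m, rfl⟩ := hα.2 m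
  rw [← hα', ← hfα, hf.map_smul, hβ', hfα, hθ]

/-- Two additive maps, semilinear along the same homomorphism, which agree on the image of a base
change are equal. -/
theorem addHom_ext (hf : IsBC θ f) {h h' : N →+ P} (hh : ∀ b n, h (b • n) = φ b • h n)
    (hh' : ∀ b n, h' (b • n) = φ b • h' n) (e : ∀ m, h (f m) = h' (f m)) (n : N) :
    h n = h' n := by
  let : Module B P := Module.compHom P φ
  exact LinearMap.congr_fun (hf.hom_ext (Q := P)
    { toFun := h, map_add' := by simp, map_smul' := hh }
    { toFun := h', map_add' := by simp, map_smul' := hh' } e) n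

end IsBC

/-- Ties the concrete tensor product to its universal property, through which most later arguments
about base change run. -/
theorem isBC_ext (θ : A →+* B) (M : Type) [AddCommGroup M] [Module A M] :
    IsBC θ ({ toFun := fun m => Ext.tmul θ 1 m
              map_zero' := by simp [Ext.tmul]
              map_add' := fun x y => by simp [Ext.tmul, TensorProduct.tmul_add] } :
        M →+ Ext θ M) where
  map_smul a m := by
    have h : (1 * θ a) ⊗ₜ[ℤ] m - (1 : B) ⊗ₜ[ℤ] (a • m) ∈ tensorRel θ M :=
      Submodule.subset_span ⟨1, a, m, rfl⟩
    have h' := (Submodule.Quotient.eq _).mpr h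
    refine h'.symm.trans ?_
    change _ = Submodule.Quotient.mk (θ a • ((1 : B) ⊗ₜ[ℤ] m))
    rw [TensorProduct.smul_tmul', one_mul, smul_eq_mul, mul_one]
  exists_lift {Q} _ _ g hg := by
    let k : B →+ M →+ Q :=
      { toFun := fun b => (DistribSMul.toAddMonoidHom Q b).comp g
        map_zero' := by ext; simp
        map_add' := fun x y => by ext; simp [add_smul] }
    let k' : (B ⊗[ℤ] M) →+ Q := TensorProduct.liftAddHom k (fun z b m => by
      change (z • b) • g m = b • g (z • m)
      rw [map_zsmul, smul_assoc, smul_comm])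
    let k'' : (B ⊗[ℤ] M) →ₗ[B] Q :=
      { k' with
        map_smul' := fun b x => by
          induction x using TensorProduct.induction_on with
          | zero => simp
          | tmul c m => 
            change k' (b • c ⊗ₜ[ℤ] m) = b • k' (c ⊗ₜ[ℤ] m)
            rw [TensorProduct.smul_tmul']
            exact mul_smul b c (g m)
          | add x y hx hy =>
            simp only [smul_add] at *
            exact (map_add k' _ _).trans ((congrArg₂ (· + ·) hx hy).trans (by
              rw [← smul_add]; exact congrArg (b • ·) (map_add k' _ _).symm)) }
    refine ⟨Submodule.liftQ _ k'' ?_, fun m => one_smul B (g m)⟩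
    rw [tensorRel, Submodule.span_le]
    rintro _ ⟨s, r, m, rfl⟩
    rw [SetLike.mem_coe, LinearMap.mem_ker, map_sub, sub_eq_zero]
    change (s * θ r) • g m = s • g (r • m)
    rw [hg, mul_smul]
  hom_ext h h' hh := by
    refine LinearMap.ext fun x => ?_
    induction x using Ext.induction with
    | htmul s m =>
      have e : Ext.tmul θ s m = s • Ext.tmul θ 1 m := by
        change _ = Submodule.Quotient.mk (s • ((1 : B) ⊗ₜ[ℤ] m))
        rw [TensorProduct.smul_tmul', smul_eq_mul, mul_one]; rfl
      rw [e, map_smul, map_smul]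
      exact congrArg (s • ·) (hh m)
    | hadd x y hx hy => rw [map_add, map_add, hx, hy]

end BaseChange

/-! ### Ore localizations -/

section Ore

variable {A B C : Type} [Ring A] [Ring B] [Ring C]

/-- `θ : A → B` is the left Ore localization of `A` at the submonoid `Y`. -/
structure IsOre (θ : A →+* B) (Y : Submonoid A) : Prop where
  unit : ∀ y ∈ Y, IsUnit (θ y)
  frac : ∀ b, ∃ y ∈ Y, ∃ a, θ y * b = θ a
  ker : ∀ a, θ a = 0 → ∃ y ∈ Y, y * a = 0

namespace IsOre

variable {θ : A →+* B} {Y : Submonoid A}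

/-- Write θ(r) θ(s)⁻¹ as a left fraction θ(y)⁻¹ θ(a). The equation y r = a s then holds in B, and
one further denominator makes it hold in A. -/
theorem ore (H : IsOre θ Y) (r s : A) (hs : s ∈ Y) : ∃ y ∈ Y, ∃ a, y * r = a * s := by
  obtain ⟨u, hu⟩ := H.unit s hs
  obtain ⟨y, hy, a, ha⟩ := H.frac (θ r * ↑u⁻¹)
  have h : θ (y * r - a * s) = 0 := by
    rw [map_sub, map_mul, map_mul, ← ha, ← hu, mul_assoc, mul_assoc, Units.inv_mul, mul_one,
      sub_self]
  obtain ⟨z, hz, h⟩ := H.ker _ h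
  refine ⟨z * y, mul_mem hz hy, z * a, ?_⟩
  rwa [mul_sub, sub_eq_zero, ← mul_assoc, ← mul_assoc] at h

theorem cancel (H : IsOre θ Y) (r r' s : A) (hs : s ∈ Y) (h : r * s = r' * s) :
    ∃ y ∈ Y, y * r = y * r' := by
  obtain ⟨y, hy, h⟩ := H.ker (r - r') (by
    rw [map_sub, sub_eq_zero]
    have := congrArg θ h
    rw [map_mul, map_mul] at this
    exact (H.unit s hs).mul_right_cancel this)
  exact ⟨y, hy, by rwa [mul_sub, sub_eq_zero] at h⟩

/-- The Ore conditions. -/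
@[reducible]
def oreSet (H : IsOre θ Y) : OreLocalization.OreSet Y where
  ore_right_cancel r r' s h := by
    obtain ⟨y, hy, h⟩ := H.cancel r r' s s.2 h
    exact ⟨⟨y, hy⟩, h⟩
  oreNum r s := (H.ore r s s.2).choose_spec.2.choose
  oreDenom r s := ⟨(H.ore r s s.2).choose, (H.ore r s s.2).choose_spec.1⟩
  ore_eq r s := (H.ore r s s.2).choose_spec.2.choose_spec

theorem hom_ext (H : IsOre θ Y) {f g : B →+* C} (h : ∀ a, f (θ a) = g (θ a)) : f = g := by
  refine RingHom.ext fun b => ?_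
  obtain ⟨y, hy, a, ha⟩ := H.frac b
  have h1 := congrArg f ha
  have h2 := congrArg g ha
  rw [map_mul] at h1 h2
  rw [h, h, ← h2] at h1
  exact ((H.unit y hy).map g).mul_left_cancel h1

/-- The homomorphism from the Ore localization of Mathlib. -/
theorem exists_inv (H : IsOre θ Y) : letI := H.oreSet
    ∃ ρ : B →+* OreLocalization Y A, ∀ a, ρ (θ a) = OreLocalization.numeratorHom a := by
  let := H.oreSet
  have hf : ∀ s : Y, θ s = (H.unit s s.2).unit := fun s => rfl
  let fS : Y →* Bˣ :=
    { toFun := fun s => (H.unit s s.2).unit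
      map_one' := Units.ext (by simp)
      map_mul' := fun s t => Units.ext (by simp) }
  let φ := OreLocalization.universalHom θ fS (fun s => rfl)
  -- Injectivity is the axiom `ker` and surjectivity is the axiom `frac`.
  have hφ : Function.Bijective φ := by
    constructor
    · refine (injective_iff_map_eq_zero φ).mpr fun x => ?_
      induction x using OreLocalization.ind with
      | _ r s =>
        intro h
        have h0 : φ (OreLocalization.oreDiv r s) = ↑(fS s)⁻¹ * θ r :=
          OreLocalization.universalHom_apply _ _ _
        rw [h0] at h
        have h' : θ r = 0 := (Units.mul_right_eq_zero (fS s)⁻¹).mp h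
        obtain ⟨y, hy, e⟩ := H.ker r h'
        rw [← OreLocalization.zero_oreDiv' s, OreLocalization.oreDiv_eq_iff]
        refine ⟨⟨y, hy⟩, y, ?_, rfl⟩
        simpa using e.symm
    · intro b
      obtain ⟨y, hy, a, ha⟩ := H.frac b
      refine ⟨OreLocalization.oreDiv a ⟨y, hy⟩, ?_⟩
      refine (OreLocalization.universalHom_apply _ _ _).trans ?_
      rw [Units.inv_mul_eq_iff_eq_mul, ← ha]
      rfl
  let e := RingEquiv.ofBijective φ hφ
  refine ⟨e.symm, fun a => ?_⟩
  have : φ (OreLocalization.numeratorHom a) = θ a := OreLocalization.universalHom_commutes _ _ _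
  rw [← this]
  exact RingEquiv.symm_apply_apply e (OreLocalization.numeratorHom a)

/-- The universal property of an Ore localization. -/
theorem exists_lift (H : IsOre θ Y) (φ : A →+* C) (hφ : ∀ y ∈ Y, IsUnit (φ y)) :
    ∃ ψ : B →+* C, ∀ a, ψ (θ a) = φ a := by
  let := H.oreSet
  obtain ⟨ρ, hρ⟩ := H.exists_inv
  let fS : Y →* Cˣ :=
    { toFun := fun s => (hφ s s.2).unit
      map_one' := Units.ext (by simp)
      map_mul' := fun s t => Units.ext (by simp) }
  refine ⟨(OreLocalization.universalHom φ fS (fun s => rfl)).comp ρ, fun a => ?_⟩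
  rw [RingHom.comp_apply, hρ]
  exact OreLocalization.universalHom_commutes _ _ _

variable {M N : Type} [AddCommGroup M] [AddCommGroup N] [Module A M] [Module B N] {f : M →+ N}

/-- The submodule of fractions of elements of the image of a semilinear map. -/
def satur (H : IsOre θ Y) (f : M →+ N) (hf : ∀ a m, f (a • m) = θ a • f m) : Submodule B N where
  carrier := {n | ∃ y ∈ Y, ∃ m, θ y • n = f m}
  zero_mem' := ⟨1, one_mem Y, 0, by simp⟩
  add_mem' := by
    rintro n n' ⟨y, hy, m, h⟩ ⟨y', hy', m', h'⟩
    obtain ⟨z, hz, a, e⟩ := H.ore y y' hy'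
    refine ⟨z * y, mul_mem hz hy, z • m + a • m', ?_⟩
    rw [smul_add, map_add, hf, hf, ← h, ← h', smul_smul, smul_smul, ← map_mul, ← map_mul, e]
  smul_mem' := by
    rintro b n ⟨y, hy, m, h⟩
    obtain ⟨u, hu⟩ := H.unit y hy
    obtain ⟨z, hz, a, e⟩ := H.frac (b * ↑u⁻¹)
    refine ⟨z, hz, a • m, ?_⟩
    rw [hf, ← e, ← h, smul_smul, smul_smul, ← hu, mul_assoc, mul_assoc, Units.inv_mul, mul_one]

/-- The elements with this property form a B-submodule containing the image of `f`. The projection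
to the quotient by it agrees with zero on that image, hence is zero. -/
theorem frac_of_isBC (H : IsOre θ Y) (hf : IsBC θ f) (n : N) : ∃ y ∈ Y, ∃ m, θ y • n = f m := by
  have h : (H.satur f hf.map_smul).mkQ = 0 := hf.hom_ext _ _ fun m => by
    rw [LinearMap.zero_apply, Submodule.mkQ_apply, Submodule.Quotient.mk_eq_zero]
    exact ⟨1, one_mem Y, m, by simp⟩
  have h' := LinearMap.congr_fun h n
  rwa [LinearMap.zero_apply, Submodule.mkQ_apply, Submodule.Quotient.mk_eq_zero] at h'

/-- The Ore localization of M serves as a test module: m ↦ m/1 factors through `f`, so m/1 = 0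
there, and the equality criterion for fractions yields the denominator. -/
theorem ker_of_isBC (H : IsOre θ Y) (hf : IsBC θ f) {m : M} (hm : f m = 0) :
    ∃ y ∈ Y, y • m = 0 := by
  let := H.oreSet
  obtain ⟨ρ, hρ⟩ := H.exists_inv
  let : Module B (OreLocalization Y M) := Module.compHom _ ρ
  let g : M →+ OreLocalization Y M :=
    { toFun := fun m => OreLocalization.oreDiv m 1
      map_zero' := OreLocalization.zero_oreDiv 1
      map_add' := fun x y => (OreLocalization.add_oreDiv (R := A) (S := Y)).symm }
  obtain ⟨h, hh⟩ := hf.exists_lift g (fun a m => by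
    change OreLocalization.oreDiv (a • m) (1 : Y) = ρ (θ a) • OreLocalization.oreDiv m (1 : Y)
    rw [hρ, OreLocalization.numeratorHom_apply, OreLocalization.oreDiv_one_smul,
      OreLocalization.smul_oreDiv_one])
  have h0 : OreLocalization.oreDiv m (1 : Y) = OreLocalization.oreDiv (0 : M) (1 : Y) := by
    rw [OreLocalization.zero_oreDiv]
    exact (hh m).symm.trans (by rw [hm, map_zero])
  rw [OreLocalization.oreDiv_eq_iff] at h0
  obtain ⟨u, v, h1, h2⟩ := h0
  refine ⟨u, u.2, ?_⟩
  have h3 : (u : A) = v := by simpa using h2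
  rw [smul_zero] at h1
  rw [h3]
  exact h1.symm

/-- Converse of the two preceding lemmas; this is how the localizations of a graded module are
recognized as a descent datum. -/
theorem isBC (H : IsOre θ Y) (hs : ∀ a m, f (a • m) = θ a • f m)
    (hfrac : ∀ n, ∃ y ∈ Y, ∃ m, θ y • n = f m)
    (hker : ∀ m, f m = 0 → ∃ y ∈ Y, y • m = 0) : IsBC θ f where
  map_smul := hs
  exists_lift {Q} _ _ g hg := by
    -- G is the graph of the extension that is sought: all fractions of pairs (f m, g m). By `hfrac`
    -- and `hker` its projection to N is bijective.
    let G := H.satur (f.prod g) (fun a m => Prod.ext (hs a m) (hg a m))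
    have hG : ∀ q : Q, ((0, q) : N × Q) ∈ G → q = 0 := by
      rintro q ⟨y, hy, m, h⟩
      obtain ⟨h1, h2⟩ := Prod.ext_iff.mp h
      simp only [Prod.smul_fst, Prod.smul_snd, smul_zero, AddMonoidHom.prod_apply] at h1 h2
      obtain ⟨z, hz, e⟩ := hker m h1.symm
      have h3 : θ (z * y) • q = 0 := by
        rw [map_mul, mul_smul, h2, ← hg, e, map_zero]
      exact (H.unit _ (mul_mem hz hy)).smul_eq_zero.mp h3
    let p : G →ₗ[B] N := (LinearMap.fst B N Q).comp G.subtype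
    have hp : Function.Bijective p := by
      constructor
      · refine (injective_iff_map_eq_zero p).mpr ?_
        rintro ⟨⟨n, q⟩, hnq⟩ h
        obtain rfl : n = 0 := h
        exact Subtype.ext (Prod.ext rfl (hG q hnq))
      · intro n
        obtain ⟨y, hy, m, h⟩ := hfrac n
        obtain ⟨u, hu⟩ := H.unit y hy
        refine ⟨⟨(n, (↑u⁻¹ : B) • g m), y, hy, m, Prod.ext h ?_⟩, rfl⟩
        change θ y • (↑u⁻¹ : B) • g m = g m
        rw [smul_smul, ← hu, Units.mul_inv, one_smul]
    let e := LinearEquiv.ofBijective p hp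
    refine ⟨((LinearMap.snd B N Q).comp G.subtype).comp e.symm.toLinearMap, fun m => ?_⟩
    have : e.symm (f m) = ⟨(f m, g m), 1, one_mem Y, m, by simp⟩ := by
      rw [LinearEquiv.symm_apply_eq]; rfl
    change ((e.symm (f m)).1).2 = _
    rw [this]
  hom_ext h h' hh := LinearMap.ext fun n => by
    obtain ⟨y, hy, m, e⟩ := hfrac n
    obtain ⟨u, hu⟩ := H.unit y hy
    have h1 : θ y • h n = θ y • h' n := by
      rw [← map_smul, ← map_smul, e, hh]
    rw [← hu] at h1
    have h2 := congrArg (fun z => (↑u⁻¹ : B) • z) h1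
    simpa [smul_smul] using h2

end IsOre

end Ore

/-! ### Skew-polynomial rings and their monomials -/

section SkewAlgebra

variable {n : ℕ} {lam : Fin n → Fin n → ℂ}

namespace SkewPoly

theorem x_mul_x {i j : Fin n} (h : i < j) :
    x lam i * x lam j = lam i j • (x lam j * x lam i) := by
  have := RingQuot.mkAlgHom_rel ℂ (SkewRel.comm (lam := lam) i j h)
  rw [map_mul, map_smul, map_mul] at this
  exact this

/-- The universal property of the skew-polynomial ring: existence. -/
def lift {S : Type} [Ring S] [Algebra ℂ S] (f : Fin n → S)
    (hf : ∀ i j, i < j → f i * f j = lam i j • (f j * f i)) : SkewPoly n lam →ₐ[ℂ] S :=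
  RingQuot.liftAlgHom ℂ (s := SkewRel n lam) ⟨FreeAlgebra.lift ℂ f, by
    rintro _ _ ⟨i, j, h⟩
    simpa using hf i j h⟩

@[simp]
theorem lift_x {S : Type} [Ring S] [Algebra ℂ S] (f : Fin n → S)
    (hf : ∀ i j, i < j → f i * f j = lam i j • (f j * f i)) (i : Fin n) :
    lift f hf (x lam i) = f i := by
  change RingQuot.liftAlgHom ℂ _ (RingQuot.mkAlgHom ℂ _ _) = _
  rw [RingQuot.liftAlgHom_mkAlgHom_apply]
  simp

theorem induction {p : SkewPoly n lam → Prop} (hc : ∀ c : ℂ, p (algebraMap ℂ _ c))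
    (hx : ∀ i, p (x lam i)) (hadd : ∀ a b, p a → p b → p (a + b))
    (hmul : ∀ a b, p a → p b → p (a * b)) (r : SkewPoly n lam) : p r := by
  obtain ⟨r, rfl⟩ := RingQuot.mkAlgHom_surjective ℂ (SkewRel n lam) r
  induction r using FreeAlgebra.induction with
  | grade0 c => rw [AlgHom.commutes]; exact hc c
  | grade1 i => exact hx i
  | mul a b ha hb => rw [map_mul]; exact hmul _ _ ha hb
  | add a b ha hb => rw [map_add]; exact hadd _ _ ha hb

theorem x_mem_deg (i : Fin n) : x lam i ∈ deg n lam 1 := by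
  rw [deg, pow_one]
  exact Submodule.subset_span ⟨i, rfl⟩

theorem const_mem_deg (c : ℂ) : algebraMap ℂ (SkewPoly n lam) c ∈ deg n lam 0 := by
  rw [Algebra.algebraMap_eq_smul_one]
  exact Submodule.smul_mem _ _ (one_mem_deg lam)

theorem mul_mem_deg {d e : ℕ} {r s : SkewPoly n lam} (hr : r ∈ deg n lam d)
    (hs : s ∈ deg n lam e) : r * s ∈ deg n lam (d + e) := by
  rw [deg, pow_add]
  exact Submodule.mul_mem_mul hr hs

/-- Induction on homogeneous elements of a given degree. -/
theorem deg_induction {p : ℕ → SkewPoly n lam → Prop} (hc : ∀ c : ℂ, p 0 (algebraMap ℂ _ c))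
    (hadd : ∀ d a b, p d a → p d b → p d (a + b))
    (hmul : ∀ d i a, p d a → p (d + 1) (x lam i * a)) (h0 : ∀ d, p d 0)
    (hsmul : ∀ d (c : ℂ) a, p d a → p d (c • a)) {d : ℕ} {r : SkewPoly n lam}
    (hr : r ∈ deg n lam d) : p d r := by
  refine Submodule.pow_induction_on_left' _ (C := fun d r _ => p d r) hc
    (fun a b d _ _ ha hb => hadd d a b ha hb) (fun m hm d a _ ha => ?_) hr
  induction hm using Submodule.span_induction with
  | mem _ h => obtain ⟨i, rfl⟩ := h; exact hmul d i a ha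
  | zero => rw [zero_mul]; exact h0 _
  | add _ _ _ _ h1 h2 => rw [add_mul]; exact hadd _ _ _ h1 h2
  | smul c _ _ h => rw [smul_mul_assoc]; exact hsmul _ _ _ h

/-- The constructor `LocDeg.inv` accepts any degree in which the inverted element lies, so the
degree of a generator has to be shown unique. Killing the other generators maps degree d into the
multiples of Xᵈ in ℂ[X], and x_j goes to X. -/
theorem eq_one_of_x_mem_deg {j : Fin n} {d : ℕ} (h : x lam j ∈ deg n lam d) : d = 1 := by
  classical
  let ev : SkewPoly n lam →ₐ[ℂ] Polynomial ℂ :=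
    lift (fun i => if i = j then Polynomial.X else 0) (fun i k hik => by
      by_cases hi : i = j
      · have hk : k ≠ j := by rintro rfl; exact hik.ne hi
        simp [hk]
      · simp [hi])
  have key : ∃ c : ℂ, ev (x lam j) = c • Polynomial.X ^ d := by
    refine deg_induction (p := fun d r => ∃ c : ℂ, ev r = c • Polynomial.X ^ d) (fun c => ?_)
      ?_ ?_ (fun d => ⟨0, by simp⟩) ?_ h
    · exact ⟨c, by rw [AlgHom.commutes, pow_zero, Algebra.algebraMap_eq_smul_one]⟩
    · rintro d a b ⟨c, hc⟩ ⟨c', hc'⟩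
      exact ⟨c + c', by rw [map_add, hc, hc', add_smul]⟩
    · rintro d i a ⟨c, hc⟩
      by_cases hi : i = j
      · refine ⟨c, ?_⟩
        rw [map_mul, hc, lift_x, if_pos hi, mul_smul_comm, pow_succ']
      · exact ⟨0, by rw [map_mul, lift_x, if_neg hi]; simp⟩
    · rintro d c a ⟨c', hc'⟩
      exact ⟨c * c', by rw [map_smul, hc', smul_smul]⟩
  obtain ⟨c, hc⟩ := key
  rw [lift_x, if_pos rfl] at hc
  have h1 := congrArg (Polynomial.coeff · 1) hc
  simp only [Polynomial.coeff_X_one, Polynomial.coeff_smul, Polynomial.coeff_X_pow] at h1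
  by_contra hd
  rw [if_neg (Ne.symm hd)] at h1
  simp at h1

/-- The endomorphism of the skew-polynomial ring which multiplies `x_i` by `c i`. -/
def scale (c : Fin n → ℂ) : SkewPoly n lam →ₐ[ℂ] SkewPoly n lam :=
  lift (fun i => c i • x lam i) (fun i j h => by
    rw [smul_mul_smul_comm, smul_mul_smul_comm, x_mul_x h, smul_comm, mul_comm (c i)])

@[simp]
theorem scale_x (c : Fin n → ℂ) (i : Fin n) : scale c (x lam i) = c i • x lam i :=
  lift_x _ _ _

theorem scale_mem_deg (c : Fin n → ℂ) {d : ℕ} {r : SkewPoly n lam} (hr : r ∈ deg n lam d) :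
    scale c r ∈ deg n lam d := by
  refine deg_induction (p := fun d r => scale c r ∈ deg n lam d) (fun a => ?_)
    (fun d a b ha hb => ?_) (fun d i a ha => ?_) (fun d => ?_) (fun d a b hb => ?_) hr
  · rw [AlgHom.commutes]; exact const_mem_deg a
  · rw [map_add]; exact add_mem ha hb
  · rw [map_mul, scale_x, add_comm]
    exact mul_mem_deg (Submodule.smul_mem _ _ (x_mem_deg i)) ha
  · rw [map_zero]; exact zero_mem _
  · rw [map_smul]; exact Submodule.smul_mem _ _ hb

/-- The scalar `μ` with `x_i x_j = μ x_j x_i`. -/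
def mu (lam : Fin n → Fin n → ℂ) (i j : Fin n) : ℂ :=
  if i < j then lam i j else if j < i then (lam j i)⁻¹ else 1

theorem mu_ne_zero (hlam : ∀ i j : Fin n, i < j → lam i j ≠ 0) (i j : Fin n) :
    mu lam i j ≠ 0 := by
  rw [mu]
  split_ifs with h h'
  · exact hlam _ _ h
  · exact inv_ne_zero (hlam _ _ h')
  · exact one_ne_zero

theorem x_mul_x' (hlam : ∀ i j : Fin n, i < j → lam i j ≠ 0) (i j : Fin n) :
    x lam i * x lam j = mu lam i j • (x lam j * x lam i) := by
  rw [mu]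
  split_ifs with h h'
  · exact x_mul_x h
  · rw [x_mul_x h', smul_smul, inv_mul_cancel₀ (hlam _ _ h'), one_smul]
  · rw [le_antisymm (not_lt.mp h') (not_lt.mp h), one_smul]

/-- Generators are normal elements. This is the source of all Ore conditions below: in them a
denominator may be kept unchanged. -/
theorem x_mul (hlam : ∀ i j : Fin n, i < j → lam i j ≠ 0) (i : Fin n) (r : SkewPoly n lam) :
    x lam i * r = scale (mu lam i) r * x lam i := by
  induction r using SkewPoly.induction with
  | hc c => rw [AlgHom.commutes]; exact (Algebra.commutes c _).symm
  | hx j => rw [scale_x, x_mul_x' hlam, smul_mul_assoc]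
  | hadd a b ha hb => rw [mul_add, ha, hb, map_add, add_mul]
  | hmul a b ha hb => rw [← mul_assoc, ha, mul_assoc, hb, map_mul, mul_assoc]

end SkewPoly

open SkewPoly

/-- `Mon A d y` says that `y` is a nonzero multiple of a product of `d` generators which belong
to the set `A`. -/
inductive Mon (A : Set (SkewPoly n lam)) : ℕ → SkewPoly n lam → Prop
  | const {c : ℂ} (hc : c ≠ 0) : Mon A 0 (algebraMap ℂ _ c)
  | mul {i : Fin n} (hi : x lam i ∈ A) {d : ℕ} {y : SkewPoly n lam} (hy : Mon A d y) :
      Mon A (d + 1) (x lam i * y)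

namespace Mon

variable {A B : Set (SkewPoly n lam)} {d e : ℕ} {y z : SkewPoly n lam}

theorem mono (h : A ⊆ B) (hy : Mon A d y) : Mon B d y := by
  induction hy with
  | const hc => exact .const hc
  | mul hi _ ih => exact .mul (h hi) ih

theorem one : Mon A 0 (1 : SkewPoly n lam) := by
  simpa using Mon.const (A := A) one_ne_zero

theorem x {i : Fin n} (hi : SkewPoly.x lam i ∈ A) : Mon A 1 (SkewPoly.x lam i) := by
  simpa using Mon.mul hi one

theorem smul {c : ℂ} (hc : c ≠ 0) (hy : Mon A d y) : Mon A d (c • y) := by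
  induction hy with
  | const hc' =>
    rw [Algebra.smul_def, ← map_mul]
    exact .const (mul_ne_zero hc hc')
  | mul hi _ ih => rw [← mul_smul_comm]; exact .mul hi ih

theorem mul' (hy : Mon A d y) (hz : Mon A e z) : Mon A (d + e) (y * z) := by
  induction hy with
  | const hc => rw [← Algebra.smul_def, zero_add]; exact hz.smul hc
  | mul hi _ ih => rw [mul_assoc, add_right_comm]; exact .mul hi ih

theorem pow (hy : Mon A d y) (k : ℕ) : Mon A (k * d) (y ^ k) := by
  induction k with
  | zero => simpa using one
  | succ k ih => rw [pow_succ, add_mul, one_mul]; exact ih.mul' hy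

theorem xpow {i : Fin n} (hi : SkewPoly.x lam i ∈ A) (k : ℕ) :
    Mon A k (SkewPoly.x lam i ^ k) := by
  simpa using (Mon.x hi).pow k

theorem mem_deg (hy : Mon A d y) : y ∈ deg n lam d := by
  induction hy with
  | const c => exact const_mem_deg _
  | mul hi _ ih => rw [add_comm]; exact mul_mem_deg (x_mem_deg _) ih

theorem comm (hlam : ∀ i j : Fin n, i < j → lam i j ≠ 0) (hy : Mon A d y) :
    ∃ c : Fin n → ℂ, (∀ i, c i ≠ 0) ∧ ∀ r, y * r = scale c r * y := by
  induction hy with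
  | @const a ha =>
    refine ⟨fun _ => 1, fun _ => one_ne_zero, fun r => ?_⟩
    have : scale (lam := lam) (fun _ => 1) r = r := by
      induction r using SkewPoly.induction with
      | hc c => rw [AlgHom.commutes]
      | hx j => rw [scale_x, one_smul]
      | hadd a b ha hb => rw [map_add, ha, hb]
      | hmul a b ha hb => rw [map_mul, ha, hb]
    rw [this]; exact Algebra.commutes a r
  | @mul i hi d y _ ih =>
    obtain ⟨c, hc, h⟩ := ih
    refine ⟨fun j => mu lam i j * c j, fun j => mul_ne_zero (mu_ne_zero hlam i j) (hc j),
      fun r => ?_⟩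
    have : scale (lam := lam) (fun j => mu lam i j * c j) r = scale (mu lam i) (scale c r) := by
      induction r using SkewPoly.induction with
      | hc c => rw [AlgHom.commutes, AlgHom.commutes, AlgHom.commutes]
      | hx j => rw [scale_x, scale_x, map_smul, scale_x, smul_smul, mul_comm]
      | hadd a b ha hb => rw [map_add, ha, hb, map_add, map_add]
      | hmul a b ha hb => rw [map_mul, ha, hb, map_mul, map_mul]
    rw [mul_assoc, h, ← mul_assoc, x_mul hlam, this, mul_assoc]

theorem exists_scale {c : Fin n → ℂ} (hc : ∀ i, c i ≠ 0) (hy : Mon A d y) :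
    ∃ k : ℂ, k ≠ 0 ∧ scale c y = k • y := by
  induction hy with
  | const _ => exact ⟨1, one_ne_zero, by rw [AlgHom.commutes, one_smul]⟩
  | @mul i hi d y _ ih =>
    obtain ⟨k, hk, h⟩ := ih
    exact ⟨c i * k, mul_ne_zero (hc i) hk, by rw [map_mul, scale_x, h, smul_mul_smul_comm]⟩

theorem mul_comm' (hlam : ∀ i j : Fin n, i < j → lam i j ≠ 0) (hy : Mon A d y)
    (hz : Mon B e z) : ∃ k : ℂ, k ≠ 0 ∧ y * z = k • (z * y) := by
  obtain ⟨c, hc, h⟩ := hy.comm hlam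
  obtain ⟨k, hk, h'⟩ := hz.exists_scale hc
  exact ⟨k, hk, by rw [h, h', smul_mul_assoc]⟩

/-- Apply to r y = 0 the rescaling σ with y r = σ(r) y. It multiplies y by a nonzero scalar, so σ(r)
y = 0. -/
theorem cancel (hlam : ∀ i j : Fin n, i < j → lam i j ≠ 0) (hy : Mon A d y)
    {r : SkewPoly n lam} (h : r * y = 0) : y * r = 0 := by
  obtain ⟨c, hc, h1⟩ := hy.comm hlam
  obtain ⟨k, hk, h2⟩ := hy.exists_scale hc
  have h3 := congrArg (scale c) h
  rw [map_mul, h2, map_zero, mul_smul_comm] at h3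
  rw [h1]
  exact (smul_eq_zero.mp h3).resolve_left hk

end Mon

/-! ### Localizations of the skew-polynomial ring -/

/-- The submonoid of monomials in the elements of `A`. -/
def monSub (A : Set (SkewPoly n lam)) : Submonoid (SkewPoly n lam) where
  carrier := {y | ∃ d, Mon A d y}
  one_mem' := ⟨0, Mon.one⟩
  mul_mem' := fun ⟨_, hy⟩ ⟨_, hz⟩ => ⟨_, hy.mul' hz⟩

/-- The unit of `loc(R, A)` given by `x_i ∈ A`. -/
def xu {A : Set (SkewPoly n lam)} {i : Fin n} (hi : x lam i ∈ A) : (Loc (SkewPoly n lam) A)ˣ :=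
  ⟨Loc.of (SkewPoly n lam) A (x lam i), Loc.inv ⟨_, hi⟩,
    Loc.of_mul_inv (A := A) ⟨_, hi⟩, Loc.inv_mul_of (A := A) ⟨_, hi⟩⟩

theorem val_xu {A : Set (SkewPoly n lam)} {i : Fin n} (hi : x lam i ∈ A) :
    (xu hi : Loc (SkewPoly n lam) A) = Loc.of (SkewPoly n lam) A (x lam i) := rfl

theorem Loc.induction {R : Type} [Ring R] {A : Set R} {p : Loc R A → Prop}
    (hof : ∀ r, p (Loc.of R A r)) (hinv : ∀ a, p (Loc.inv a))
    (hadd : ∀ a b, p a → p b → p (a + b)) (hmul : ∀ a b, p a → p b → p (a * b)) (z : Loc R A) :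
    p z := by
  obtain ⟨z, rfl⟩ := RingQuot.mkRingHom_surjective (LocRel R A) z
  induction z using FreeAlgebra.induction with
  | grade0 c =>
    have h : RingQuot.mkRingHom (LocRel R A) (algebraMap ℤ _ c) = Loc.of R A c := by simp; rfl
    rw [h]; exact hof _
  | grade1 s =>
    rcases s with r | a
    · exact hof r
    · exact hinv a
  | mul a b ha hb => rw [map_mul]; exact hmul _ _ ha hb
  | add a b ha hb => rw [map_add]; exact hadd _ _ ha hb

section

variable {A B : Set (SkewPoly n lam)}

theorem of_smul (c : ℂ) (r : SkewPoly n lam) :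
    Loc.of (SkewPoly n lam) A (c • r) = Loc.of (SkewPoly n lam) A (algebraMap ℂ _ c) * Loc.of (SkewPoly n lam) A r := by
  rw [Algebra.smul_def, map_mul]

theorem of_mul_of_mul {y y' r r' r'' : SkewPoly n lam} {b b' : Loc (SkewPoly n lam) A}
    (h : Loc.of (SkewPoly n lam) A y * b = Loc.of (SkewPoly n lam) A r)
    (h' : Loc.of (SkewPoly n lam) A y' * b' = Loc.of (SkewPoly n lam) A r')
    (hc : y' * r = r'' * y') :
    Loc.of (SkewPoly n lam) A (y' * y) * (b * b') = Loc.of (SkewPoly n lam) A (r'' * r') := by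
  rw [map_mul, mul_assoc, ← mul_assoc (Loc.of (SkewPoly n lam) A y) b, h, ← mul_assoc, ← map_mul,
    hc, map_mul, mul_assoc, h', map_mul]

theorem LocDeg.one : LocDeg lam A 0 (1 : Loc (SkewPoly n lam) A) := by
  simpa using LocDeg.of (A := A) (one_mem_deg lam)

theorem locDeg_xu {i : Fin n} (hi : x lam i ∈ A) : LocDeg lam A 1 (xu hi : Loc (SkewPoly n lam) A) := by
  rw [val_xu]; simpa using LocDeg.of (A := A) (x_mem_deg i)

theorem locDeg_xu_inv {i : Fin n} (hi : x lam i ∈ A) :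
    LocDeg lam A (-1) (↑(xu hi)⁻¹ : Loc (SkewPoly n lam) A) :=
  LocDeg.inv (A := A) (d := 1) ⟨_, hi⟩ (x_mem_deg i)

theorem locDeg_zpow {i : Fin n} (hi : x lam i ∈ A) (k : ℤ) :
    LocDeg lam A k (↑(xu hi ^ k) : Loc (SkewPoly n lam) A) := by
  induction k using Int.induction_on with
  | zero => simpa using LocDeg.one
  | succ k ih =>
    rw [zpow_add_one, Units.val_mul]
    exact ih.mul (locDeg_xu hi)
  | pred k ih =>
    rw [zpow_sub_one, Units.val_mul]
    exact ih.mul (locDeg_xu_inv hi)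

theorem Mon.exists_inv {d : ℕ} {y : SkewPoly n lam} (hy : Mon A d y) :
    ∃ w, LocDeg lam A (-d) w ∧ Loc.of (SkewPoly n lam) A y * w = 1 ∧ w * Loc.of (SkewPoly n lam) A y = 1 := by
  induction hy with
  | @const c hc =>
    refine ⟨Loc.of (SkewPoly n lam) A (algebraMap ℂ _ c⁻¹), LocDeg.of (const_mem_deg _), ?_, ?_⟩ <;>
      rw [← map_mul, ← map_mul] <;> simp [hc]
  | @mul i hi d y _ ih =>
    obtain ⟨w, hw, h1, h2⟩ := ih
    refine ⟨w * ↑(xu hi)⁻¹, ?_, ?_, ?_⟩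
    · have := hw.mul (locDeg_xu_inv hi)
      rwa [← neg_add, ← Nat.cast_succ] at this
    · rw [map_mul, mul_assoc, ← mul_assoc _ w, h1, one_mul, ← val_xu hi]
      exact (xu hi).mul_inv
    · rw [map_mul, mul_assoc, ← mul_assoc _ _ (Loc.of (SkewPoly n lam) A y), ← val_xu hi,
        Units.inv_mul, one_mul, h2]

theorem Mon.isUnit {d : ℕ} {y : SkewPoly n lam} (hy : Mon A d y) : IsUnit (Loc.of (SkewPoly n lam) A y) := by
  obtain ⟨w, _, h1, h2⟩ := hy.exists_inv
  exact ⟨⟨_, w, h1, h2⟩, rfl⟩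

variable (hlam : ∀ i j : Fin n, i < j → lam i j ≠ 0)
include hlam

/-- Homogeneous elements of a localization are fractions of homogeneous elements. -/
theorem LocDeg.exists_frac (hA : A ⊆ Set.range (x lam)) {m : ℤ} {b : Loc (SkewPoly n lam) A}
    (hb : LocDeg lam A m b) : ∃ d y, Mon A d y ∧ ∃ e : ℕ, ∃ r ∈ SkewPoly.deg n lam e,
      (e : ℤ) = d + m ∧ Loc.of (SkewPoly n lam) A y * b = Loc.of (SkewPoly n lam) A r := by
  induction hb with
  | @of d r hr => exact ⟨0, 1, Mon.one, d, r, hr, by simp, by simp⟩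
  | @inv d a ha =>
    obtain ⟨a, h⟩ := a
    obtain ⟨i, rfl⟩ := hA h
    obtain rfl := eq_one_of_x_mem_deg ha
    exact ⟨1, x lam i, Mon.x h, 0, 1, one_mem_deg lam, by simp, by
      rw [map_one]; exact Loc.of_mul_inv (A := A) ⟨_, h⟩⟩
  | add _ _ h1 h2 =>
    obtain ⟨d, y, hy, e, r, hr, he, h⟩ := h1
    obtain ⟨d', y', hy', e', r', hr', he', h'⟩ := h2
    -- The common denominator is y' y. It clears both fractions because it is a scalar multiple of y
    -- y'.
    obtain ⟨k, hk, hc⟩ := hy'.mul_comm' hlam hy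
    refine ⟨d' + d, y' * y, hy'.mul' hy, d' + e, y' * r + k • (y * r'), ?_, ?_, ?_⟩
    · refine add_mem (mul_mem_deg hy'.mem_deg hr) (Submodule.smul_mem _ _ ?_)
      have h3 : d' + e = d + e' := by omega
      rw [h3]; exact mul_mem_deg hy.mem_deg hr'
    · push_cast; omega
    · rw [mul_add, map_add, map_mul, mul_assoc, h, ← map_mul, ← map_mul, hc, of_smul, of_smul,
        mul_assoc, map_mul _ y y', mul_assoc, h', ← map_mul _ y r']
  | neg _ h1 =>
    obtain ⟨d, y, hy, e, r, hr, he, h⟩ := h1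
    exact ⟨d, y, hy, e, -r, neg_mem hr, he, by rw [mul_neg, h, map_neg]⟩
  | mul _ _ h1 h2 =>
    obtain ⟨d, y, hy, e, r, hr, he, h⟩ := h1
    obtain ⟨d', y', hy', e', r', hr', he', h'⟩ := h2
    obtain ⟨c, _, hc⟩ := hy'.comm hlam
    refine ⟨d' + d, y' * y, hy'.mul' hy, e + e', scale c r * r',
      mul_mem_deg (scale_mem_deg c hr) hr', by push_cast; omega, ?_⟩
    exact of_mul_of_mul h h' (hc r)

theorem exists_frac (hA : A ⊆ Set.range (x lam)) (b : Loc (SkewPoly n lam) A) :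
    ∃ y ∈ monSub A, ∃ r, Loc.of (SkewPoly n lam) A y * b = Loc.of (SkewPoly n lam) A r := by
  induction b using Loc.induction with
  | hof r => exact ⟨1, one_mem _, r, by simp⟩
  | hinv a =>
    obtain ⟨i, hi⟩ := hA a.2
    exact ⟨a, ⟨1, by rw [← hi]; exact Mon.x (by rw [hi]; exact a.2)⟩, 1, by
      rw [map_one]; exact Loc.of_mul_inv _⟩
  | hadd a b h1 h2 =>
    obtain ⟨y, ⟨d, hy⟩, r, h⟩ := h1
    obtain ⟨y', ⟨d', hy'⟩, r', h'⟩ := h2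
    obtain ⟨k, hk, hc⟩ := hy'.mul_comm' hlam hy
    refine ⟨y' * y, ⟨_, hy'.mul' hy⟩, y' * r + k • (y * r'), ?_⟩
    rw [mul_add, map_add, map_mul, mul_assoc, h, ← map_mul, ← map_mul, hc, of_smul, of_smul,
        mul_assoc, map_mul _ y y', mul_assoc, h', ← map_mul _ y r']
  | hmul a b h1 h2 =>
    obtain ⟨y, ⟨d, hy⟩, r, h⟩ := h1
    obtain ⟨y', ⟨d', hy'⟩, r', h'⟩ := h2
    obtain ⟨c, _, hc⟩ := hy'.comm hlam
    refine ⟨y' * y, ⟨_, hy'.mul' hy⟩, scale c r * r', ?_⟩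
    exact of_mul_of_mul h h' (hc r)

/-- By normality the monomials in A form a left Ore set, and loc(R, A) maps to the Ore localization.
There r becomes r/1 = 0, which means that a monomial kills r. -/
theorem exists_mul_eq_zero (hA : A ⊆ Set.range (x lam)) {r : SkewPoly n lam}
    (hr : Loc.of (SkewPoly n lam) A r = 0) : ∃ y ∈ monSub A, y * r = 0 := by
  have hex : ∀ (r : SkewPoly n lam) (s : monSub A), ∃ r', (s : SkewPoly n lam) * r = r' * s := by
    rintro r ⟨s, d, hs⟩
    obtain ⟨c, _, hc⟩ := hs.comm hlam
    exact ⟨_, hc r⟩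
  let : OreLocalization.OreSet (monSub A) :=
    { ore_right_cancel := fun r r' s h => by
        refine ⟨s, ?_⟩
        obtain ⟨s, d, hs⟩ := s
        rw [← sub_eq_zero, ← sub_mul] at h
        have := hs.cancel hlam h
        rwa [mul_sub, sub_eq_zero] at this
      oreNum := fun r s => (hex r s).choose
      oreDenom := fun _ s => s
      ore_eq := fun r s => (hex r s).choose_spec }
  let φ : Loc (SkewPoly n lam) A →+* OreLocalization (monSub A) (SkewPoly n lam) :=
    Loc.lift OreLocalization.numeratorRingHom (fun a ha => by
      obtain ⟨i, rfl⟩ := hA ha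
      exact OreLocalization.numerator_isUnit (⟨x lam i, 1, Mon.x ha⟩ : monSub A))
  have h0 : OreLocalization.oreDiv r (1 : monSub A) = 0 := by
    have hφ : φ (Loc.of (SkewPoly n lam) A r) = OreLocalization.numeratorRingHom r :=
      Loc.lift_of _ _ _
    rw [hr, map_zero] at hφ
    exact hφ.symm
  rw [← OreLocalization.zero_oreDiv' (1 : monSub A), OreLocalization.oreDiv_eq_iff] at h0
  obtain ⟨u, v, h1, h2⟩ := h0
  have h3 : (u : SkewPoly n lam) = v := by simpa using h2
  refine ⟨u, u.2, ?_⟩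
  rw [h3, ← smul_eq_mul, ← h1]
  simp

theorem isOre_of (hA : A ⊆ Set.range (x lam)) :
    IsOre (Loc.of (SkewPoly n lam) A) (monSub A) where
  unit := fun _ ⟨_, hy⟩ => hy.isUnit
  frac := exists_frac hlam hA
  ker := fun _ => exists_mul_eq_zero hlam hA

end

end SkewAlgebra

/-! ### Degree zero components of localizations -/

section Charts

open SkewPoly

variable {n : ℕ} {lam : Fin n → Fin n → ℂ}

/-- The nonempty sets of generators. -/
abbrev Idx (lam : Fin n → Fin n → ℂ) : Type :=
  {A : Set (SkewPoly n lam) // (∃ i, x lam i ∈ A) ∧ A ⊆ Set.range (x lam)}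

/-- The union of two sets of generators. -/
def Idx.union (A B : Idx lam) : Idx lam :=
  ⟨A.1 ∪ B.1, ⟨A.2.1.choose, Or.inl A.2.1.choose_spec⟩, Set.union_subset A.2.2 B.2.2⟩

theorem Idx.le_union_left (A B : Idx lam) : A ≤ A.union B := Set.subset_union_left
theorem Idx.le_union_right (A B : Idx lam) : B ≤ A.union B := Set.subset_union_right
theorem Idx.union_le {A B C : Idx lam} (hA : A ≤ C) (hB : B ≤ C) : A.union B ≤ C :=
  Set.union_subset hA hB

/-- The degree zero component of the localization at a set of generators. -/
abbrev RA (A : Idx lam) : Type := degZero lam A.1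

/-- The localization of the skew-polynomial ring at a set of generators. -/
abbrev SA (A : Idx lam) : Type := Loc (SkewPoly n lam) A.1

/-- The canonical map to a localization. -/
abbrev ofA (A : Idx lam) : SkewPoly n lam →+* SA A := Loc.of _ A.1

/-- The canonical map between localizations. -/
def resS {A B : Idx lam} (h : A ≤ B) : SA A →+* SA B :=
  Loc.map (RingHom.id _) (isUnit_of_subset lam h)

/-- The canonical map between degree zero components. -/
def res {A B : Idx lam} (h : A ≤ B) : RA A →+* RA B := degZeroMap lam h

theorem coe_res {A B : Idx lam} (h : A ≤ B) (a : RA A) : (res h a : SA B) = resS h a := rfl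

@[simp]
theorem resS_of {A B : Idx lam} (h : A ≤ B) (r : SkewPoly n lam) :
    resS h (ofA A r) = ofA B r := Loc.map_of _ _ _

@[simp]
theorem resS_refl (A : Idx lam) (a : SA A) : resS (le_refl A) a = a := by
  have : resS (le_refl A) = RingHom.id _ := Loc.hom_ext (fun r => resS_of (le_refl A) r)
  rw [this]; rfl

@[simp]
theorem resS_resS {A B C : Idx lam} (h : A ≤ B) (h' : B ≤ C) (a : SA A) :
    resS h' (resS h a) = resS (h.trans h') a := by
  have : (resS h').comp (resS h) = resS (h.trans h') := Loc.hom_ext (fun r => by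
    rw [RingHom.comp_apply, resS_of, resS_of, resS_of])
  rw [← this]; rfl

@[simp]
theorem res_refl (A : Idx lam) (a : RA A) : res (le_refl A) a = a :=
  Subtype.ext (resS_refl A a)

@[simp]
theorem res_res {A B C : Idx lam} (h : A ≤ B) (h' : B ≤ C) (a : RA A) :
    res h' (res h a) = res (h.trans h') a :=
  Subtype.ext (resS_resS h h' a)

@[simp]
theorem resS_xu {A B : Idx lam} (h : A ≤ B) {i : Fin n} (hi : x lam i ∈ A.1) :
    resS h (xu hi) = xu (A := B.1) (h hi) := resS_of h _

theorem map_xu {A B : Idx lam} (h : A ≤ B) {i : Fin n} (hi : x lam i ∈ A.1) :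
    Units.map (resS h).toMonoidHom (xu hi) = xu (A := B.1) (h hi) := Units.ext (resS_xu h hi)

@[simp]
theorem resS_zpow {A B : Idx lam} (h : A ≤ B) {i : Fin n} (hi : x lam i ∈ A.1) (k : ℤ) :
    resS h ↑(xu hi ^ k) = ↑(xu (A := B.1) (h hi) ^ k) := by
  rw [← map_xu h hi, ← map_zpow]; rfl

theorem isUnit_degZero {A : Set (SkewPoly n lam)} {a : degZero lam A} {w : Loc (SkewPoly n lam) A}
    (hw : LocDeg lam A 0 w) (h1 : (a : Loc (SkewPoly n lam) A) * w = 1)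
    (h2 : w * (a : Loc (SkewPoly n lam) A) = 1) : IsUnit a :=
  ⟨⟨a, ⟨w, hw⟩, Subtype.ext h1, Subtype.ext h2⟩, rfl⟩

/-- The element `x_i⁻ᵈ r` of degree zero. -/
def divx {A : Idx lam} {i : Fin n} (hi : x lam i ∈ A.1) {d : ℕ} {r : SkewPoly n lam}
    (hr : r ∈ deg n lam d) : RA A :=
  ⟨↑(xu hi ^ (-(d : ℤ))) * ofA A r, by
    have h := (locDeg_zpow hi (-(d : ℤ))).mul (LocDeg.of (A := A.1) hr)
    rw [neg_add_cancel] at h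
    exact h⟩

theorem xpow_mul_divx {A : Idx lam} {i : Fin n} (hi : x lam i ∈ A.1) {d : ℕ}
    {r : SkewPoly n lam} (hr : r ∈ deg n lam d) :
    ofA A (x lam i ^ d) * (divx hi hr : SA A) = ofA A r := by
  have : ofA A (x lam i ^ d) = ↑(xu hi ^ d) := by rw [map_pow, Units.val_pow_eq_pow_val]; rfl
  rw [this, divx, ← mul_assoc, ← Units.val_mul, zpow_neg, zpow_natCast, mul_inv_cancel,
    Units.val_one, one_mul]

theorem isUnit_xpow {A : Idx lam} {i : Fin n} (hi : x lam i ∈ A.1) (d : ℕ) :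
    IsUnit (ofA A (x lam i ^ d)) := (Mon.xpow hi d).isUnit

theorem eq_divx {A : Idx lam} {i : Fin n} (hi : x lam i ∈ A.1) {d : ℕ}
    {r : SkewPoly n lam} (hr : r ∈ deg n lam d) {a : RA A}
    (h : ofA A (x lam i ^ d) * (a : SA A) = ofA A r) : a = divx hi hr :=
  Subtype.ext ((isUnit_xpow hi d).mul_left_cancel (h.trans (xpow_mul_divx hi hr).symm))

/-- The fraction `x_i⁻¹ x_j`. -/
def ratio {A : Idx lam} {i : Fin n} (hi : x lam i ∈ A.1) (j : Fin n) : RA A :=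
  divx hi (x_mem_deg j)

/-- The constant `c`, as an element of degree zero. -/
def constA (A : Idx lam) (c : ℂ) : RA A :=
  ⟨ofA A (algebraMap ℂ _ c), LocDeg.of (const_mem_deg c)⟩

theorem isUnit_constA (A : Idx lam) {c : ℂ} (hc : c ≠ 0) : IsUnit (constA A c) :=
  isUnit_degZero (w := ofA A (algebraMap ℂ _ c⁻¹)) (LocDeg.of (const_mem_deg _))
    (by simp only [constA]; rw [← map_mul, ← map_mul, mul_inv_cancel₀ hc]; simp)
    (by simp only [constA]; rw [← map_mul, ← map_mul, inv_mul_cancel₀ hc]; simp)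

variable (hlam : ∀ i j : Fin n, i < j → lam i j ≠ 0)
include hlam

/-- The denominators `x_i⁻ᵈ y` for monomials `y` of degree `d` in the elements of `B`. -/
def den {A : Idx lam} {i : Fin n} (hi : x lam i ∈ A.1) (B : Idx lam) : Submonoid (RA A) where
  carrier := {u | ∃ d y, Mon B.1 d y ∧ ofA A (x lam i ^ d) * (u : SA A) = ofA A y}
  one_mem' := ⟨0, 1, Mon.one, by simp⟩
  mul_mem' := by
    rintro u u' ⟨d, y, hy, h⟩ ⟨d', y', hy', h'⟩
    obtain ⟨k, hk, hc⟩ := (Mon.xpow hi d').mul_comm' hlam hy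
    refine ⟨d' + d, k • (y * y'), by rw [add_comm]; exact (hy.mul' hy').smul hk, ?_⟩
    rw [pow_add, Subring.coe_mul, ← smul_mul_assoc]
    refine of_mul_of_mul h h' ?_
    rw [hc, smul_mul_assoc]

theorem divx_mem_den {A B : Idx lam} {i : Fin n} (hi : x lam i ∈ A.1) {d : ℕ}
    {y : SkewPoly n lam} (hy : Mon B.1 d y) : divx hi hy.mem_deg ∈ den hlam hi B :=
  ⟨d, y, hy, xpow_mul_divx hi _⟩

/-- A degree zero fraction y⁻¹ r, with y and r of the same degree d, equals (x_i⁻ᵈ y)⁻¹ (x_i⁻ᵈ r), a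
fraction of elements of R_A. Any generator in A can play the role of x_i. -/
theorem isOre_res {A B : Idx lam} (h : A ≤ B) {i : Fin n} (hi : x lam i ∈ A.1) :
    IsOre (res h) (den hlam hi B) where
  unit := by
    rintro u ⟨d, y, hy, hu⟩
    obtain ⟨w, hw, h1, h2⟩ := hy.exists_inv
    have hu' : ofA B (x lam i ^ d) * (res h u : SA B) = ofA B y := by
      rw [coe_res, ← resS_of h, ← map_mul, hu, resS_of]
    refine isUnit_degZero (w := w * ofA B (x lam i ^ d)) ?_ ?_ ?_
    · simpa using hw.mul (LocDeg.of (A := B.1) (Mon.xpow (h hi) d).mem_deg)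
    · refine (isUnit_xpow (h hi) d).mul_left_cancel ?_
      rw [← mul_assoc, hu', ← mul_assoc, h1, one_mul, mul_one]
    · rw [mul_assoc, hu', h2]
  frac b := by
    obtain ⟨d, y, hy, e, r, hr, he, hb⟩ := LocDeg.exists_frac hlam B.2.2 b.2
    -- Degree zero forces the numerator and the denominator to have equal degrees.
    obtain rfl : e = d := by omega
    refine ⟨divx hi hy.mem_deg, divx_mem_den hlam hi hy, divx hi hr, Subtype.ext ?_⟩
    refine (isUnit_xpow (h hi) e).mul_left_cancel ?_
    rw [Subring.coe_mul, ← mul_assoc, coe_res, coe_res, ← resS_of h, ← map_mul, ← map_mul,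
      xpow_mul_divx, xpow_mul_divx, resS_of, resS_of, hb]
  ker a ha := by
    obtain ⟨d, y, hy, e, r, hr, he, hb⟩ := LocDeg.exists_frac hlam A.2.2 a.2
    have h0 : ofA B r = 0 := by
      rw [← resS_of h, ← hb, map_mul, ← coe_res, ha]; simp
    obtain ⟨z, ⟨f, hz⟩, hzr⟩ := exists_mul_eq_zero hlam B.2.2 h0
    have hzy := hz.mul' (hy.mono h)
    refine ⟨divx hi hzy.mem_deg, divx_mem_den hlam hi hzy, Subtype.ext ?_⟩
    refine (isUnit_xpow hi (f + d)).mul_left_cancel ?_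
    rw [Subring.coe_mul, ← mul_assoc, xpow_mul_divx, map_mul, mul_assoc, hb, ← map_mul, hzr]
    simp

theorem res_hom_ext {A B : Idx lam} (h : A ≤ B) {Q : Type} [Ring Q] {f g : RA B →+* Q}
    (hfg : ∀ a, f (res h a) = g (res h a)) : f = g := by
  obtain ⟨i, hi⟩ := A.2.1
  exact (isOre_res hlam h hi).hom_ext hfg

/-- Since x_iᵈ and x_j commute up to a nonzero scalar, every denominator is a constant times a
product of ratios x_i⁻¹ x_j, so it is enough to invert finitely many elements. -/
theorem isUnit_of_mem_den {A B : Idx lam} {i : Fin n} (hi : x lam i ∈ A.1) {Q : Type} [Ring Q]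
    (φ : RA A →+* Q) (hφ : ∀ j, x lam j ∈ B.1 → IsUnit (φ (ratio hi j))) {u : RA A}
    (hu : u ∈ den hlam hi B) : IsUnit (φ u) := by
  obtain ⟨d, y, hy, hu⟩ := hu
  induction hy generalizing u with
  | @const c hc =>
    have : u = constA A c := Subtype.ext (by simpa [constA] using hu)
    rw [this]
    exact (isUnit_constA A hc).map φ
  | @mul j hj d y hy ih =>
    obtain ⟨k, hk, hc⟩ := (Mon.xpow hi d).mul_comm' hlam (Mon.x hj)
    have hu' : u = constA A k⁻¹ * (ratio hi j * divx hi hy.mem_deg) := by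
      refine Subtype.ext ((isUnit_xpow hi (d + 1)).mul_left_cancel ?_)
      rw [hu]
      have h1 : ofA A (x lam i ^ (d + 1)) * ((ratio hi j * divx hi hy.mem_deg : RA A) : SA A) =
          ofA A ((k • x lam j) * y) := by
        rw [pow_add, Subring.coe_mul]
        refine of_mul_of_mul (xpow_mul_divx hi (x_mem_deg j)) (xpow_mul_divx hi _) ?_
        rw [hc, smul_mul_assoc]
      rw [Subring.coe_mul, constA, ← mul_assoc, ← map_mul, ← Algebra.commutes,
        map_mul _ (algebraMap ℂ _ k⁻¹), mul_assoc, h1, ← map_mul (ofA A), ← Algebra.smul_def, smul_mul_assoc, smul_smul, inv_mul_cancel₀ hk, one_smul]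
    rw [hu', map_mul, map_mul]
    exact ((isUnit_constA A (inv_ne_zero hk)).map φ).mul
      ((hφ j hj).mul (ih (xpow_mul_divx hi _)))

/-- The universal property of the restriction maps. -/
theorem exists_lift_res {A B : Idx lam} (h : A ≤ B) {i : Fin n} (hi : x lam i ∈ A.1) {Q : Type}
    [Ring Q] (φ : RA A →+* Q) (hφ : ∀ j, x lam j ∈ B.1 → IsUnit (φ (ratio hi j))) :
    ∃ ψ : RA B →+* Q, ∀ a, ψ (res h a) = φ a :=
  (isOre_res hlam h hi).exists_lift φ fun _ hu => isUnit_of_mem_den hlam hi φ hφ hu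

omit hlam in
theorem res_divx {A B : Idx lam} (h : A ≤ B) {i : Fin n} (hi : x lam i ∈ A.1) {d : ℕ}
    {r : SkewPoly n lam} (hr : r ∈ deg n lam d) :
    res h (divx hi hr) = divx (A := B) (h hi) hr := by
  refine Subtype.ext ?_
  rw [coe_res, divx, divx, map_mul, resS_zpow, resS_of]

end Charts

/-! ### The localizations of all charts -/

section Nodes

open SkewPoly

variable {n : ℕ} {lam : Fin n → Fin n → ℂ}

theorem L0.mem_union_image {R R' S : Type} [Ring R] [Ring R'] [Ring S] {θ : R →+* S}
    {θ' : R' →+* S} {F : L0 R} {F' : L0 R'} {a : S} :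
    a ∈ (((F.image θ).union (F'.image θ')).fin : Set S) ↔
      (∃ b ∈ F.fin, θ b = a) ∨ ∃ b ∈ F'.fin, θ' b = a := by
  classical
  simp only [L0.union, L0.image, Finset.coe_union, Set.mem_union, Finset.mem_coe,
    Finset.mem_image]

/-- A finite subset of the degree zero component of the localization at a set of generators. -/
structure Node (lam : Fin n → Fin n → ℂ) where
  /-- the set of generators -/
  set : Idx lam
  /-- the finite subset -/
  fin : L0 (RA set)

namespace Node

instance : LE (Node lam) := ⟨fun j k => ∃ h : j.set ≤ k.set, j.fin.image (res h) ≤ k.fin⟩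

/-- The localization which belongs to a node. -/
abbrev T (j : Node lam) : Type := LocF j.fin

/-- The canonical map to the localization. -/
abbrev alg (j : Node lam) : RA j.set →+* j.T := Loc.of _ _

/-- The canonical map between the localizations of two nodes. -/
def tm {j k : Node lam} (h : j ≤ k) : j.T →+* k.T := locMap (res h.fst) h.snd

@[simp]
theorem tm_alg {j k : Node lam} (h : j ≤ k) (a : RA j.set) :
    tm h (j.alg a) = k.alg (res h.fst a) := locMap_of _ _ _

theorem le_iff {j k : Node lam} : j ≤ k ↔ ∃ h : j.set ≤ k.set,
    ∀ a ∈ (j.fin.fin : Set (RA j.set)), IsUnit (k.alg (res h a)) :=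
  exists_congr fun _ => L0.image_le_iff

instance : Preorder (Node lam) where
  le_refl j := le_iff.mpr ⟨le_rfl, fun a ha => by rw [res_refl]; exact Loc.isUnit_of ha⟩
  le_trans j k l h h' := le_iff.mpr ⟨h.fst.trans h'.fst, fun a ha => by
    rw [← res_res h.fst h'.fst, ← tm_alg h']
    exact ((le_iff.mp h).snd a ha).map _⟩

@[simp]
theorem tm_refl (j : Node lam) (z : j.T) : tm (le_refl j) z = z := by
  have : tm (le_refl j) = RingHom.id _ := Loc.hom_ext fun r => by
    refine (tm_alg _ r).trans ?_
    rw [res_refl]; rfl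
  rw [this]; rfl

@[simp]
theorem tm_tm {j k l : Node lam} (h : j ≤ k) (h' : k ≤ l) (z : j.T) :
    tm h' (tm h z) = tm (h.trans h') z := by
  have : (tm h').comp (tm h) = tm (h.trans h') := Loc.hom_ext fun r => by
    refine (congrArg _ (tm_alg h r)).trans ((tm_alg h' _).trans ?_)
    rw [res_res]; exact (tm_alg (h.trans h') r).symm
  rw [← this]; rfl

/-- The union of two nodes. -/
def join (j k : Node lam) : Node lam :=
  ⟨j.set.union k.set, (j.fin.image (res (j.set.le_union_left k.set))).union
    (k.fin.image (res (j.set.le_union_right k.set)))⟩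

theorem le_join_left (j k : Node lam) : j ≤ join j k := ⟨_, L0.le_union_left _ _⟩

theorem le_join_right (j k : Node lam) : k ≤ join j k := ⟨_, L0.le_union_right _ _⟩

theorem join_le {j k l : Node lam} (h : j ≤ l) (h' : k ≤ l) : join j k ≤ l := by
  have hs : (join j k).set ≤ l.set := Idx.union_le h.fst h'.fst
  refine le_iff.mpr ⟨hs, fun a ha => ?_⟩
  have ha' : (∃ b ∈ j.fin.fin, res (le_join_left j k).fst b = a) ∨
      ∃ b ∈ k.fin.fin, res (le_join_right j k).fst b = a :=
    L0.mem_union_image.mp ha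
  rcases ha' with ⟨b, hb, rfl⟩ | ⟨b, hb, rfl⟩
  · rw [res_res]; exact (le_iff.mp h).snd b hb
  · rw [res_res]; exact (le_iff.mp h').snd b hb

/-- The canonical map is an isomorphism. -/
def Weak {j k : Node lam} (h : j ≤ k) : Prop := Function.Bijective (tm h)

/-- The localization of `k` is, up to a weak equivalence, a localization of that of `j`. -/
def Pre (j k : Node lam) : Prop := Weak (le_join_right j k)

variable [hlam : Fact (∀ i j : Fin n, i < j → lam i j ≠ 0)]

/-- Both R_A → R_B and R_B → loc(R_B, F) are epimorphisms of rings. -/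
theorem T_hom_ext {A : Idx lam} {k : Node lam} (h : A ≤ k.set) {Q : Type} [Ring Q]
    {f g : k.T →+* Q} (hfg : ∀ a, f (k.alg (res h a)) = g (k.alg (res h a))) : f = g := by
  refine Loc.hom_ext fun r => ?_
  exact RingHom.congr_fun (res_hom_ext hlam.out h (f := f.comp k.alg) (g := g.comp k.alg) hfg) r

/-- Because the maps from R_A are epimorphisms, a ring map backwards which is compatible with R_A is
automatically a two-sided inverse. -/
theorem weak_of_retraction {j k : Node lam} (h : j ≤ k) (ρ : k.T →+* j.T)
    (hρ : ∀ a, ρ (k.alg (res h.fst a)) = j.alg a) : Weak h := by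
  have h1 : ρ.comp (tm h) = RingHom.id _ := Loc.hom_ext fun r => by
    rw [RingHom.comp_apply, tm_alg, hρ]; rfl
  have h2 : (tm h).comp ρ = RingHom.id _ := T_hom_ext h.fst fun a => by
    rw [RingHom.comp_apply, hρ, tm_alg]; rfl
  exact Function.bijective_iff_has_inverse.mpr
    ⟨ρ, fun z => RingHom.congr_fun h1 z, fun z => RingHom.congr_fun h2 z⟩

omit hlam in
theorem Weak.exists_retraction {j k : Node lam} {h : j ≤ k} (w : Weak h) :
    ∃ ρ : k.T →+* j.T, ∀ z, ρ (tm h z) = z :=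
  ⟨(RingEquiv.ofBijective (tm h) w).symm, fun z =>
    RingEquiv.symm_apply_apply (RingEquiv.ofBijective (tm h) w) z⟩

omit hlam in
theorem Weak.trans {j k l : Node lam} {h : j ≤ k} {h' : k ≤ l} (w : Weak h)
    (w' : Weak h') : Weak (h.trans h') := by
  have : ⇑(tm (h.trans h')) = tm h' ∘ tm h := funext fun z => (tm_tm h h' z).symm
  rw [Weak, this]
  exact Function.Bijective.comp w' w

/-- The first factor of an isomorphism is split injective, and it is an epimorphism. -/
theorem Weak.of_trans {j k l : Node lam} (h : j ≤ k) (h' : k ≤ l)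
    (w : Weak (h.trans h')) : Weak h := by
  obtain ⟨ρ, hρ⟩ := w.exists_retraction
  refine weak_of_retraction h (ρ.comp (tm h')) fun a => ?_
  rw [RingHom.comp_apply, ← tm_alg h, tm_tm, hρ]

omit hlam in
theorem coe_ratio {A : Idx lam} {i : Fin n} (hi : x lam i ∈ A.1) (j : Fin n) :
    (ratio hi j : SA A) = ↑(xu hi)⁻¹ * ofA A (x lam j) := by
  simp only [ratio, divx, Nat.cast_one, zpow_neg, zpow_one]

omit hlam in
theorem isUnit_ratio {A : Idx lam} {i j : Fin n} (hi : x lam i ∈ A.1) (hj : x lam j ∈ A.1) :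
    IsUnit (ratio hi j) := by
  refine isUnit_degZero (w := ↑(xu hj)⁻¹ * ↑(xu hi)) ?_ ?_ ?_
  · simpa using (locDeg_xu_inv hj).mul (locDeg_xu hi)
  · rw [coe_ratio, ← val_xu hj, mul_assoc, Units.mul_inv_cancel_left, Units.inv_mul]
  · rw [coe_ratio, ← val_xu hj, mul_assoc, Units.mul_inv_cancel_left, Units.inv_mul]

/-- The localization at the join inverts over k' only what l inverts over k. As l inverts nothing
new, a retraction to the localization at k' can be built from the universal properties. -/
theorem Weak.pushout {k l k' : Node lam} {h : k ≤ l} (w : Weak h) (h' : k ≤ k') :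
    Weak (le_join_right l k') := by
  obtain ⟨ρ, hρ⟩ := w.exists_retraction
  obtain ⟨i, hi⟩ := k.set.2.1
  have hU : k'.set ≤ (join l k').set := (le_join_right l k').fst
  have hU' : l.set ≤ (join l k').set := (le_join_left l k').fst
  -- For a generator x_j of l, the ratio x_i⁻¹ x_j is a unit at l, hence at k by the retraction,
  -- hence at k'.
  obtain ⟨ψ, hψ⟩ := exists_lift_res hlam.out hU (h'.fst hi) k'.alg (by
    rintro j (hj | hj)
    · have h1 : IsUnit (ρ (l.alg (ratio (h.fst hi) j))) :=
        ((isUnit_ratio (h.fst hi) hj).map l.alg).map ρ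
      have h2 := h1.map (tm h')
      rw [ratio, ← res_divx h.fst hi, ← tm_alg h, hρ, tm_alg, res_divx] at h2
      exact h2
    · exact (isUnit_ratio (h'.fst hi) hj).map k'.alg)
  have hψ' : ψ.comp (res hU') = ((tm h').comp ρ).comp l.alg :=
    res_hom_ext hlam.out h.fst fun b => by
      have e : res hU' (res h.fst b) = res hU (res h'.fst b) := by rw [res_res, res_res]
      rw [RingHom.comp_apply, e, hψ, RingHom.comp_apply, RingHom.comp_apply, ← tm_alg h, hρ, tm_alg]
  refine weak_of_retraction _ (Loc.lift ψ fun a ha => ?_) fun a => ?_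
  · have ha' : (∃ b ∈ l.fin.fin, res hU' b = a) ∨ ∃ b ∈ k'.fin.fin, res hU b = a :=
      L0.mem_union_image.mp ha
    rcases ha' with ⟨b, hb, rfl⟩ | ⟨b, hb, rfl⟩
    · have := RingHom.congr_fun hψ' b
      rw [RingHom.comp_apply] at this
      rw [this]
      exact ((Loc.isUnit_of hb).map ρ).map (tm h')
    · rw [hψ]
      exact Loc.isUnit_of hb
  · exact (Loc.lift_of _ _ _).trans (hψ a)

/-- The join lies below l, so k → join is the first factor of the isomorphism k → l. -/
theorem pre_of_roof {j k l : Node lam} (h : j ≤ l) (h' : k ≤ l) (w : Weak h') :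
    Pre j k :=
  Weak.of_trans _ (join_le h h') w

omit hlam in
theorem weak_refl (j : Node lam) : Weak (le_refl j) := by
  have : ⇑(tm (le_refl j)) = id := funext (tm_refl j)
  rw [Weak, this]
  exact Function.bijective_id

theorem pre_of_le {j k : Node lam} (h : j ≤ k) : Pre j k :=
  pre_of_roof h le_rfl (weak_refl k)

theorem Weak.pre {j k : Node lam} {h : j ≤ k} (w : Weak h) : Pre k j :=
  pre_of_roof le_rfl h w

/-- Push the weak map k → join j k out along k → join k l and compose with the weak map from l. -/
theorem Pre.trans {j k l : Node lam} (h : Pre j k) (h' : Pre k l) : Pre j l := by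
  have w : Weak _ := Weak.pushout h (le_join_left k l)
  exact pre_of_roof ((le_join_left j k).trans (le_join_left _ (join k l)))
    ((le_join_right k l).trans (le_join_right _ _)) (Weak.trans h' w)

omit hlam in
theorem le_of_fin_le {A : Idx lam} {F G : L0 (RA A)} (h : F ≤ G) :
    (⟨A, F⟩ : Node lam) ≤ ⟨A, G⟩ :=
  le_iff.mpr ⟨le_rfl, fun a ha => by rw [res_refl]; exact h a ha⟩

omit hlam in
theorem tm_le_of_fin_le {A : Idx lam} {F G : L0 (RA A)} (h : F ≤ G) :
    tm (le_of_fin_le h) = pMap h := Loc.hom_ext fun r => by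
  rw [pMap_of]
  exact (tm_alg (le_of_fin_le h) r).trans (congrArg _ (res_refl _ r))

omit hlam in
theorem fin_le_of_le {A : Idx lam} {F G : L0 (RA A)}
    (h : (⟨A, F⟩ : Node lam) ≤ ⟨A, G⟩) : F ≤ G := fun a ha => by
  have := (le_iff.mp h).snd a ha
  rwa [res_refl] at this

omit hlam in
-- Over a fixed set of generators `Pre` is no weaker than the original preorder on finite subsets;
-- this is what later makes the charts injective.
theorem fin_le_of_pre {A : Idx lam} {F G : L0 (RA A)}
    (h : Pre (⟨A, F⟩ : Node lam) ⟨A, G⟩) : F ≤ G := fun a ha => by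
  obtain ⟨ρ, hρ⟩ := Weak.exists_retraction h
  have h1 : IsUnit (alg ⟨A, F⟩ a) := Loc.isUnit_of ha
  have h2 := (h1.map (tm (le_join_left ⟨A, F⟩ ⟨A, G⟩))).map ρ
  rw [tm_alg] at h2
  have h3 := hρ (alg ⟨A, G⟩ a)
  rw [tm_alg] at h3
  rw [← h3]
  exact h2

/-- Every localization of a chart is a localization of any larger chart. -/
theorem exists_weak {B : Idx lam} (k : Node lam) (h : B ≤ k.set) :
    ∃ G : L0 (RA B), ∃ h' : (⟨B, G⟩ : Node lam) ≤ k, Weak h' := by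
  classical
  obtain ⟨i, hi⟩ := B.2.1
  have hO := isOre_res hlam.out h hi
  -- Each element f of R_{k.set} is written as a left fraction u⁻¹ a over R_B.
  choose u hu a ha using hO.frac
  have hfin : (Set.range fun j : {j : Fin n // x lam j ∈ k.set.1} => ratio hi j.1).Finite :=
    Set.finite_range _
  -- Inverting the ratios x_i⁻¹ x_j turns R_B into R_{k.set}; inverting the numerators a then
  -- amounts to inverting the given elements, because the denominators u are already units.
  let G : L0 (RA B) := ⟨hfin.toFinset ∪ k.fin.fin.image a⟩
  have hle : (⟨B, G⟩ : Node lam) ≤ k := le_iff.mpr ⟨h, fun b hb => by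
    have hb' : (∃ j, x lam j ∈ k.set.1 ∧ ratio hi j = b) ∨ ∃ f ∈ k.fin.fin, a f = b := by
      simpa [G] using hb
    rcases hb' with ⟨j, hj, rfl⟩ | ⟨f, hf, rfl⟩
    · rw [ratio, res_divx]
      exact (isUnit_ratio (h hi) hj).map _
    · rw [← ha, map_mul]
      exact ((hO.unit _ (hu f)).map _).mul (Loc.isUnit_of hf)⟩
  refine ⟨G, hle, ?_⟩
  have hr : ∀ j, x lam j ∈ k.set.1 → IsUnit (alg ⟨B, G⟩ (ratio hi j)) := fun j hj => by
    refine Loc.isUnit_of ?_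
    have : ∃ j', x lam j' ∈ k.set.1 ∧ ratio hi j' = ratio hi j := ⟨j, hj, rfl⟩
    simpa [G] using Or.inl this
  obtain ⟨ψ, hψ⟩ := exists_lift_res hlam.out h hi (alg ⟨B, G⟩) hr
  refine weak_of_retraction hle (Loc.lift ψ fun f hf => ?_) fun b =>
    (Loc.lift_of _ _ _).trans (hψ b)
  have h1 : IsUnit (alg ⟨B, G⟩ (a f)) := Loc.isUnit_of (by
    have : ∃ f' ∈ k.fin.fin, a f' = a f := ⟨f, hf, rfl⟩
    simpa [G] using Or.inr this)
  have h2 : IsUnit (alg ⟨B, G⟩ (u f)) := isUnit_of_mem_den hlam.out hi _ hr (hu f)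
  have h3 := congrArg ψ (ha f)
  rw [map_mul, hψ, hψ] at h3
  rw [← h3] at h1
  obtain ⟨v, hv⟩ := h2
  rw [← hv] at h1
  exact (Units.isUnit_units_mul v _).mp h1

end Node

end Nodes

/-! ### Points of spectra as directed lower sets, and their functoriality -/

section Points

variable {R S T : Type} [Ring R] [Ring S] [Ring T]

theorem L0.mem_image {θ : R →+* S} {F : L0 R} {a : S} :
    a ∈ ((F.image θ).fin : Set S) ↔ ∃ b ∈ F.fin, θ b = a := by
  classical
  simp only [L0.image, Finset.coe_image, Set.mem_image, Finset.mem_coe]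

theorem Sober.ext_cls {C C' : NCTop R}
    (h : ∀ F : L0 R, F.cls ∈ (Sober.carrier C : Set (LSpace R)) ↔
      F.cls ∈ (Sober.carrier C' : Set (LSpace R))) : C = C' := by
  refine IrreducibleCloseds.ext (Set.ext fun y => ?_)
  obtain ⟨F, rfl⟩ := exists_cls y
  exact h F

theorem hatFun_hatFun (θ : R →+* S) (φ : S →+* T) (C : NCTop T) :
    hatFun θ (hatFun φ C) = hatFun (φ.comp θ) C := Sober.ext_cls fun F => by
  classical
  rw [cls_mem_hatFun, cls_mem_hatFun, cls_mem_hatFun]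
  have : (F.image θ).image φ = F.image (φ.comp θ) := by
    simp only [L0.image, Finset.image_image]
    rfl
  rw [this]

theorem hatFun_id (C : NCTop R) : hatFun (RingHom.id R) C = C := Sober.ext_cls fun F => by
  classical
  rw [cls_mem_hatFun]
  have : F.image (RingHom.id R) = F := by
    cases F
    simp [L0.image]
  rw [this]

theorem cls_mem_of_le {C : NCTop R} {F G : L0 R} (h : F ≤ G)
    (hG : G.cls ∈ (Sober.carrier C : Set (LSpace R))) :
    F.cls ∈ (Sober.carrier C : Set (LSpace R)) :=
  mem_carrier_of_le hG (cls_le.mpr h)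

theorem isOpen_Ici_LSpace (z : LSpace R) : IsOpen {w | z ≤ w} := by
  rw [Topology.IsUpperSet.isOpen_iff_isUpperSet]
  exact fun a b hab ha => le_trans (show z ≤ a from ha) hab

theorem exists_cls_mem (C : NCTop R) : ∃ F : L0 R, F.cls ∈ (Sober.carrier C : Set (LSpace R)) := by
  obtain ⟨y, hy⟩ := C.isIrreducible'.1
  obtain ⟨F, rfl⟩ := exists_cls y
  exact ⟨F, hy⟩

theorem union_le {F G H : L0 R} (h : F ≤ H) (h' : G ≤ H) : F.union G ≤ H := by
  classical
  intro a ha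
  have ha' : a ∈ F.fin ∨ a ∈ G.fin := by simpa [L0.union] using ha
  exact ha'.elim (h a) (h' a)

/-- Irreducibility means that C is directed: the open upper sets above F and above G both meet C, so
their intersection does too. -/
theorem union_cls_mem {C : NCTop R} {F G : L0 R}
    (hF : F.cls ∈ (Sober.carrier C : Set (LSpace R)))
    (hG : G.cls ∈ (Sober.carrier C : Set (LSpace R))) :
    (F.union G).cls ∈ (Sober.carrier C : Set (LSpace R)) := by
  obtain ⟨z, hz, hz1, hz2⟩ := C.isIrreducible'.2 _ _ (isOpen_Ici_LSpace F.cls)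
    (isOpen_Ici_LSpace G.cls) ⟨_, hF, le_refl F.cls⟩ ⟨_, hG, le_refl G.cls⟩
  obtain ⟨H, rfl⟩ := exists_cls z
  exact cls_mem_of_le (union_le (cls_le.mp hz1) (cls_le.mp hz2)) hz

theorem isOpen_of_exists_le (U : L0 R → Prop) :
    IsOpen {C : NCTop R | ∃ F : L0 R, F.cls ∈ (Sober.carrier C : Set (LSpace R)) ∧ U F} := by
  refine ⟨{y | ∃ F : L0 R, U F ∧ F.cls ≤ y}, ?_, ?_⟩
  · rw [Topology.IsUpperSet.isOpen_iff_isUpperSet]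
    rintro a b hab ⟨F, hF, h⟩
    exact ⟨F, hF, h.trans hab⟩
  · ext C
    constructor
    · rintro ⟨F, hF, h⟩
      exact ⟨F.cls, hF, F, h, le_rfl⟩
    · rintro ⟨y, hy, F, hF, h⟩
      exact ⟨F, mem_carrier_of_le hy h, hF⟩

/-- The point of `NCSpec(S)` generated by the image of a point of `NCSpec(R)`. -/
def pushPt (θ : R →+* S) (C : NCTop R) : NCTop S where
  carrier := {y | ∃ F : L0 R, F.cls ∈ (Sober.carrier C : Set (LSpace R)) ∧ y ≤ (F.image θ).cls}
  isClosed' := by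
    rw [Topology.IsUpperSet.isClosed_iff_isLower]
    rintro a b hab ⟨F, hF, h⟩
    exact ⟨F, hF, hab.trans h⟩
  isIrreducible' := by
    constructor
    · obtain ⟨F, hF⟩ := exists_cls_mem C
      exact ⟨_, F, hF, le_rfl⟩
    · rintro U V hU hV ⟨y, ⟨F, hF, hy⟩, hyU⟩ ⟨z, ⟨G, hG, hz⟩, hzV⟩
      rw [Topology.IsUpperSet.isOpen_iff_isUpperSet] at hU hV
      refine ⟨((F.union G).image θ).cls, ⟨_, union_cls_mem hF hG, le_rfl⟩,
        hU (hy.trans (cls_le.mpr (L0.image_mono θ (F.le_union_left G)))) hyU,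
        hV (hz.trans (cls_le.mpr (L0.image_mono θ (F.le_union_right G)))) hzV⟩

theorem cls_mem_pushPt {θ : R →+* S} {C : NCTop R} {G : L0 S} :
    G.cls ∈ (Sober.carrier (pushPt θ C) : Set (LSpace S)) ↔
      ∃ F : L0 R, F.cls ∈ (Sober.carrier C : Set (LSpace R)) ∧ G ≤ F.image θ :=
  exists_congr fun _ => and_congr_right fun _ => cls_le

end Points

/-! ### The topology of the noncommutative projective space -/

section Topology

open SkewPoly Node

variable {n : ℕ} {lam : Fin n → Fin n → ℂ}

/-- The index of the `i`-th chart. -/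
def sgl (lam : Fin n → Fin n → ℂ) (i : Fin n) : Idx lam :=
  ⟨{x lam i}, ⟨i, rfl⟩, by rintro _ rfl; exact ⟨i, rfl⟩⟩

/-- The index of the overlap of two charts. -/
def pr (lam : Fin n → Fin n → ℂ) (i j : Fin n) : Idx lam :=
  ⟨{x lam i, x lam j}, ⟨i, Or.inl rfl⟩, by rintro _ (rfl | rfl); exacts [⟨i, rfl⟩, ⟨j, rfl⟩]⟩

theorem sgl_le {i : Fin n} {A : Idx lam} (hi : x lam i ∈ A.1) : sgl lam i ≤ A :=
  Set.singleton_subset_iff.mpr hi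

theorem pr_le {i j : Fin n} {A : Idx lam} (hi : x lam i ∈ A.1) (hj : x lam j ∈ A.1) :
    pr lam i j ≤ A := by
  rintro _ (rfl | rfl)
  exacts [hi, hj]

theorem sgl_le_left (i j : Fin n) : sgl lam i ≤ pr lam i j := sgl_le (Or.inl rfl)

theorem sgl_le_right (i j : Fin n) : sgl lam j ≤ pr lam i j := sgl_le (Or.inr rfl)

theorem res_refl' (A : Idx lam) : res (le_refl A) = RingHom.id _ := RingHom.ext (res_refl A)

theorem res_comp {A B C : Idx lam} (h : A ≤ B) (hBC : B ≤ C) :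
    (res hBC).comp (res h) = res (h.trans hBC) := RingHom.ext (res_res h hBC)

/-- The inclusion of a chart. -/
def chart (i : Fin n) : NCTop (RA (sgl lam i)) → ncProj n lam :=
  gluePi (fun i : Fin n => NCSpec (chartRing lam i)) (fun i j => NCSpec (overlapRing lam i j))
    (fun i j => NCSpec.map (chartMapL lam i j)) (fun i j => NCSpec.map (chartMapR lam i j)) i

theorem continuous_chart (i : Fin n) : Continuous (chart (lam := lam) i) :=
  (gluePi (fun i : Fin n => NCSpec (chartRing lam i)) (fun i j => NCSpec (overlapRing lam i j))
    (fun i j => NCSpec.map (chartMapL lam i j))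
    (fun i j => NCSpec.map (chartMapR lam i j)) i).hom.continuous

theorem chart_glue (i j : Fin n) (v : NCTop (RA (pr lam i j))) :
    chart i (hatFun (res (sgl_le_left i j)) v) = chart j (hatFun (res (sgl_le_right i j)) v) :=
  Quot.sound (GlueRel.mk (X := fun i : Fin n => NCSpec (chartRing lam i))
    (V := fun i j => NCSpec (overlapRing lam i j))
    (f := fun i j => NCSpec.map (chartMapL lam i j))
    (g := fun i j => NCSpec.map (chartMapR lam i j)) i j v)

theorem exists_chart (p : ncProj n lam) : ∃ i C, chart (lam := lam) i C = p := by
  obtain ⟨⟨i, C⟩, rfl⟩ := Quot.exists_rep p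
  exact ⟨i, C, rfl⟩

/-- The inclusion of the intersection of some charts. -/
def inc (A : Idx lam) (C : NCTop (RA A)) : ncProj n lam :=
  chart A.2.1.choose (hatFun (res (sgl_le A.2.1.choose_spec)) C)

/-- The gluing relation makes `inc` independent of the chart chosen in its definition. -/
theorem inc_eq {A : Idx lam} {i : Fin n} (hi : x lam i ∈ A.1) (C : NCTop (RA A)) :
    inc A C = chart i (hatFun (res (sgl_le hi)) C) := by
  have h := A.2.1.choose_spec
  have e := chart_glue A.2.1.choose i (hatFun (res (pr_le h hi)) C)
  rw [hatFun_hatFun, hatFun_hatFun, res_comp, res_comp] at e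
  exact e

theorem inc_hatFun {A B : Idx lam} (h : A ≤ B) (C : NCTop (RA B)) :
    inc A (hatFun (res h) C) = inc B C := by
  obtain ⟨i, hi⟩ := A.2.1
  rw [inc_eq hi, inc_eq (h hi), hatFun_hatFun, res_comp]

theorem inc_sgl (i : Fin n) (C : NCTop (RA (sgl lam i))) : inc (sgl lam i) C = chart i C := by
  rw [inc_eq (A := sgl lam i) (i := i) rfl, res_refl', hatFun_id]

theorem continuous_inc (A : Idx lam) : Continuous (inc A) :=
  (continuous_chart _).comp (hatFun_continuous _)

/-- The preimage of an open subset under the inclusion of an intersection of charts. -/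
def incPre (A : Idx lam) (V : Opens (ncProj n lam)) : Opens (NCTop (RA A)) :=
  ⟨inc A ⁻¹' V, V.2.preimage (continuous_inc A)⟩

/-- The point of the projective space which belongs to a node. -/
def Node.point (j : Node lam) : ncProj n lam := inc j.set j.fin.pt

theorem cls_mem_pt {R : Type} [Ring R] {F G : L0 R} :
    F.cls ∈ (Sober.carrier G.pt : Set (LSpace R)) ↔ F ≤ G :=
  mem_carrier_pt.trans cls_le

theorem point_mem_of_le {j k : Node lam} (h : j ≤ k) {V : Opens (ncProj n lam)}
    (hj : j.point ∈ V) : k.point ∈ V := by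
  rw [Node.point, ← inc_hatFun h.fst]
  exact mem_of_pt_mem (V := incPre j.set V) (F := j.fin)
    (cls_mem_hatFun.mpr (cls_mem_pt.mpr h.snd)) hj

variable [hlam : Fact (∀ i j : Fin n, i < j → lam i j ≠ 0)]

theorem Node.Weak.fin_le {k l : Node lam} {h : k ≤ l} (w : Weak h) {F : L0 (RA k.set)}
    (hF : (⟨k.set, F⟩ : Node lam) ≤ l) : F ≤ k.fin :=
  fin_le_of_pre (pre_of_roof hF h w)

/-- The point of the join belongs to V, and on the chart of k this is witnessed by some F that
becomes invertible at the join. As k → join is weak, F is already invertible at k. -/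
theorem point_mem_of_pre {j k : Node lam} (h : Pre j k) {V : Opens (ncProj n lam)}
    (hj : j.point ∈ V) : k.point ∈ V := by
  have h1 := point_mem_of_le (le_join_left j k) hj
  rw [Node.point, ← inc_hatFun (le_join_right j k).fst] at h1
  obtain ⟨F, hF, hFV⟩ := exists_pt_mem (V := incPre k.set V) h1
  have hF' : (⟨k.set, F⟩ : Node lam) ≤ join j k :=
    ⟨(le_join_right j k).fst, cls_mem_pt.mp (cls_mem_hatFun.mp hF)⟩
  exact pt_mem_of_le (Weak.fin_le h hF') (incPre k.set V) hFV

/-- The predicate on points of a chart which defines the smallest open subset containing the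
point of a node. -/
def nbhdPred (j : Node lam) (p : Σ i : Fin n, NCTop (RA (sgl lam i))) : Prop :=
  ∃ F : L0 (RA (sgl lam p.1)), F.cls ∈ (Sober.carrier p.2 : Set (LSpace (RA (sgl lam p.1)))) ∧
    Pre j ⟨sgl lam p.1, F⟩

/-- The condition can be tested on any intersection of charts containing the point, so it respects
the gluing. Passing back to the chart requires `exists_weak`. -/
theorem nbhdPred_hatFun (j : Node lam) {i : Fin n} {A : Idx lam} (h : sgl lam i ≤ A)
    (C : NCTop (RA A)) : nbhdPred j ⟨i, hatFun (res h) C⟩ ↔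
      ∃ F : L0 (RA A), F.cls ∈ (Sober.carrier C : Set (LSpace (RA A))) ∧ Pre j ⟨A, F⟩ := by
  constructor
  · rintro ⟨F, hF, hj⟩
    exact ⟨F.image (res h), hF, hj.trans (pre_of_le ⟨h, le_rfl⟩)⟩
  · rintro ⟨F, hF, hj⟩
    obtain ⟨G, hG, w⟩ := exists_weak ⟨A, F⟩ h
    exact ⟨G, cls_mem_hatFun.mpr (cls_mem_of_le hG.snd hF), hj.trans (Weak.pre w)⟩

/-- The smallest open subset which contains the point of a node. -/
def Node.nbhd (j : Node lam) : Opens (ncProj n lam) where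
  carrier := {p | Quot.lift (nbhdPred j) (by
    rintro _ _ ⟨i, k, v⟩
    exact propext ((nbhdPred_hatFun j (sgl_le_left i k) v).trans
      (nbhdPred_hatFun j (sgl_le_right i k) v).symm)) p}
  is_open' := by
    refine isOpen_coinduced.mpr (isOpen_sigma_iff.mpr fun i => ?_)
    exact isOpen_of_exists_le fun F => Pre j ⟨sgl lam i, F⟩

theorem chart_mem_nbhd {j : Node lam} {i : Fin n} {C : NCTop (RA (sgl lam i))} :
    chart i C ∈ j.nbhd ↔ ∃ F : L0 (RA (sgl lam i)),
      F.cls ∈ (Sober.carrier C : Set (LSpace (RA (sgl lam i)))) ∧ Pre j ⟨sgl lam i, F⟩ :=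
  Iff.rfl

theorem inc_mem_nbhd {j : Node lam} {A : Idx lam} {C : NCTop (RA A)} :
    inc A C ∈ j.nbhd ↔ ∃ F : L0 (RA A),
      F.cls ∈ (Sober.carrier C : Set (LSpace (RA A))) ∧ Pre j ⟨A, F⟩ :=
  nbhdPred_hatFun j _ C

theorem point_mem_nbhd_iff {j k : Node lam} : k.point ∈ j.nbhd ↔ Pre j k := by
  refine inc_mem_nbhd.trans ⟨?_, fun h => ⟨k.fin, cls_mem_pt.mpr le_rfl, h⟩⟩
  rintro ⟨F, hF, h⟩
  exact h.trans (pre_of_le (k := k) (le_of_fin_le (cls_mem_pt.mp hF)))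

theorem point_mem_nbhd (j : Node lam) : j.point ∈ j.nbhd :=
  point_mem_nbhd_iff.mpr (pre_of_le le_rfl)

/-- This is the minimality of `nbhd`; it rests on the invariance of open sets under `Pre`. -/
theorem nbhd_le_iff {j : Node lam} {V : Opens (ncProj n lam)} : j.nbhd ≤ V ↔ j.point ∈ V := by
  refine ⟨fun h => h (point_mem_nbhd j), fun h p hp => ?_⟩
  obtain ⟨i, C, rfl⟩ := exists_chart p
  obtain ⟨F, hF, hj⟩ := chart_mem_nbhd.mp hp
  have h1 := point_mem_of_pre hj h
  rw [← inc_sgl]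
  exact mem_of_pt_mem (V := incPre (sgl lam i) V) hF h1

theorem nbhd_le_nbhd_iff {j k : Node lam} : k.nbhd ≤ j.nbhd ↔ Pre j k :=
  nbhd_le_iff.trans point_mem_nbhd_iff

theorem nbhd_mono {j k : Node lam} (h : j ≤ k) : k.nbhd ≤ j.nbhd :=
  nbhd_le_nbhd_iff.mpr (pre_of_le h)

theorem exists_nbhd {p : ncProj n lam} {V : Opens (ncProj n lam)} (hp : p ∈ V) :
    ∃ j : Node lam, p ∈ j.nbhd ∧ j.nbhd ≤ V := by
  obtain ⟨i, C, rfl⟩ := exists_chart p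
  rw [← inc_sgl] at hp ⊢
  obtain ⟨F, hF, hFV⟩ := exists_pt_mem (V := incPre (sgl lam i) V) hp
  exact ⟨⟨sgl lam i, F⟩, inc_mem_nbhd.mpr ⟨F, hF, pre_of_le le_rfl⟩, nbhd_le_iff.mpr hFV⟩

/-- A point C is recovered from its image: by `fin_le_of_pre`, F belongs to C exactly when the image
lies in the smallest neighbourhood of the node of F. -/
theorem chart_injective (i : Fin n) : Function.Injective (chart (lam := lam) i) := by
  have key : ∀ C C' : NCTop (RA (sgl lam i)), chart i C = chart i C' →
      ∀ F : L0 (RA (sgl lam i)), F.cls ∈ (Sober.carrier C : Set (LSpace (RA (sgl lam i)))) →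
      F.cls ∈ (Sober.carrier C' : Set (LSpace (RA (sgl lam i)))) := by
    intro C C' h F hF
    have h1 : chart i C ∈ (⟨sgl lam i, F⟩ : Node lam).nbhd :=
      chart_mem_nbhd.mpr ⟨F, hF, pre_of_le le_rfl⟩
    rw [h] at h1
    obtain ⟨G, hG, hFG⟩ := chart_mem_nbhd.mp h1
    exact cls_mem_of_le (fin_le_of_pre hFG) hG
  exact fun C C' h => Sober.ext_cls fun F => ⟨key C C' h F, key C' C h.symm F⟩

omit hlam in
theorem Node.image_le {A B : Idx lam} (h : A ≤ B) {F : L0 (RA A)} {l : Node lam}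
    (hF : (⟨A, F⟩ : Node lam) ≤ l) (hB : B ≤ l.set) : (⟨B, F.image (res h)⟩ : Node lam) ≤ l := by
  refine le_iff.mpr ⟨hB, fun a ha => ?_⟩
  obtain ⟨b, hb, rfl⟩ := L0.mem_image.mp ha
  rw [res_res]
  exact (le_iff.mp hF).snd b hb

/-- If p is the image of a point C of the k-th chart, then C contains some F' over which passing to
the overlap with the i-th chart inverts nothing new. So C extends to the overlap, and p lies in the
i-th chart. Openness of charts follows from this. -/
theorem exists_of_mem_nbhd {i : Fin n} {F : L0 (RA (sgl lam i))} {p : ncProj n lam}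
    (hp : p ∈ (⟨sgl lam i, F⟩ : Node lam).nbhd) : ∃ C : NCTop (RA (sgl lam i)),
      F.cls ∈ (Sober.carrier C : Set (LSpace (RA (sgl lam i)))) ∧ chart i C = p := by
  have hp' := hp
  obtain ⟨k, C, rfl⟩ := exists_chart p
  obtain ⟨F', hF', w⟩ := chart_mem_nbhd.mp hp
  let B := (sgl lam i).union (sgl lam k)
  have hk : sgl lam k ≤ B := Idx.le_union_right _ _
  have hi : sgl lam i ≤ B := Idx.le_union_left _ _
  have hv : hatFun (res hk) (pushPt (res hk) C) = C := Sober.ext_cls fun G => by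
    rw [cls_mem_hatFun, cls_mem_pushPt]
    constructor
    · rintro ⟨F₁, hF₁, h⟩
      -- The join with (i, F) remains weak over F₁ ∪ F', so whatever F₁ inverts on the overlap is
      -- already inverted by F₁ ∪ F' on the chart.
      have w' := Weak.pushout w (le_of_fin_le (F₁.le_union_right F'))
      refine cls_mem_of_le (Weak.fin_le w' ?_) (union_cls_mem hF₁ hF')
      have h1 : (⟨sgl lam k, G⟩ : Node lam) ≤ ⟨B, F₁.image (res hk)⟩ := ⟨hk, h⟩
      exact h1.trans (Node.image_le hk ((le_of_fin_le (F₁.le_union_left F')).trans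
        (le_join_right _ _)) (le_join_left (join ⟨sgl lam i, F⟩ ⟨sgl lam k, F'⟩) _).fst)
    · exact fun h => ⟨G, h, le_rfl⟩
  have e : chart i (hatFun (res hi) (pushPt (res hk) C)) = chart k C := by
    rw [← inc_sgl, inc_hatFun, ← inc_hatFun hk, hv, inc_sgl]
  refine ⟨_, ?_, e⟩
  rw [← e] at hp'
  obtain ⟨G, hG, hFG⟩ := chart_mem_nbhd.mp hp'
  exact cls_mem_of_le (fin_le_of_pre hFG) hG

theorem isOpenMap_chart (i : Fin n) : IsOpenMap (chart (lam := lam) i) := by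
  intro W hW
  rw [isOpen_iff_forall_mem_open]
  rintro _ ⟨C, hC, rfl⟩
  obtain ⟨F, hF, hFW⟩ := exists_pt_mem (V := ⟨W, hW⟩) hC
  refine ⟨(⟨sgl lam i, F⟩ : Node lam).nbhd, fun p hp => ?_, Opens.isOpen _,
    chart_mem_nbhd.mpr ⟨F, hF, pre_of_le le_rfl⟩⟩
  obtain ⟨C', hC', rfl⟩ := exists_of_mem_nbhd hp
  exact ⟨C', mem_of_pt_mem (V := ⟨W, hW⟩) hC' hFW, rfl⟩

theorem isOpenEmbedding_chart (i : Fin n) : Topology.IsOpenEmbedding (chart (lam := lam) i) :=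
  .of_continuous_injective_isOpenMap (continuous_chart i) (chart_injective i) (isOpenMap_chart i)

end Topology

/-! ### Families indexed by the localizations of the charts -/

section Families

open SkewPoly Node

variable {n : ℕ} {lam : Fin n → Fin n → ℂ}

/-- A functor from nodes to abelian groups which inverts the weak equivalences. -/
structure NodeSys (lam : Fin n → Fin n → ℂ) where
  /-- the value at a node -/
  obj : Node lam → Type
  [grp : ∀ j, AddCommGroup (obj j)]
  /-- the transition maps -/
  map : ∀ {j k : Node lam}, j ≤ k → obj j →+ obj k
  map_refl : ∀ (j : Node lam) (t : obj j), map (le_refl j) t = t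
  map_map : ∀ {j k l : Node lam} (h : j ≤ k) (h' : k ≤ l) (t : obj j),
    map h' (map h t) = map (h.trans h') t
  bij : ∀ {j k : Node lam} (h : j ≤ k), Weak h → Function.Bijective (map h)

attribute [instance] NodeSys.grp

namespace NodeSys

variable (D : NodeSys lam)

/-- Compatible families indexed by the nodes whose point belongs to an open subset. -/
def fam (V : Opens (ncProj n lam)) : AddSubgroup (∀ j : {j : Node lam // j.point ∈ V}, D.obj j.1) where
  carrier := {s | ∀ (j k : {j : Node lam // j.point ∈ V}) (h : j.1 ≤ k.1), D.map h (s j) = s k}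
  add_mem' hs ht := fun j k h => by simp [hs j k h, ht j k h]
  zero_mem' := fun j k h => by simp
  neg_mem' hs := fun j k h => by simp [hs j k h]

/-- Restriction of compatible families. -/
def famRes {U V : Opens (ncProj n lam)} (i : U ≤ V) : D.fam V →+ D.fam U where
  toFun s := ⟨fun j => s.1 ⟨j.1, i j.2⟩, fun j k h => s.2 ⟨j.1, i j.2⟩ ⟨k.1, i k.2⟩ h⟩
  map_zero' := rfl
  map_add' _ _ := rfl

variable {D}

/-- Each j is linked to σ j by a roof j → κ j ← σ j whose first leg is weak, so the value at σ j
determines the value at j. -/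
theorem fam_ext {V : Opens (ncProj n lam)} {σ κ : ∀ j : Node lam, j.point ∈ V → Node lam}
    (hσV : ∀ j hj, (σ j hj).point ∈ V) (hσ : ∀ j hj, σ j hj ≤ κ j hj) (hκ : ∀ j hj, j ≤ κ j hj)
    (w : ∀ j hj, Weak (hκ j hj)) {s t : D.fam V}
    (h : ∀ j hj, s.1 ⟨σ j hj, hσV j hj⟩ = t.1 ⟨σ j hj, hσV j hj⟩) : s = t := by
  refine Subtype.ext (funext fun ⟨j, hj⟩ => (D.bij _ (w j hj)).1 ?_)
  have hκV : (κ j hj).point ∈ V := point_mem_of_le (hκ j hj) hj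
  rw [s.2 ⟨j, hj⟩ ⟨κ j hj, hκV⟩, t.2 ⟨j, hj⟩ ⟨κ j hj, hκV⟩,
    ← s.2 ⟨σ j hj, hσV j hj⟩ ⟨κ j hj, hκV⟩ (hσ j hj),
    ← t.2 ⟨σ j hj, hσV j hj⟩ ⟨κ j hj, hκV⟩ (hσ j hj), h]

/-- The value at j is obtained by moving g (σ j) up to κ j and back along the isomorphism from j.
Monotonicity of σ and κ gives compatibility, and `hS` ensures that g is extended. -/
theorem exists_fam {V : Opens (ncProj n lam)} {S : Node lam → Prop}
    {σ κ : ∀ j : Node lam, j.point ∈ V → Node lam}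
    (hσS : ∀ j hj, S (σ j hj)) (hσ : ∀ j hj, σ j hj ≤ κ j hj)
    (hκ : ∀ j hj, j ≤ κ j hj) (w : ∀ j hj, Weak (hκ j hj))
    (hσ' : ∀ j k hj hk, j ≤ k → σ j hj ≤ σ k hk) (hκ' : ∀ j k hj hk, j ≤ k → κ j hj ≤ κ k hk)
    (hS : ∀ j hj, S j → j ≤ σ j hj) (g : ∀ j : {j // S j}, D.obj j.1)
    (hg : ∀ (j k : {j // S j}) (h : j.1 ≤ k.1), D.map h (g j) = g k) :
    ∃ s : D.fam V, ∀ j (hj : j.point ∈ V) (hjS : S j), s.1 ⟨j, hj⟩ = g ⟨j, hjS⟩ := by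
  choose f hf using fun j hj => (D.bij _ (w j hj)).2 (D.map (hσ j hj) (g ⟨σ j hj, hσS j hj⟩))
  refine ⟨⟨fun j => f j.1 j.2, ?_⟩, fun j hj hjS => (D.bij _ (w j hj)).1 ?_⟩
  · rintro ⟨j, hj⟩ ⟨k, hk⟩ h
    refine (D.bij _ (w k hk)).1 ?_
    rw [hf, D.map_map, ← D.map_map (hκ j hj) (hκ' j k hj hk h), hf, D.map_map,
      ← hg ⟨σ j hj, hσS j hj⟩ ⟨σ k hk, hσS k hk⟩ (hσ' j k hj hk h), D.map_map]
  · refine (hf j hj).trans ?_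
    rw [← hg ⟨j, hjS⟩ ⟨σ j hj, hσS j hj⟩ (hS j hj hjS), D.map_map]

variable [hlam : Fact (∀ i j : Fin n, i < j → lam i j ≠ 0)]

omit hlam in
theorem join_mono {j k k' : Node lam} (h : k ≤ k') : join j k ≤ join j k' :=
  join_le (le_join_left _ _) (h.trans (le_join_right _ _))

variable (D) in
/-- Compatible families over the smallest neighbourhood of a node. -/
theorem fam_nbhd_bijective (j : Node lam) :
    Function.Bijective fun s : D.fam j.nbhd => s.1 ⟨j, point_mem_nbhd j⟩ := by
  constructor
  · intro s t h
    exact fam_ext (σ := fun _ _ => j) (κ := fun k _ => join j k) (fun _ _ => point_mem_nbhd j)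
      (fun k _ => le_join_left j k) (fun k _ => le_join_right j k)
      (fun k hk => point_mem_nbhd_iff.mp hk) fun _ _ => h
  · intro t
    -- The roof of k is k → join j k ← j. Its first leg is weak precisely because k lies in the
    -- smallest neighbourhood of j.
    obtain ⟨s, hs⟩ := exists_fam (D := D) (V := j.nbhd) (S := fun k => k = j) (σ := fun _ _ => j)
      (κ := fun k _ => join j k) (fun _ _ => rfl)
      (fun k _ => le_join_left j k) (fun k _ => le_join_right j k)
      (fun k hk => point_mem_nbhd_iff.mp hk) (fun _ _ _ _ _ => le_rfl)
      (fun _ _ _ _ h => join_mono h) (fun _ _ h => h.le) (fun k => D.map k.2.ge t)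
      (fun k l h => D.map_map _ _ _)
    exact ⟨s, (hs j (point_mem_nbhd j) rfl).trans (D.map_refl j t)⟩

/-- The open subset covered by a chart. -/
def _root_.NCGeom.chartOpen (i : Fin n) : Opens (ncProj n lam) :=
  ⟨Set.range (chart i), (isOpenEmbedding_chart i).isOpen_range⟩

theorem _root_.NCGeom.pre_of_mem_chartOpen {i : Fin n} {j : Node lam}
    (h : j.point ∈ chartOpen (lam := lam) i) : Pre ⟨sgl lam i, ⟨∅⟩⟩ j := by
  obtain ⟨C, hC⟩ := h
  rw [← point_mem_nbhd_iff, ← hC]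
  obtain ⟨F, hF⟩ := exists_cls_mem C
  exact chart_mem_nbhd.mpr ⟨F, hF, pre_of_le (le_of_fin_le fun a ha => by simp at ha)⟩

variable (D) in
/-- Compatible families over an open subset of a chart. -/
theorem fam_chart {V : Opens (ncProj n lam)} {i : Fin n} (hV : V ≤ chartOpen i) :
    (∀ s t : D.fam V, (∀ (F : L0 (RA (sgl lam i))) (h : Node.point ⟨sgl lam i, F⟩ ∈ V),
      s.1 ⟨_, h⟩ = t.1 ⟨_, h⟩) → s = t) ∧
    ∀ g : ∀ (F : L0 (RA (sgl lam i))), Node.point ⟨sgl lam i, F⟩ ∈ V → D.obj ⟨sgl lam i, F⟩,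
      (∀ F G hF hG (h : F ≤ G), D.map (le_of_fin_le h) (g F hF) = g G hG) →
      ∃ s : D.fam V, ∀ F h, s.1 ⟨⟨sgl lam i, F⟩, h⟩ = g F h := by
  let e : Node lam := ⟨sgl lam i, ⟨∅⟩⟩
  have hκ : ∀ j : Node lam, j.point ∈ V → Weak (le_join_right e j) :=
    fun j hj => pre_of_mem_chartOpen (hV hj)
  -- A node over V is joined with the trivial node of the chart, which changes nothing up to weak
  -- equivalence, and the join is then replaced by a node of the chart itself.
  choose G hG wG using fun j : Node lam => exists_weak (join e j) (le_join_left e j).fst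
  have hσV : ∀ j : Node lam, j.point ∈ V → Node.point ⟨sgl lam i, G j⟩ ∈ V := fun j hj =>
    point_mem_of_pre (Weak.pre (wG j)) (point_mem_of_le (le_join_right e j) hj)
  constructor
  · intro s t h
    exact fam_ext (σ := fun j _ => ⟨sgl lam i, G j⟩) (κ := fun k _ => join e k) hσV
      (fun k _ => hG k) (fun k _ => le_join_right e k) hκ fun j hj => h _ _
  · intro g hg
    obtain ⟨s, hs⟩ := exists_fam (D := D) (V := V)
      (S := fun k => k.point ∈ V ∧ ∃ F, k = ⟨sgl lam i, F⟩)
      (σ := fun j _ => ⟨sgl lam i, G j⟩) (κ := fun k _ => join e k)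
      (fun j hj => ⟨hσV j hj, _, rfl⟩) (fun k _ => hG k) (fun k _ => le_join_right e k) hκ
      (fun j k _ _ h => le_of_fin_le (Weak.fin_le (wG k) ((hG j).trans (join_mono h))))
      (fun _ _ _ _ h => join_mono h) (by
        rintro _ hj ⟨_, F, rfl⟩
        exact le_of_fin_le (Weak.fin_le (wG _) (le_join_right e _)))
      (fun k => D.map k.2.2.choose_spec.ge (g k.2.2.choose (by
        rw [← k.2.2.choose_spec]; exact k.2.1))) (by
        rintro ⟨j, hj, hjF⟩ ⟨k, hk, hkF⟩ h
        have ej := hjF.choose_spec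
        have ek := hkF.choose_spec
        have h1 : (⟨sgl lam i, hjF.choose⟩ : Node lam) ≤ ⟨sgl lam i, hkF.choose⟩ :=
          ej.ge.trans (h.trans ek.le)
        rw [D.map_map, ← hg hjF.choose hkF.choose (by rw [← ej]; exact hj)
          (by rw [← ek]; exact hk) (fin_le_of_le h1), D.map_map])
    refine ⟨s, fun F h => ?_⟩
    have hex : ∃ F', (⟨sgl lam i, F⟩ : Node lam) = ⟨sgl lam i, F'⟩ := ⟨F, rfl⟩
    refine (hs _ h ⟨h, hex⟩).trans ?_
    have e1 := hex.choose_spec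
    exact hg _ _ _ h (fin_le_of_le e1.ge)

end NodeSys

end Families

/-! ### The structure sheaf of the noncommutative projective space -/

section Structure

open SkewPoly Node

variable {n : ℕ} {lam : Fin n → Fin n → ℂ}

/-- The preimage of an open subset under the inclusion of a chart. -/
def chartPre (i : Fin n) (V : Opens (ncProj n lam)) : Opens (NCTop (RA (sgl lam i))) :=
  ⟨chart i ⁻¹' V, V.2.preimage (continuous_chart i)⟩

theorem point_sgl (i : Fin n) (F : L0 (RA (sgl lam i))) :
    Node.point ⟨sgl lam i, F⟩ = chart i F.pt := inc_sgl i F.pt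

theorem pt_mem_chartPre {i : Fin n} {F : L0 (RA (sgl lam i))} {V : Opens (ncProj n lam)} :
    F.pt ∈ chartPre i V ↔ Node.point ⟨sgl lam i, F⟩ ∈ V := by
  rw [point_sgl]; rfl

/-- The restriction of sections of the structure sheaf to a chart. -/
def secChart (V : Opens (ncProj n lam)) (i : Fin n) :
    (ncProj n lam).presheaf.obj (op V) →+* ncSec (RA (sgl lam i)) (chartPre i V) :=
  (Pi.evalRingHom (fun i : Fin n => ncSec (RA (sgl lam i)) (chartPre i V)) i).comp
    (Subring.subtype (eqSec _ _ _ _ _ _ V))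

theorem secChart_injective {V : Opens (ncProj n lam)} {s t : (ncProj n lam).presheaf.obj (op V)}
    (h : ∀ i, secChart V i s = secChart V i t) : s = t :=
  Subtype.ext (funext h)

/-- The restrictions of a section to two charts agree on the overlap. -/
theorem secChart_overlap {V : Opens (ncProj n lam)} (s : (ncProj n lam).presheaf.obj (op V))
    (i j : Fin n) {F : L0 (RA (sgl lam i))} (hF : F.pt ∈ chartPre i V)
    {F' : L0 (RA (sgl lam j))} (hF' : F'.pt ∈ chartPre j V) {G : L0 (RA (pr lam i j))}
    (h : F.image (res (sgl_le_left i j)) ≤ G) (h' : F'.image (res (sgl_le_right i j)) ≤ G) :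
    locMap (res (sgl_le_left i j)) h ((secChart V i s).1 ⟨F, hF⟩) =
      locMap (res (sgl_le_right i j)) h' ((secChart V j s).1 ⟨F', hF'⟩) := by
  have hG : G.pt ∈ (Opens.map (ncBase (chartMapL lam i j))).obj (chartPre i V) :=
    mem_of_pt_mem (V := chartPre i V) (F := F)
      (cls_mem_hatFun.mpr (cls_mem_pt.mpr h)) hF
  have hG' : G.pt ∈ (Opens.map (ncBase (chartMapR lam i j))).obj (chartPre j V) :=
    mem_of_pt_mem (V := chartPre j V) (F := F')
      (cls_mem_hatFun.mpr (cls_mem_pt.mpr h')) hF'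
  have e1 := ncMapSec_apply (chartMapL lam i j) (chartPre i V) (secChart V i s) ⟨G, hG⟩ ⟨F, hF⟩ h
  have e2 := ncMapSec_apply (chartMapR lam i j) (chartPre j V) (secChart V j s) ⟨G, hG'⟩
    ⟨F', hF'⟩ h'
  have e3 := congrArg (fun t => t.1 ⟨G, hG⟩) (s.2 (i, j))
  exact e1.symm.trans (e3.trans e2)

/-- The two maps factor through a node on the overlap of the charts i and j, where the gluing
condition applies. -/
theorem tm_secChart {V : Opens (ncProj n lam)} (s : (ncProj n lam).presheaf.obj (op V))
    {i j : Fin n} {F : L0 (RA (sgl lam i))} (hF : F.pt ∈ chartPre i V)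
    {F' : L0 (RA (sgl lam j))} (hF' : F'.pt ∈ chartPre j V) {k : Node lam}
    (h : (⟨sgl lam i, F⟩ : Node lam) ≤ k) (h' : (⟨sgl lam j, F'⟩ : Node lam) ≤ k) :
    tm h ((secChart V i s).1 ⟨F, hF⟩) = tm h' ((secChart V j s).1 ⟨F', hF'⟩) := by
  let l : Node lam := ⟨pr lam i j, (F.image (res (sgl_le_left i j))).union
    (F'.image (res (sgl_le_right i j)))⟩
  have hl : (⟨sgl lam i, F⟩ : Node lam) ≤ l := ⟨sgl_le_left i j, L0.le_union_left _ _⟩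
  have hl' : (⟨sgl lam j, F'⟩ : Node lam) ≤ l := ⟨sgl_le_right i j, L0.le_union_right _ _⟩
  have hp : pr lam i j ≤ k.set := pr_le (h.fst rfl) (h'.fst rfl)
  have hlk : l ≤ k := le_iff.mpr ⟨hp, fun a ha => by
    rcases L0.mem_union_image.mp ha with ⟨b, hb, rfl⟩ | ⟨b, hb, rfl⟩
    · rw [res_res]; exact (le_iff.mp h).snd b hb
    · rw [res_res]; exact (le_iff.mp h').snd b hb⟩
  rw [← tm_tm hl hlk, ← tm_tm hl' hlk]
  exact congrArg (tm hlk) (secChart_overlap s i j hF hF' _ _)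

theorem exists_sgl_le {V : Opens (ncProj n lam)} {j : Node lam} (hj : j.point ∈ V) :
    ∃ (i : Fin n) (F : L0 (RA (sgl lam i))), F.pt ∈ chartPre i V ∧
      (⟨sgl lam i, F⟩ : Node lam) ≤ j := by
  obtain ⟨i, hi⟩ := j.set.2.1
  rw [Node.point, inc_eq hi] at hj
  obtain ⟨F, hF, hFV⟩ := exists_pt_mem (V := chartPre i V) hj
  exact ⟨i, F, hFV, sgl_le hi, cls_mem_pt.mp (cls_mem_hatFun.mp hF)⟩

/-- The value of a section of the structure sheaf at a node. -/
def ev (V : Opens (ncProj n lam)) (j : Node lam) (hj : j.point ∈ V) :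
    (ncProj n lam).presheaf.obj (op V) →+* j.T :=
  (tm (exists_sgl_le hj).choose_spec.choose_spec.2).comp
    ((Pi.evalRingHom (fun F : {F : L0 (RA (sgl lam (exists_sgl_le hj).choose)) // 
        F.pt ∈ chartPre _ V} => LocF F.1)
      ⟨_, (exists_sgl_le hj).choose_spec.choose_spec.1⟩).comp
      ((Subring.subtype _).comp (secChart V (exists_sgl_le hj).choose)))

/-- Frees `ev` from the chart and the finite subset chosen in its definition. -/
theorem ev_eq {V : Opens (ncProj n lam)} {j : Node lam} (hj : j.point ∈ V)
    (s : (ncProj n lam).presheaf.obj (op V)) {i : Fin n} {F : L0 (RA (sgl lam i))}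
    (hF : F.pt ∈ chartPre i V) (h : (⟨sgl lam i, F⟩ : Node lam) ≤ j) :
    ev V j hj s = tm h ((secChart V i s).1 ⟨F, hF⟩) :=
  tm_secChart s _ _ _ _

theorem ev_sgl {V : Opens (ncProj n lam)} {i : Fin n} {F : L0 (RA (sgl lam i))}
    (hF : F.pt ∈ chartPre i V) (s : (ncProj n lam).presheaf.obj (op V)) :
    ev V ⟨sgl lam i, F⟩ (pt_mem_chartPre.mp hF) s = (secChart V i s).1 ⟨F, hF⟩ :=
  (ev_eq _ s hF le_rfl).trans (tm_refl _ _)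

theorem tm_ev {V : Opens (ncProj n lam)} {j k : Node lam} (h : j ≤ k) (hj : j.point ∈ V)
    (hk : k.point ∈ V) (s : (ncProj n lam).presheaf.obj (op V)) :
    tm h (ev V j hj s) = ev V k hk s := by
  obtain ⟨i, F, hF, hFj⟩ := exists_sgl_le hj
  rw [ev_eq hj s hF hFj, ev_eq hk s hF (hFj.trans h), tm_tm]

theorem ev_map {U V : Opens (ncProj n lam)} (i : U ⟶ V) {j : Node lam} (hj : j.point ∈ U)
    (s : (ncProj n lam).presheaf.obj (op V)) :
    ev U j hj ((ncProj n lam).presheaf.map i.op s) = ev V j (i.le hj) s := by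
  obtain ⟨k, F, hF, hFj⟩ := exists_sgl_le hj
  rw [ev_eq hj _ hF hFj, ev_eq (i.le hj) s (i.le hF) hFj]
  rfl

theorem ev_injective {V : Opens (ncProj n lam)} {s t : (ncProj n lam).presheaf.obj (op V)}
    (h : ∀ j hj, ev V j hj s = ev V j hj t) : s = t :=
  secChart_injective fun i => Subtype.ext (funext fun F => by
    rw [← ev_sgl F.2, ← ev_sgl F.2, h])

theorem ncMapSec_eq_of_fam {V : Opens (ncProj n lam)} {i : Fin n} {A : Idx lam}
    (hA : sgl lam i ≤ A) (f : ∀ j : Node lam, j.point ∈ V → j.T)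
    (hf : ∀ j k hj hk (h : j ≤ k), tm h (f j hj) = f k hk)
    (s : ncSec (RA (sgl lam i)) (chartPre i V))
    (hs : ∀ F h, s.1 ⟨F, h⟩ = f ⟨sgl lam i, F⟩ (pt_mem_chartPre.mp h))
    (G : {G : L0 (RA A) // G.pt ∈ (Opens.map (ncBase (res hA))).obj (chartPre i V)})
    (hG : Node.point ⟨A, G.1⟩ ∈ V) :
    (ncMapSec (res hA) (chartPre i V) s).1 G = f ⟨A, G.1⟩ hG := by
  obtain ⟨F, hF, hFV⟩ := exists_image_le G.2
  refine (ncMapSec_apply (res hA) (chartPre i V) s G ⟨F, hFV⟩ hF).trans ?_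
  exact (congrArg _ (hs F hFV)).trans
    (hf ⟨sgl lam i, F⟩ ⟨A, G.1⟩ (pt_mem_chartPre.mp hFV) hG ⟨hA, hF⟩)

/-- Together with `ev_injective` this identifies the structure sheaf of X with the sheaf of
compatible families over nodes; the gluing condition is compatibility at the nodes of pairwise
overlaps. -/
theorem exists_ev {V : Opens (ncProj n lam)} (f : ∀ j : Node lam, j.point ∈ V → j.T)
    (hf : ∀ j k hj hk (h : j ≤ k), tm h (f j hj) = f k hk) :
    ∃ s : (ncProj n lam).presheaf.obj (op V), ∀ j hj, ev V j hj s = f j hj := by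
  have hs : ∀ i, ∃ s : ncSec (RA (sgl lam i)) (chartPre i V),
      ∀ F h, s.1 ⟨F, h⟩ = f ⟨sgl lam i, F⟩ (pt_mem_chartPre.mp h) := fun i =>
    ⟨⟨fun F => f ⟨sgl lam i, F.1⟩ (pt_mem_chartPre.mp F.2), fun F G h => by
      refine Eq.trans ?_ (hf _ _ (pt_mem_chartPre.mp F.2) (pt_mem_chartPre.mp G.2)
        (le_of_fin_le h))
      rw [tm_le_of_fin_le]⟩, fun _ _ => rfl⟩
  choose s hs using hs
  have hk : ∀ k : Fin n × Fin n, ncMapSec (chartMapL lam k.1 k.2) (chartPre k.1 V) (s k.1) =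
      ncRes (gluePi_comp (fun i : Fin n => NCSpec (chartRing lam i))
        (fun i j => NCSpec (overlapRing lam i j))
        (fun i j => NCSpec.map (chartMapL lam i j)) (fun i j => NCSpec.map (chartMapR lam i j))
          k.1 k.2 V).le
        (ncMapSec (chartMapR lam k.1 k.2) (chartPre k.2 V) (s k.2)) := by
    rintro ⟨i, j⟩
    refine Subtype.ext (funext fun G => ?_)
    have hG : Node.point ⟨pr lam i j, G.1⟩ ∈ V := by
      rw [Node.point, inc_eq (A := pr lam i j) (i := i) (Or.inl rfl)]
      exact G.2
    exact (ncMapSec_eq_of_fam (sgl_le_left i j) f hf (s i) (hs i) G hG).trans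
      (ncMapSec_eq_of_fam (sgl_le_right i j) f hf (s j) (hs j) ⟨G.1, _⟩ hG).symm
  refine ⟨(⟨s, hk⟩ : eqSec (glueF (fun i : Fin n => NCSpec (chartRing lam i))
    (fun i j => NCSpec (overlapRing lam i j)) (fun i j => NCSpec.map (chartMapL lam i j))
    (fun i j => NCSpec.map (chartMapR lam i j))) (glueG _ _ _ _) Prod.fst Prod.snd
    (glueL _ _ _ _) (glueR _ _ _ _) V), fun j hj => ?_⟩
  obtain ⟨i, F, hF, hFj⟩ := exists_sgl_le hj
  exact (ev_eq hj _ hF hFj).trans ((congrArg (tm hFj) (hs i F hF)).trans (hf _ _ _ _ _))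

/-- The localizations of all charts, as a functor on nodes. -/
def nodeRing (lam : Fin n → Fin n → ℂ) : NodeSys lam where
  obj j := j.T
  map h := (tm h).toAddMonoidHom
  map_refl j t := tm_refl j t
  map_map h h' t := tm_tm h h' t
  bij _ w := w

variable [hlam : Fact (∀ i j : Fin n, i < j → lam i j ≠ 0)]

theorem ev_nbhd_bijective (j : Node lam) :
    Function.Bijective (ev j.nbhd j (point_mem_nbhd j)) := by
  constructor
  · intro s t h
    refine ev_injective fun k hk => ?_
    let f (s) : (nodeRing lam).fam j.nbhd := ⟨fun k => ev j.nbhd k.1 k.2 s, fun k l h =>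
      tm_ev h k.2 l.2 s⟩
    have := ((nodeRing lam).fam_nbhd_bijective j).1 (a₁ := f s) (a₂ := f t) h
    exact congrFun (congrArg Subtype.val this) ⟨k, hk⟩
  · intro t
    obtain ⟨f, hf⟩ := ((nodeRing lam).fam_nbhd_bijective j).2 t
    obtain ⟨s, hs⟩ := exists_ev (V := j.nbhd) (fun k hk => f.1 ⟨k, hk⟩)
      (fun k l hk hl h => f.2 ⟨k, hk⟩ ⟨l, hl⟩ h)
    exact ⟨s, (hs _ _).trans hf⟩

/-- Inside one chart the components at the other charts are redundant, by `fam_chart` for the system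
of localized rings. -/
theorem secChart_bijective {V : Opens (ncProj n lam)} {i : Fin n} (hV : V ≤ chartOpen i) :
    Function.Bijective (secChart V i) := by
  constructor
  · intro s t h
    refine ev_injective fun k hk => ?_
    let f (s) : (nodeRing lam).fam V := ⟨fun k => ev V k.1 k.2 s, fun k l h => tm_ev h k.2 l.2 s⟩
    have := ((nodeRing lam).fam_chart hV).1 (f s) (f t) fun F hF => by
      have e1 := ev_sgl (pt_mem_chartPre.mpr hF) s
      have e2 := ev_sgl (pt_mem_chartPre.mpr hF) t
      rw [h] at e1
      exact e1.trans e2.symm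
    exact congrFun (congrArg Subtype.val this) ⟨k, hk⟩
  · intro t
    obtain ⟨f, hf⟩ := ((nodeRing lam).fam_chart hV).2 (fun F hF => t.1 ⟨F, pt_mem_chartPre.mpr hF⟩)
      (fun F G hF hG h => by
        rw [← t.2 ⟨F, pt_mem_chartPre.mpr hF⟩ ⟨G, pt_mem_chartPre.mpr hG⟩ h]
        exact RingHom.congr_fun (tm_le_of_fin_le h) _)
    obtain ⟨s, hs⟩ := exists_ev (V := V) (fun k hk => f.1 ⟨k, hk⟩)
      (fun k l hk hl h => f.2 ⟨k, hk⟩ ⟨l, hl⟩ h)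
    refine ⟨s, Subtype.ext (funext fun F => ?_)⟩
    rw [← ev_sgl F.2, hs, hf]

end Structure

/-! ### Descent data and the associated sheaves -/

theorem IsBC.exists_semilinear {A B C : Type} [Ring A] [Ring B] [Ring C] {θ : A →+* B}
    {M N P : Type} [AddCommGroup M] [AddCommGroup N] [AddCommGroup P] [Module A M] [Module B N]
    [Module C P] {f : M →+ N} (hf : IsBC θ f) (φ : B →+* C) (q : M →+ P)
    (hq : ∀ a m, q (a • m) = φ (θ a) • q m) :
    ∃ g : N →+ P, (∀ b n, g (b • n) = φ b • g n) ∧ ∀ m, g (f m) = q m := by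
  let : Module B P := Module.compHom P φ
  obtain ⟨h, hh⟩ := hf.exists_lift q hq
  exact ⟨h.toAddMonoidHom, fun b n => h.map_smul b n, hh⟩

section Descent

open SkewPoly Node

variable {n : ℕ} {lam : Fin n → Fin n → ℂ}

/-- A system of modules over the degree zero components of the localizations at nonempty sets of
generators, compatible with extension of scalars. -/
structure DMod (lam : Fin n → Fin n → ℂ) where
  /-- the module of a set of generators -/
  obj : Idx lam → Type
  [grp : ∀ A, AddCommGroup (obj A)]
  [mod : ∀ A, Module (RA A) (obj A)]
  /-- the restriction maps -/
  map : ∀ {A B : Idx lam}, A ≤ B → obj A →+ obj B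
  map_refl : ∀ (A : Idx lam) (m : obj A), map (le_refl A) m = m
  map_map : ∀ {A B C : Idx lam} (h : A ≤ B) (h' : B ≤ C) (m : obj A),
    map h' (map h m) = map (h.trans h') m
  isBC : ∀ {A B : Idx lam} (h : A ≤ B), IsBC (res h) (map h)

attribute [instance] DMod.grp DMod.mod

namespace DMod

/-- Morphisms of descent data. -/
@[ext]
structure Hom (M N : DMod lam) where
  /-- the components -/
  app : ∀ A, M.obj A →ₗ[RA A] N.obj A
  naturality : ∀ {A B : Idx lam} (h : A ≤ B) (m : M.obj A),
    app B (M.map h m) = N.map h (app A m)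

instance : Category (DMod lam) where
  Hom := Hom
  id M := ⟨fun _ => LinearMap.id, fun _ _ => rfl⟩
  comp f g := ⟨fun A => (g.app A).comp (f.app A), fun h m => by
    simp [f.naturality, g.naturality]⟩

theorem hom_ext {M N : DMod lam} {f g : M ⟶ N} (h : ∀ A m, Hom.app f A m = Hom.app g A m) :
    f = g := Hom.ext (funext fun A => LinearMap.ext (h A))

@[simp]
theorem id_app (M : DMod lam) (A : Idx lam) (m : M.obj A) : Hom.app (𝟙 M) A m = m := rfl

@[simp]
theorem comp_app {M N P : DMod lam} (f : M ⟶ N) (g : N ⟶ P) (A : Idx lam) (m : M.obj A) :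
    Hom.app (f ≫ g) A m = Hom.app g A (Hom.app f A m) := rfl

variable (M : DMod lam)

/-- The localization of a descent datum at a node. -/
abbrev at_ (j : Node lam) : Type := LocMod j.fin (M.obj j.set)

/-- The canonical map to the localization. -/
def toAt (j : Node lam) : M.obj j.set →+ M.at_ j where
  toFun := fun m => Ext.tmul j.alg 1 m
  map_zero' := by simp [Ext.tmul]
  map_add' := fun x y => by simp [Ext.tmul, TensorProduct.tmul_add]

theorem isBC_toAt (j : Node lam) : IsBC j.alg (M.toAt j) := isBC_ext _ _

theorem exists_atMap {j k : Node lam} (h : j ≤ k) : ∃ g : M.at_ j →+ M.at_ k,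
    (∀ b n, g (b • n) = tm h b • g n) ∧ ∀ m, g (M.toAt j m) = M.toAt k (M.map h.fst m) :=
  (M.isBC_toAt j).exists_semilinear (tm h) ((M.toAt k).comp (M.map h.fst)) fun a m => by
    rw [AddMonoidHom.comp_apply, (M.isBC h.fst).map_smul, (M.isBC_toAt k).map_smul, tm_alg]
    rfl

/-- The transition maps between localizations. -/
def atMap {j k : Node lam} (h : j ≤ k) : M.at_ j →+ M.at_ k := (M.exists_atMap h).choose

theorem atMap_smul {j k : Node lam} (h : j ≤ k) (b : j.T) (m : M.at_ j) :
    M.atMap h (b • m) = tm h b • M.atMap h m := (M.exists_atMap h).choose_spec.1 b m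

@[simp]
theorem atMap_toAt {j k : Node lam} (h : j ≤ k) (m : M.obj j.set) :
    M.atMap h (M.toAt j m) = M.toAt k (M.map h.fst m) := (M.exists_atMap h).choose_spec.2 m

/-- From M_A to the localization at k one may pass through M_B or through the localization at j. The
first route is a base change, so the second is too and its first leg can be cancelled. -/
theorem isBC_atMap {j k : Node lam} (h : j ≤ k) : IsBC (tm h) (M.atMap h) := by
  refine (M.isBC_toAt j).cancel ?_ (M.atMap_smul h)
  have h1 : (tm h).comp j.alg = k.alg.comp (res h.fst) := RingHom.ext (tm_alg h)
  have h2 : (M.atMap h).comp (M.toAt j) = (M.toAt k).comp (M.map h.fst) :=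
    AddMonoidHom.ext (M.atMap_toAt h)
  rw [h1, h2]
  exact (M.isBC h.fst).comp (M.isBC_toAt k)

/-- The localizations of a descent datum as a functor on nodes. -/
def nodeSys : NodeSys lam where
  obj := M.at_
  map := M.atMap
  map_refl j t := by
    refine (M.isBC_toAt j).addHom_ext (φ := RingHom.id _) (h := M.atMap (le_refl j))
      (h' := AddMonoidHom.id _) (fun b m => ?_) (fun _ _ => rfl) (fun m => ?_) t
    · rw [atMap_smul, tm_refl]; rfl
    · rw [atMap_toAt]
      exact congrArg _ (M.map_refl _ m)
  map_map {j k l} h h' t := by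
    refine (M.isBC_toAt j).addHom_ext (φ := tm (h.trans h')) (h := (M.atMap h').comp (M.atMap h))
      (h' := M.atMap (h.trans h')) (fun b m => ?_) (M.atMap_smul _) (fun m => ?_) t
    · rw [AddMonoidHom.comp_apply, atMap_smul, atMap_smul, tm_tm]; rfl
    · rw [AddMonoidHom.comp_apply, atMap_toAt, atMap_toAt, atMap_toAt]
      exact congrArg _ (M.map_map _ _ m)
  -- Extension of scalars along an isomorphism is bijective, so weak maps are inverted.
  bij h w := (M.isBC_atMap h).bijective w

/-- Over a fixed set of generators the transition maps are those of the sheaf of a module, so on a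
chart the families become sections of that sheaf. -/
theorem atMap_le_of_fin_le {A : Idx lam} {F G : L0 (RA A)} (h : F ≤ G) (m : LocMod F (M.obj A)) :
    M.atMap (le_of_fin_le h) m = pMod h (M.obj A) m := by
  refine (M.isBC_toAt ⟨A, F⟩).addHom_ext (φ := pMap h) (h := M.atMap (le_of_fin_le h))
    (h' := (pMod h (M.obj A)).toAddMonoidHom) (fun b m => ?_)
    (fun b m => (pMod h (M.obj A)).map_smulₛₗ b m) (fun m => ?_) m
  · rw [atMap_smul, tm_le_of_fin_le]
  · rw [atMap_toAt]
    refine (congrArg _ (M.map_refl _ m)).trans ?_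
    exact congrArg (fun t => Ext.tmul (Loc.of _ _) t m) (map_one (pMap h)).symm

instance (j : Node lam) : Module j.T (M.nodeSys.obj j) := inferInstanceAs (Module j.T (M.at_ j))

instance famModule (V : Opens (ncProj n lam)) :
    Module ((ncProj n lam).presheaf.obj (op V)) (M.nodeSys.fam V) where
  smul r s := ⟨fun j => ev V j.1 j.2 r • s.1 j, fun j k h => by
    refine (M.atMap_smul h _ _).trans ?_
    rw [tm_ev h j.2 k.2]
    exact congrArg _ (s.2 j k h)⟩
  one_smul s := Subtype.ext (funext fun j => by
    refine (congrArg (· • s.1 j) (map_one (ev V j.1 j.2))).trans (one_smul _ _))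
  mul_smul a b s := Subtype.ext (funext fun j => by
    refine (congrArg (· • s.1 j) (map_mul (ev V j.1 j.2) a b)).trans
      (mul_smul _ _ _))
  smul_zero a := Subtype.ext (funext fun j => smul_zero _)
  smul_add a s t := Subtype.ext (funext fun j => smul_add _ _ _)
  add_smul a b s := Subtype.ext (funext fun j => by
    refine (congrArg (· • s.1 j) (map_add (ev V j.1 j.2) a b)).trans
      (add_smul _ _ _))
  zero_smul s := Subtype.ext (funext fun j => by
    refine (congrArg (· • s.1 j) (map_zero (ev V j.1 j.2))).trans (zero_smul _ _))

theorem fam_smul {V : Opens (ncProj n lam)} (r : (ncProj n lam).presheaf.obj (op V))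
    (s : M.nodeSys.fam V) (j : {j : Node lam // j.point ∈ V}) :
    (r • s).1 j = ev V j.1 j.2 r • s.1 j := rfl

/-- The presheaf of compatible families. -/
def famPresheaf : TopCat.Presheaf Ab.{0} (ncProj n lam) where
  obj V := AddCommGrpCat.of (M.nodeSys.fam V.unop)
  map i := AddCommGrpCat.ofHom (M.nodeSys.famRes i.unop.le)
  map_id _ := rfl
  map_comp _ _ := rfl

instance (V : (Opens (ncProj n lam))ᵒᵖ) :
    Module ((ncProj n lam).presheaf.obj V) (M.famPresheaf.obj V) :=
  M.famModule V.unop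

variable [hlam : Fact (∀ i j : Fin n, i < j → lam i j ≠ 0)]

omit hlam in
theorem famPresheaf_isSheaf : M.famPresheaf.IsSheaf := by
  rw [TopCat.Presheaf.isSheaf_iff_isSheaf_comp (forget Ab)]
  refine isSheaf_families _ (J := Node lam) Node.point (fun j => M.at_ j) (· ≤ ·)
    (fun _ _ h V => point_mem_of_le h) (fun _ _ h a b => M.atMap h a = b)
    (fun V s j h => (show M.nodeSys.fam V from s).1 ⟨j, h⟩) ?_ ?_ ?_ ?_
  · intro V s t h
    exact Subtype.ext (funext fun j => h j.1 j.2)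
  · intro V s j k h hj hk
    exact (show M.nodeSys.fam V from s).2 ⟨j, hj⟩ ⟨k, hk⟩ h
  · intro V f hf
    exact ⟨(⟨fun j => f j.1 j.2, fun j k h => hf j.1 k.1 h j.2 k.2⟩ : M.nodeSys.fam V),
      fun _ _ => rfl⟩
  · intro U V i s j h
    rfl

/-- The sheaf of modules associated to a descent datum. -/
def sheaf : OMod (ncProj n lam) where
  val := PresheafOfModules.ofPresheaf (R := (ncProj n lam).presheaf) M.famPresheaf (by
    intro U V i r s
    refine Subtype.ext (funext fun j => ?_)
    exact congrArg (· • ((show M.nodeSys.fam U.unop from s).1 ⟨j.1, i.unop.le j.2⟩ : M.nodeSys.obj j.1))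
      (ev_map i.unop j.2 r).symm)
  isSheaf := M.famPresheaf_isSheaf

end DMod

end Descent

/-! ### Sections of sheaves of modules -/

section Sections

variable {X : RSpace}

/-- The ring of sections of the structure sheaf. -/
abbrev RSec (X : RSpace) (V : Opens X) : Type := X.presheaf.obj (op V)

/-- Restriction of sections of the structure sheaf. -/
def rRes (X : RSpace) {U V : Opens X} (h : U ≤ V) : RSec X V →+* RSec X U :=
  (X.presheaf.map (homOfLE h).op).hom

/-- The module of sections of a sheaf of modules. -/
def MSec (M : OMod X) (V : Opens X) : Type := M.val.obj (op V)

instance (M : OMod X) (V : Opens X) : AddCommGroup (MSec M V) :=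
  inferInstanceAs (AddCommGroup (M.val.obj (op V)))

instance (M : OMod X) (V : Opens X) : Module (RSec X V) (MSec M V) :=
  inferInstanceAs (Module (X.sheaf.obj.obj (op V)) (M.val.obj (op V)))

/-- Restriction of sections of a sheaf of modules. -/
def mRes (M : OMod X) {U V : Opens X} (h : U ≤ V) : MSec M V →+ MSec M U :=
  (M.val.map (homOfLE h).op).hom.toAddMonoidHom

theorem mRes_smul (M : OMod X) {U V : Opens X} (h : U ≤ V) (r : RSec X V) (m : MSec M V) :
    mRes M h (r • m) = rRes X h r • mRes M h m :=
  (M.val.map (homOfLE h).op).hom.map_smul r m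

theorem mRes_refl (M : OMod X) {V : Opens X} (m : MSec M V) : mRes M (le_refl V) m = m :=
  CategoryTheory.congr_fun (M.val.presheaf.map_id (op V)) m

theorem mRes_mRes (M : OMod X) {U V W : Opens X} (h : V ≤ W) (h' : U ≤ V) (m : MSec M W) :
    mRes M h' (mRes M h m) = mRes M (h'.trans h) m :=
  (CategoryTheory.congr_fun (M.val.presheaf.map_comp (homOfLE h).op (homOfLE h').op) m).symm

variable {M N P : OMod X}

/-- The action of a morphism on sections. -/
def mApp (φ : M ⟶ N) (V : Opens X) : MSec M V →ₗ[RSec X V] MSec N V := (φ.val.app (op V)).hom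

theorem mApp_mRes (φ : M ⟶ N) {U V : Opens X} (h : U ≤ V) (m : MSec M V) :
    mApp φ U (mRes M h m) = mRes N h (mApp φ V m) :=
  PresheafOfModules.naturality_apply φ.val (homOfLE h).op m

theorem mApp_id (V : Opens X) (m : MSec M V) : mApp (𝟙 M) V m = m := rfl

theorem mApp_comp (φ : M ⟶ N) (ψ : N ⟶ P) (V : Opens X) (m : MSec M V) :
    mApp (φ ≫ ψ) V m = mApp ψ V (mApp φ V m) := rfl

theorem mHom_ext {φ ψ : M ⟶ N} (h : ∀ V m, mApp φ V m = mApp ψ V m) : φ = ψ :=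
  SheafOfModules.hom_ext (PresheafOfModules.hom_ext fun V => ModuleCat.hom_ext
    (LinearMap.ext fun m => h V.unop m))

/-- Morphisms of sheaves of modules from maps on sections. -/
def mHomMk (f : ∀ V, MSec M V →ₗ[RSec X V] MSec N V)
    (hf : ∀ {U V : Opens X} (h : U ≤ V) m, f U (mRes M h m) = mRes N h (f V m)) : M ⟶ N where
  val :=
    { app := fun V => ModuleCat.ofHom (f V.unop)
      naturality := fun i => ModuleCat.hom_ext (LinearMap.ext fun m => hf i.unop.le m) }

/-- Isomorphisms of sheaves of modules from bijections on sections. -/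
def mIsoMk (f : ∀ V, MSec M V →ₗ[RSec X V] MSec N V)
    (hf : ∀ {U V : Opens X} (h : U ≤ V) m, f U (mRes M h m) = mRes N h (f V m))
    (hb : ∀ V, Function.Bijective (f V)) : M ≅ N where
  hom := mHomMk f hf
  inv := mHomMk (fun V => (LinearEquiv.ofBijective (f V) (hb V)).symm) fun {U V} h m => by
    refine (hb U).1 ?_
    rw [hf]
    exact (LinearEquiv.apply_symm_apply (LinearEquiv.ofBijective (f U) (hb U)) _).trans
      (congrArg _ (LinearEquiv.apply_symm_apply (LinearEquiv.ofBijective (f V) (hb V)) m).symm)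
  hom_inv_id := mHom_ext fun V m =>
    LinearEquiv.symm_apply_apply (LinearEquiv.ofBijective (f V) (hb V)) m
  inv_hom_id := mHom_ext fun V m =>
    LinearEquiv.apply_symm_apply (LinearEquiv.ofBijective (f V) (hb V)) m

theorem mApp_bijective (e : M ≅ N) (V : Opens X) : Function.Bijective (mApp e.hom V) :=
  Function.bijective_iff_has_inverse.mpr ⟨mApp e.inv V,
    fun m => by rw [← mApp_comp, e.hom_inv_id, mApp_id],
    fun m => by rw [← mApp_comp, e.inv_hom_id, mApp_id]⟩

theorem mSec_ext {V : Opens X} {ι : Type} (U : ι → Opens X) (hU : ∀ i, U i ≤ V) (hV : V ≤ iSup U)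
    {s t : MSec M V} (h : ∀ i, mRes M (hU i) s = mRes M (hU i) t) : s = t :=
  TopCat.Sheaf.eq_of_locally_eq' (C := Ab) ⟨M.val.presheaf, M.isSheaf⟩ U V
    (fun i => homOfLE (hU i)) hV s t h

theorem mSec_glue {V : Opens X} {ι : Type} (U : ι → Opens X) (hU : ∀ i, U i ≤ V)
    (hV : V ≤ iSup U) (s : ∀ i, MSec M (U i))
    (hs : ∀ i j, mRes M (inf_le_left : U i ⊓ U j ≤ U i) (s i) =
      mRes M (inf_le_right : U i ⊓ U j ≤ U j) (s j)) :
    ∃ t : MSec M V, ∀ i, mRes M (hU i) t = s i := by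
  obtain ⟨t, ht, -⟩ := TopCat.Sheaf.existsUnique_gluing' (C := Ab) ⟨M.val.presheaf, M.isSheaf⟩ U V
    (fun i => homOfLE (hU i)) hV s (fun i j => hs i j)
  exact ⟨t, ht⟩

/-! ### Restriction to an open subspace -/

variable {U : Opens X} {Y : RSpace} (e : openSub X U ≅ Y)

/-- The open subset of `X` which corresponds to an open subset of a space isomorphic to an open
subspace of `X`. -/
def imgOpen (W : Opens Y) : Opens X :=
  U.isOpenEmbedding.isOpenMap.functor.obj ((Opens.map e.hom.hom.base).obj W)

theorem imgOpen_mono {W W' : Opens Y} (h : W ≤ W') : imgOpen e W ≤ imgOpen e W' :=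
  (U.isOpenEmbedding.isOpenMap.functor.map ((Opens.map e.hom.hom.base).map (homOfLE h))).le

/-- Transport of sections of the structure sheaf. -/
def ringImg (W : Opens Y) : RSec Y W →+* RSec X (imgOpen e W) := (e.hom.hom.c.app (op W)).hom

theorem ringImg_bijective (W : Opens Y) : Function.Bijective (ringImg e W) := by
  have : IsIso e.hom.hom := inferInstance
  have : IsIso e.hom.hom.c := AlgebraicGeometry.PresheafedSpace.c_isIso_of_iso e.hom.hom
  have : IsIso (e.hom.hom.c.app (op W)) := inferInstance
  exact ConcreteCategory.bijective_of_isIso (e.hom.hom.c.app (op W))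

theorem rRes_ringImg {W W' : Opens Y} (h : W ≤ W') (r : RSec Y W') :
    ringImg e W (rRes Y h r) = rRes X (imgOpen_mono e h) (ringImg e W' r) :=
  ConcreteCategory.congr_hom (e.hom.hom.c.naturality (homOfLE h).op) r

variable (M)

/-- Sections of the restriction of a sheaf of modules to an open subspace. -/
def modImg (W : Opens Y) :
    MSec ((pushMod e.hom).obj ((resMod X U).obj M)) W ≃+ MSec M (imgOpen e W) :=
  AddEquiv.refl _

theorem modImg_smul (W : Opens Y) (r : RSec Y W)
    (m : MSec ((pushMod e.hom).obj ((resMod X U).obj M)) W) :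
    modImg M e W (r • m) = ringImg e W r • modImg M e W m := rfl

theorem modImg_mRes {W W' : Opens Y} (h : W ≤ W')
    (m : MSec ((pushMod e.hom).obj ((resMod X U).obj M)) W') :
    modImg M e W (mRes _ h m) = mRes M (imgOpen_mono e h) (modImg M e W' m) := rfl

end Sections

/-! ### Quasicoherence of the sheaf of a descent datum -/

section Charts

open SkewPoly Node

variable {n : ℕ} {lam : Fin n → Fin n → ℂ} [hlam : Fact (∀ i j : Fin n, i < j → lam i j ≠ 0)]

/-- The homeomorphism from the spectrum of a chart onto its image. -/
def chartHomeo (i : Fin n) :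
    (openSub (ncProj n lam) (chartOpen i)).carrier ≅ NCTop (RA (sgl lam i)) :=
  TopCat.isoOfHomeo (isOpenEmbedding_chart i).toIsEmbedding.toHomeomorph.symm

/-- The open subset of the projective space which corresponds to an open subset of a chart. -/
def chartImage (i : Fin n) (W : Opens (NCTop (RA (sgl lam i)))) : Opens (ncProj n lam) :=
  (chartOpen i).isOpenEmbedding.isOpenMap.functor.obj
    ((Opens.map (chartHomeo (lam := lam) i).hom).obj W)

theorem chartImage_le (i : Fin n) (W : Opens (NCTop (RA (sgl lam i)))) :
    chartImage i W ≤ chartOpen i := by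
  rintro _ ⟨q, -, rfl⟩
  exact q.2

theorem chart_mem_chartImage {i : Fin n} {W : Opens (NCTop (RA (sgl lam i)))}
    {C : NCTop (RA (sgl lam i))} : chart i C ∈ chartImage i W ↔ C ∈ W := by
  have hC : (chartHomeo (lam := lam) i).hom ⟨chart i C, C, rfl⟩ = C :=
    (isOpenEmbedding_chart i).toIsEmbedding.toHomeomorph.symm_apply_apply C
  constructor
  · rintro ⟨q, hq, e⟩
    have : q = ⟨chart i C, C, rfl⟩ := Subtype.ext e
    subst this
    change (chartHomeo (lam := lam) i).hom _ ∈ W at hq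
    rwa [hC] at hq
  · intro h
    refine ⟨⟨chart i C, C, rfl⟩, ?_, rfl⟩
    change (chartHomeo (lam := lam) i).hom _ ∈ W
    rwa [hC]

theorem chartPre_chartImage (i : Fin n) (W : Opens (NCTop (RA (sgl lam i)))) :
    chartPre i (chartImage i W) = W :=
  Opens.ext (Set.ext fun _ => chart_mem_chartImage)

theorem sgl_mem_chartImage {i : Fin n} {W : Opens (NCTop (RA (sgl lam i)))}
    {F : L0 (RA (sgl lam i))} : Node.point ⟨sgl lam i, F⟩ ∈ chartImage i W ↔ F.pt ∈ W := by
  rw [point_sgl, chart_mem_chartImage]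

/-- Sections over an open subset of a chart. -/
def secImage (i : Fin n) (W : Opens (NCTop (RA (sgl lam i)))) :
    RSec (ncProj n lam) (chartImage i W) →+* ncSec (RA (sgl lam i)) W :=
  (ncRes (chartPre_chartImage i W).ge).comp (secChart _ i)

theorem secImage_apply (i : Fin n) (W : Opens (NCTop (RA (sgl lam i))))
    (s : RSec (ncProj n lam) (chartImage i W)) (F : {F : L0 (RA (sgl lam i)) // F.pt ∈ W}) :
    (secImage i W s).1 F = ev _ ⟨sgl lam i, F.1⟩ (sgl_mem_chartImage.mpr F.2) s :=
  (ev_sgl (V := chartImage i W) (i := i) (chart_mem_chartImage.mpr F.2) s).symm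

theorem secImage_bijective (i : Fin n) (W : Opens (NCTop (RA (sgl lam i)))) :
    Function.Bijective (secImage (lam := lam) i W) := by
  refine Function.Bijective.comp (g := ncRes (chartPre_chartImage i W).ge) ?_
    (secChart_bijective (chartImage_le i W))
  exact Function.bijective_iff_has_inverse.mpr ⟨ncRes (chartPre_chartImage i W).le,
    fun _ => rfl, fun _ => rfl⟩

/-- A chart of the projective space is the spectrum of a ring. -/
def chartIso (i : Fin n) : openSub (ncProj n lam) (chartOpen i) ≅ NCSpec (RA (sgl lam i)) :=
  AlgebraicGeometry.SheafedSpace.isoMk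
    (AlgebraicGeometry.PresheafedSpace.isoOfComponents (chartHomeo i)
      (NatIso.ofComponents
        (fun W => (RingEquiv.ofBijective (secImage i W.unop)
          (secImage_bijective i W.unop)).toRingCatIso)
        (fun _ => rfl)))

theorem secImage_c (i : Fin n) (W : Opens (NCTop (RA (sgl lam i))))
    (r : ncSec (RA (sgl lam i)) W) :
    secImage i W (ringImg (chartIso (lam := lam) i) W r) = r :=
  (RingEquiv.ofBijective (secImage i W) (secImage_bijective i W)).apply_symm_apply r

variable (M : DMod lam)

/-- The node of a chart which belongs to a finite subset. -/
def sglNode (i : Fin n) {W : Opens (NCTop (RA (sgl lam i)))} (F : L0 (RA (sgl lam i)))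
    (hF : F.pt ∈ W) : {j : Node lam // j.point ∈ chartImage i W} :=
  ⟨⟨sgl lam i, F⟩, sgl_mem_chartImage.mpr hF⟩

/-- The value of a family at a node of a chart. -/
def famAt (i : Fin n) {W : Opens (NCTop (RA (sgl lam i)))} (s : M.nodeSys.fam (chartImage i W))
    (F : L0 (RA (sgl lam i))) (hF : F.pt ∈ W) : LocMod F (M.obj (sgl lam i)) :=
  s.1 (sglNode i F hF)

theorem pMod_famAt (i : Fin n) {W : Opens (NCTop (RA (sgl lam i)))}
    (s : M.nodeSys.fam (chartImage i W)) (F G : L0 (RA (sgl lam i))) (hF : F.pt ∈ W)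
    (hG : G.pt ∈ W) (h : F ≤ G) :
    pMod h (M.obj (sgl lam i)) (famAt M i s F hF) = famAt M i s G hG :=
  (M.atMap_le_of_fin_le h _).symm.trans
    (s.2 (sglNode i F hF) (sglNode i G hG) (le_of_fin_le h))

/-- Restriction of families to the nodes of a chart. -/
def chartFam (i : Fin n) (W : Opens (NCTop (RA (sgl lam i)))) :
    M.nodeSys.fam (chartImage i W) →+ tildeSec (R := RA (sgl lam i)) (M.obj (sgl lam i)) W where
  toFun s := ⟨fun F => famAt M i s F.1 F.2, fun F G h => pMod_famAt M i s F.1 G.1 F.2 G.2 h⟩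
  map_zero' := rfl
  map_add' _ _ := rfl

theorem chartFam_smul (i : Fin n) (W : Opens (NCTop (RA (sgl lam i))))
    (r : RSec (ncProj n lam) (chartImage i W)) (s : M.nodeSys.fam (chartImage i W)) :
    chartFam M i W (r • s) = secImage i W r • chartFam M i W s :=
  Subtype.ext (funext fun F => by
    refine (M.fam_smul r s (sglNode i F.1 F.2)).trans ?_
    exact congrArg (fun z : LocF F.1 => z • famAt M i s F.1 F.2) (secImage_apply i W r F).symm)

theorem chartFam_ringImg_smul (i : Fin n) (W : Opens (NCTop (RA (sgl lam i))))
    (r : ncSec (RA (sgl lam i)) W) (s : M.nodeSys.fam (chartImage i W)) :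
    chartFam M i W ((show RSec (ncProj n lam) (chartImage i W) from
      ringImg (chartIso (lam := lam) i) W r) • s) = r • chartFam M i W s := by
  rw [chartFam_smul]
  exact congrArg (· • chartFam M i W s) (secImage_c i W r)

/-- The value at a node of a chart of a section of the sheaf of a module. -/
def secAt (i : Fin n) {W : Opens (NCTop (RA (sgl lam i)))}
    (t : tildeSec (R := RA (sgl lam i)) (M.obj (sgl lam i)) W) (F : L0 (RA (sgl lam i)))
    (hF : F.pt ∈ W) : M.nodeSys.obj ⟨sgl lam i, F⟩ := t.1 ⟨F, hF⟩

omit hlam in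
theorem map_secAt (i : Fin n) {W : Opens (NCTop (RA (sgl lam i)))}
    (t : tildeSec (R := RA (sgl lam i)) (M.obj (sgl lam i)) W) (F G : L0 (RA (sgl lam i)))
    (hF : F.pt ∈ W) (hG : G.pt ∈ W) (h : F ≤ G) :
    M.nodeSys.map (le_of_fin_le h) (secAt M i t F hF) = secAt M i t G hG :=
  (M.atMap_le_of_fin_le h _).trans (t.2 ⟨F, hF⟩ ⟨G, hG⟩ h)

/-- By `fam_chart`, a family over an open subset of a chart amounts to its values at the nodes of
that chart. -/
theorem chartFam_bijective (i : Fin n) (W : Opens (NCTop (RA (sgl lam i)))) :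
    Function.Bijective (chartFam M i W) := by
  have h := M.nodeSys.fam_chart (chartImage_le i W)
  constructor
  · intro s t e
    refine h.1 s t fun F hF => ?_
    have e1 : (chartFam M i W s).1 ⟨F, sgl_mem_chartImage.mp hF⟩ =
      (chartFam M i W t).1 ⟨F, sgl_mem_chartImage.mp hF⟩ := by rw [e]
    exact e1
  · intro t
    obtain ⟨s, hs⟩ := h.2 (fun F hF => secAt M i t F (sgl_mem_chartImage.mp hF))
      (fun F G hF hG h => map_secAt M i t F G _ _ h)
    exact ⟨s, Subtype.ext (funext fun F => hs F.1 (sgl_mem_chartImage.mpr F.2))⟩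

/-- Sections of the sheaf of a descent datum. -/
def famSec (V : Opens (ncProj n lam)) : MSec M.sheaf V ≃+ M.nodeSys.fam V := AddEquiv.refl _

omit hlam in
theorem famSec_smul {V : Opens (ncProj n lam)} (r : RSec (ncProj n lam) V) (m : MSec M.sheaf V) :
    famSec M V (r • m) = r • famSec M V m := rfl

/-- Sections of the sheaf associated to a module. -/
def tildeSecEquiv {R : Type} [Ring R] (N : Type) [AddCommGroup N] [Module R N]
    (W : Opens (NCSpec R)) : MSec (tildeMod R N) W ≃+ tildeSec (R := R) N W := AddEquiv.refl _

/-- The sections over an open subset of a chart of the sheaf of a descent datum. -/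
def chartModEquiv (i : Fin n) (W : Opens (NCSpec (RA (sgl lam i)))) :
    MSec ((pushMod (chartIso i).hom).obj ((resMod (ncProj n lam) (chartOpen i)).obj M.sheaf)) W →+
      MSec (tildeMod (RA (sgl lam i)) (M.obj (sgl lam i))) W :=
  (tildeSecEquiv _ W).symm.toAddMonoidHom.comp ((chartFam M i W).comp
    ((famSec M (chartImage i W)).toAddMonoidHom.comp
      (modImg M.sheaf (chartIso i) W).toAddMonoidHom))

theorem chartModEquiv_smul (i : Fin n) (W : Opens (NCSpec (RA (sgl lam i))))
    (r : RSec (NCSpec (RA (sgl lam i))) W) (m) :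
    chartModEquiv M i W (r • m) = r • chartModEquiv M i W m := by
  have h1 := modImg_smul M.sheaf (chartIso i) W r m
  have h2 := famSec_smul M (ringImg (chartIso (lam := lam) i) W r) (modImg M.sheaf (chartIso i) W m)
  have h3 := chartFam_ringImg_smul M i W r (famSec M _ (modImg M.sheaf (chartIso i) W m))
  refine (congrArg (fun t => (tildeSecEquiv _ W).symm (chartFam M i W (famSec M _ t))) h1).trans ?_
  refine (congrArg (fun t => (tildeSecEquiv _ W).symm (chartFam M i W t)) h2).trans ?_
  exact congrArg (tildeSecEquiv _ W).symm h3

theorem chartModEquiv_bijective (i : Fin n) (W : Opens (NCSpec (RA (sgl lam i)))) :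
    Function.Bijective (chartModEquiv M i W) :=
  (tildeSecEquiv _ W).symm.bijective.comp ((chartFam_bijective M i W).comp
    ((famSec M (chartImage i W)).bijective.comp (modImg M.sheaf (chartIso i) W).bijective))

/-- The sheaf of a descent datum corresponds over a chart to the sheaf of a module. -/
def chartModIso (i : Fin n) :
    (pushMod (chartIso i).hom).obj ((resMod (ncProj n lam) (chartOpen i)).obj M.sheaf) ≅
      tildeMod (RA (sgl lam i)) (M.obj (sgl lam i)) :=
  mIsoMk (fun W => { chartModEquiv M i W with map_smul' := chartModEquiv_smul M i W })
    (fun _ _ => rfl) (fun W => chartModEquiv_bijective M i W)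

theorem iSup_chartOpen : (⨆ i, chartOpen (lam := lam) i) = ⊤ := by
  refine top_le_iff.mp fun p _ => ?_
  obtain ⟨i, C, rfl⟩ := exists_chart p
  exact Opens.mem_iSup.mpr ⟨i, C, rfl⟩

theorem DMod.isQcoh_sheaf : IsQcoh (ncProj n lam) M.sheaf :=
  ⟨Fin n, chartOpen, iSup_chartOpen, fun i =>
    ⟨RingCat.of (RA (sgl lam i)), chartIso i, ModuleCat.of (RA (sgl lam i)) (M.obj (sgl lam i)),
      ⟨chartModIso M i⟩⟩⟩

end Charts

/-! ### Quasicoherent sheaves on minimal open subsets -/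

/-- Variant of `transport` for isomorphisms pointing towards the known base change, the direction of
evaluation maps. -/
theorem IsBC.transport_symm {A B A' B' : Type} [Ring A] [Ring B] [Ring A'] [Ring B']
    {M N M' N' : Type} [AddCommGroup M] [AddCommGroup N] [AddCommGroup M'] [AddCommGroup N']
    [Module A M] [Module B N] [Module A' M'] [Module B' N'] {θ : A →+* B} {θ' : A' →+* B'}
    {f : M →+ N} {f' : M' →+ N'} (hf : IsBC θ f) {a : A' →+* A} {b : B' →+* B}
    (ha : Function.Bijective a) (hb : Function.Bijective b) (hθ : ∀ x, b (θ' x) = θ (a x))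
    {α : M' →+ M} {β : N' →+ N} (hα : Function.Bijective α) (hβ : Function.Bijective β)
    (hα' : ∀ x m, α (x • m) = a x • α m) (hβ' : ∀ x m, β (x • m) = b x • β m)
    (hfα : ∀ m, β (f' m) = f (α m)) : IsBC θ' f' := by
  let ea := RingEquiv.ofBijective a ha
  let eb := RingEquiv.ofBijective b hb
  let eα := AddEquiv.ofBijective α hα
  let eβ := AddEquiv.ofBijective β hβ
  have h1 : ∀ x, a (ea.symm x) = x := ea.apply_symm_apply
  have h2 : ∀ x, b (eb.symm x) = x := eb.apply_symm_apply
  have h3 : ∀ x, α (eα.symm x) = x := eα.apply_symm_apply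
  have h4 : ∀ x, β (eβ.symm x) = x := eβ.apply_symm_apply
  refine hf.transport (a := (ea.symm : A →+* A')) (b := (eb.symm : B →+* B')) ea.symm.bijective
    eb.symm.bijective (fun x => hb.1 ?_) (α := eα.symm.toAddMonoidHom)
    (β := eβ.symm.toAddMonoidHom) eα.symm.bijective eβ.symm.bijective (fun x m => hα.1 ?_)
    (fun x m => hβ.1 ?_) (fun m => hβ.1 ?_)
  · exact (h2 _).trans ((congrArg θ (h1 x).symm).trans (hθ _).symm)
  · exact (h3 _).trans ((congrArg₂ (· • ·) (h1 x) (h3 m)).symm.trans (hα' _ _).symm)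
  · exact (h4 _).trans ((congrArg₂ (· • ·) (h2 x) (h4 m)).symm.trans (hβ' _ _).symm)
  · exact (h4 _).trans ((congrArg f (h3 m)).symm.trans (hfα _).symm)

/-- An open subset which is the smallest neighbourhood of a point. -/
def IsLeastNhd {X : Type} [TopologicalSpace X] (V : Opens X) : Prop :=
  ∃ p ∈ V, ∀ V' : Opens X, p ∈ V' → V ≤ V'

/-! ### Smallest open neighbourhoods in the spectrum of a ring -/

section Affine

variable {R : Type} [Ring R]

/-- If W is smallest around q, some F in q has its point in W. The open set of all points containing
F is a neighbourhood of q, hence contains W. -/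
theorem IsLeastNhd.exists_least {W : Opens (NCTop R)} (h : IsLeastNhd W) :
    ∃ F : L0 R, F.pt ∈ W ∧ ∀ G : L0 R, G.pt ∈ W → F ≤ G := by
  obtain ⟨q, hq, hW⟩ := h
  obtain ⟨F, hF, hFW⟩ := exists_pt_mem hq
  refine ⟨F, hFW, fun G hG => ?_⟩
  obtain ⟨F₁, hF₁, rfl⟩ := hW ⟨_, isOpen_of_exists_le (fun G => G = F)⟩ ⟨F, hF, rfl⟩ hG
  exact cls_mem_pt.mp hF₁

/-- Evaluation of sections of the structure sheaf. -/
def ncEval (W : Opens (NCTop R)) (F : L0 R) (hF : F.pt ∈ W) : ncSec R W →+* LocF F :=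
  (Pi.evalRingHom (fun F : {F : L0 R // F.pt ∈ W} => LocF F.1) ⟨F, hF⟩).comp (Subring.subtype _)

theorem ncEval_bijective {W : Opens (NCTop R)} {F : L0 R} (hF : F.pt ∈ W)
    (h : ∀ G : L0 R, G.pt ∈ W → F ≤ G) : Function.Bijective (ncEval W F hF) := by
  constructor
  · intro s t e
    refine Subtype.ext (funext fun G => ?_)
    rw [← s.2 ⟨F, hF⟩ G (h G.1 G.2), ← t.2 ⟨F, hF⟩ G (h G.1 G.2)]
    exact congrArg (pMap (h G.1 G.2)) e
  · intro t
    exact ⟨⟨fun G => pMap (h G.1 G.2) t, fun G G' hG => pMap_pMap _ _ t⟩, pMap_refl F t⟩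

variable (N : Type) [AddCommGroup N] [Module R N]

theorem pMod_refl (F : L0 R) (t : LocMod F N) : pMod (le_refl F) N t = t := by
  induction t using Ext.induction with
  | htmul s m =>
    refine (Ext.map_tmul (pMap (le_refl F)) _ s m).trans ?_
    rw [pMap_refl]
  | hadd x y hx hy => rw [map_add, hx, hy]

theorem pMod_pMod {F G H : L0 R} (h : F ≤ G) (h' : G ≤ H) (t : LocMod F N) :
    pMod h' N (pMod h N t) = pMod (h.trans h') N t := by
  induction t using Ext.induction with
  | htmul s m =>
    refine (congrArg (pMod h' N) (Ext.map_tmul (pMap h) _ s m)).trans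
      ((Ext.map_tmul (pMap h') _ _ m).trans ?_)
    rw [pMap_pMap]
    exact (Ext.map_tmul (pMap (h.trans h')) _ s m).symm
  | hadd x y hx hy => rw [map_add, map_add, map_add, hx, hy]

/-- Evaluation of sections of the sheaf associated to a module. -/
def tildeEval (W : Opens (NCTop R)) (F : L0 R) (hF : F.pt ∈ W) :
    tildeSec (R := R) N W →+ LocMod F N where
  toFun s := s.1 ⟨F, hF⟩
  map_zero' := rfl
  map_add' _ _ := rfl

theorem tildeEval_smul (W : Opens (NCTop R)) (F : L0 R) (hF : F.pt ∈ W) (r : ncSec R W)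
    (s : tildeSec (R := R) N W) :
    tildeEval N W F hF (r • s) = ncEval W F hF r • tildeEval N W F hF s := rfl

theorem pMap_ncEval {W W' : Opens (NCTop R)} (hW : W' ≤ W) {F G : L0 R} (hF : F.pt ∈ W)
    (hG : G.pt ∈ W') (h : F ≤ G) (s : ncSec R W) :
    ncEval W' G hG (ncRes hW s) = pMap h (ncEval W F hF s) :=
  (s.2 ⟨F, hF⟩ ⟨G, hW hG⟩ h).symm

theorem pMod_tildeEval {W W' : Opens (NCTop R)} (hW : W' ≤ W) {F G : L0 R} (hF : F.pt ∈ W)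
    (hG : G.pt ∈ W') (h : F ≤ G) (s : tildeSec (R := R) N W) :
    tildeEval N W' G hG (tildeRes N hW s) = pMod h N (tildeEval N W F hF s) :=
  (s.2 ⟨F, hF⟩ ⟨G, hW hG⟩ h).symm

theorem tildeEval_bijective {W : Opens (NCTop R)} {F : L0 R} (hF : F.pt ∈ W)
    (h : ∀ G : L0 R, G.pt ∈ W → F ≤ G) : Function.Bijective (tildeEval N W F hF) := by
  constructor
  · intro s t e
    refine Subtype.ext (funext fun G => ?_)
    rw [← s.2 ⟨F, hF⟩ G (h G.1 G.2), ← t.2 ⟨F, hF⟩ G (h G.1 G.2)]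
    exact congrArg (pMod (h G.1 G.2) N) e
  · intro t
    exact ⟨⟨fun G => pMod (h G.1 G.2) N t, fun G G' hG => pMod_pMod N _ _ t⟩, pMod_refl N F t⟩

theorem isBC_pMod {F G : L0 R} (h : F ≤ G) : IsBC (pMap h) (pMod h N).toAddMonoidHom := by
  refine (isBC_ext (Loc.of R (F.fin : Set R)) N).cancel ?_ (fun b n => (pMod h N).map_smulₛₗ b n)
  have h1 : (pMap h).comp (Loc.of R (F.fin : Set R)) = Loc.of R (G.fin : Set R) :=
    RingHom.ext (pMap_of h)
  rw [h1]
  convert isBC_ext (Loc.of R (G.fin : Set R)) N using 1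
  refine AddMonoidHom.ext fun m => ?_
  refine (Ext.map_tmul (pMap h) (pMap_of h) 1 m).trans ?_
  rw [map_one]
  rfl

/-- Evaluation at the least finite subsets F and G of W and U turns restriction into loc(R, F) ⊗ N →
loc(R, G) ⊗ N. -/
theorem isBC_tildeRes {U W : Opens (NCTop R)} (h : U ≤ W) (hU : IsLeastNhd U)
    (hW : IsLeastNhd W) : IsBC (ncRes (R := R) h) (M := tildeSec (R := R) N W)
      (N := tildeSec (R := R) N U) (tildeRes (R := R) N h) := by
  obtain ⟨F, hF, hFW⟩ := hW.exists_least
  obtain ⟨G, hG, hGU⟩ := hU.exists_least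
  exact (isBC_pMod N (hFW G (h hG))).transport_symm (a := ncEval W F hF) (b := ncEval U G hG)
    (ncEval_bijective hF hFW) (ncEval_bijective hG hGU) (pMap_ncEval h hF hG _)
    (α := tildeEval N W F hF) (β := tildeEval N U G hG) (tildeEval_bijective N hF hFW)
    (tildeEval_bijective N hG hGU) (tildeEval_smul N W F hF) (tildeEval_smul N U G hG)
    (pMod_tildeEval N h hF hG _)

theorem isBC_tildeMod {U W : Opens (NCSpec R)} (h : U ≤ W) (hU : IsLeastNhd U)
    (hW : IsLeastNhd W) : IsBC (rRes (NCSpec R) h) (mRes (tildeMod R N) h) :=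
  isBC_tildeRes N h hU hW

end Affine

/-! ### Transport of smallest neighbourhoods to an open subspace -/

section Open

variable {X : RSpace} {U : Opens X} {Y : RSpace} (e : openSub X U ≅ Y)

theorem mem_imgOpen {W : Opens Y} {p : X} :
    p ∈ imgOpen e W ↔ ∃ hp : p ∈ U, e.hom.hom.base ⟨p, hp⟩ ∈ W := by
  constructor
  · rintro ⟨q, hq, rfl⟩
    exact ⟨q.2, hq⟩
  · rintro ⟨hp, h⟩
    exact ⟨⟨p, hp⟩, h, rfl⟩

theorem base_inv_hom (y : Y) : e.hom.hom.base (e.inv.hom.base y) = y :=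
  ConcreteCategory.congr_hom (congrArg (fun f => f.hom.base) e.inv_hom_id) y

theorem base_hom_inv (q : openSub X U) : e.inv.hom.base (e.hom.hom.base q) = q :=
  ConcreteCategory.congr_hom (congrArg (fun f => f.hom.base) e.hom_inv_id) q

theorem exists_imgOpen {V : Opens X} (hV : V ≤ U) : ∃ W : Opens Y, imgOpen e W = V := by
  refine ⟨(Opens.map e.inv.hom.base).obj ((Opens.map U.inclusion').obj V), Opens.ext ?_⟩
  ext p
  refine (mem_imgOpen e).trans ⟨?_, fun hp => ⟨hV hp, ?_⟩⟩
  · rintro ⟨hp, h⟩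
    exact (congrArg (fun q : U => q.1 ∈ V) (base_hom_inv e ⟨p, hp⟩)).mp h
  · exact (congrArg (fun q : U => q.1 ∈ V) (base_hom_inv e ⟨p, hV hp⟩)).mpr hp

theorem le_of_imgOpen_le {W W' : Opens Y} (h : imgOpen e W ≤ imgOpen e W') : W ≤ W' := by
  intro y hy
  have h1 : (e.inv.hom.base y).1 ∈ imgOpen e W := (mem_imgOpen e).mpr
    ⟨(e.inv.hom.base y).2, by change e.hom.hom.base (e.inv.hom.base y) ∈ W; rwa [base_inv_hom]⟩
  obtain ⟨_, h2⟩ := (mem_imgOpen e).mp (h h1)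
  change e.hom.hom.base (e.inv.hom.base y) ∈ W' at h2
  rwa [base_inv_hom] at h2

theorem IsLeastNhd.of_imgOpen {W : Opens Y} (h : IsLeastNhd (imgOpen e W)) : IsLeastNhd W := by
  obtain ⟨p, hp, hW⟩ := h
  obtain ⟨hpU, hpW⟩ := (mem_imgOpen e).mp hp
  exact ⟨_, hpW, fun V hV => le_of_imgOpen_le e (hW _ ((mem_imgOpen e).mpr ⟨hpU, hV⟩))⟩

/-- Sections of a quasicoherent sheaf over minimal open subsets are extensions of scalars of each
other. -/
theorem IsQcoh.isBC {M : OMod X} (hM : IsQcoh X M) {V V' : Opens X} (h : V' ≤ V)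
    (hV : IsLeastNhd V) (hV' : IsLeastNhd V') : IsBC (rRes X h) (mRes M h) := by
  obtain ⟨ι, U, hU, H⟩ := hM
  -- A smallest neighbourhood of p lies in every member of the cover that contains p. This is why
  -- the arbitrary cover in the definition of quasicoherence causes no difficulty.
  obtain ⟨i, hi⟩ : ∃ i, V ≤ U i := by
    obtain ⟨p, hp, hV⟩ := hV
    have : p ∈ ⨆ i, U i := by rw [hU]; trivial
    obtain ⟨i, hi⟩ := Opens.mem_iSup.mp this
    exact ⟨i, hV _ hi⟩
  obtain ⟨A, e, N, ⟨φ⟩⟩ := H i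
  obtain ⟨W, rfl⟩ := exists_imgOpen e hi
  obtain ⟨W', rfl⟩ := exists_imgOpen e (h.trans hi)
  have hW := le_of_imgOpen_le e h
  have h1 := isBC_tildeMod N hW (hV'.of_imgOpen e) (hV.of_imgOpen e)
  -- The base change is moved first along the isomorphism of modules over NCSpec(A), then along the
  -- isomorphism of ringed spaces.
  have h2 : IsBC (rRes (NCSpec A) hW)
      (mRes ((pushMod e.hom).obj ((resMod X (U i)).obj M)) hW) :=
    h1.transport_symm (a := RingHom.id _) (b := RingHom.id _) Function.bijective_id
      Function.bijective_id (fun _ => rfl) (α := (mApp φ.hom W).toAddMonoidHom)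
      (β := (mApp φ.hom W').toAddMonoidHom) (mApp_bijective φ W) (mApp_bijective φ W')
      (fun x m => (mApp φ.hom W).map_smul x m) (fun x m => (mApp φ.hom W').map_smul x m)
      (fun m => mApp_mRes φ.hom hW m)
  exact h2.transport (ringImg_bijective e W) (ringImg_bijective e W')
    (fun x => rRes_ringImg e hW x) (α := (modImg M e W).toAddMonoidHom)
    (β := (modImg M e W').toAddMonoidHom) (modImg M e W).bijective (modImg M e W').bijective
    (modImg_smul M e W) (modImg_smul M e W') (fun m => modImg_mRes M e hW m)

end Open

/-! ### Quasicoherent sheaves and descent data -/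

theorem Loc.of_empty_bijective (R : Type) [Ring R] (F : Set R) (hF : F = ∅) :
    Function.Bijective (Loc.of R F) := by
  subst hF
  let ρ : Loc R (∅ : Set R) →+* R := Loc.lift (RingHom.id R) (fun a ha => ha.elim)
  have h : (Loc.of R ∅).comp ρ = RingHom.id _ := Loc.hom_ext fun r =>
    congrArg (Loc.of R ∅) (Loc.lift_of (RingHom.id R) _ r)
  exact Function.bijective_iff_has_inverse.mpr ⟨ρ, fun r => Loc.lift_of (RingHom.id R) _ r,
    fun z => RingHom.congr_fun h z⟩

section Equiv

open SkewPoly Node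

variable {n : ℕ} {lam : Fin n → Fin n → ℂ}

/-- The isomorphism defined by a bijective morphism of descent data. -/
def DMod.isoMk {M N : DMod lam} (f : M ⟶ N) (hf : ∀ A, Function.Bijective (Hom.app f A)) :
    M ≅ N where
  hom := f
  inv := ⟨fun A => (LinearEquiv.ofBijective (Hom.app f A) (hf A)).symm, fun {A B} h m => by
    refine (hf B).1 ?_
    rw [Hom.naturality]
    exact (LinearEquiv.apply_symm_apply (LinearEquiv.ofBijective (Hom.app f B) (hf B)) _).trans
      (congrArg _ (LinearEquiv.apply_symm_apply
        (LinearEquiv.ofBijective (Hom.app f A) (hf A)) m).symm)⟩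
  hom_inv_id := DMod.hom_ext fun A m =>
    LinearEquiv.symm_apply_apply (LinearEquiv.ofBijective (Hom.app f A) (hf A)) m
  inv_hom_id := DMod.hom_ext fun A m =>
    LinearEquiv.apply_symm_apply (LinearEquiv.ofBijective (Hom.app f A) (hf A)) m

/-- The node of an intersection of charts. -/
abbrev base (A : Idx lam) : Node lam := ⟨A, ⟨∅⟩⟩

theorem base_le {A : Idx lam} {j : Node lam} (h : A ≤ j.set) : base A ≤ j :=
  Node.le_iff.mpr ⟨h, fun a ha => by simp at ha⟩

theorem alg_base_bijective (A : Idx lam) : Function.Bijective (base A).alg :=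
  Loc.of_empty_bijective _ _ (by simp)

variable [hlam : Fact (∀ i j : Fin n, i < j → lam i j ≠ 0)]

theorem isLeastNhd_nbhd (j : Node lam) : IsLeastNhd j.nbhd :=
  ⟨j.point, point_mem_nbhd j, fun _ h => nbhd_le_iff.mpr h⟩

/-- The open subset covered by an intersection of charts. -/
abbrev baseNbhd (A : Idx lam) : Opens (ncProj n lam) := (base A).nbhd

theorem baseNbhd_mono {A B : Idx lam} (h : A ≤ B) : baseNbhd B ≤ baseNbhd A :=
  nbhd_mono (base_le h)

/-- The sections of the structure sheaf over the smallest neighbourhood of a node. -/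
def evEquiv (j : Node lam) : RSec (ncProj n lam) j.nbhd ≃+* j.T :=
  RingEquiv.ofBijective (ev j.nbhd j (point_mem_nbhd j)) (ev_nbhd_bijective j)

theorem evEquiv_rRes {j k : Node lam} (h : j ≤ k) (s : RSec (ncProj n lam) j.nbhd) :
    evEquiv k (rRes (ncProj n lam) (nbhd_mono h) s) = tm h (evEquiv j s) :=
  (ev_map (homOfLE (nbhd_mono h)) (point_mem_nbhd k) s).trans
    (tm_ev h (point_mem_nbhd j) _ s).symm

/-- The sections of the structure sheaf over an intersection of charts. -/
def secHom (A : Idx lam) : RA A →+* RSec (ncProj n lam) (baseNbhd A) :=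
  ((evEquiv (base A)).symm : (base A).T →+* _).comp (base A).alg

theorem secHom_bijective (A : Idx lam) : Function.Bijective (secHom A) :=
  (evEquiv (base A)).symm.bijective.comp (alg_base_bijective A)

theorem evEquiv_secHom (A : Idx lam) (a : RA A) : evEquiv (base A) (secHom A a) = (base A).alg a :=
  (evEquiv (base A)).apply_symm_apply _

theorem rRes_secHom {A B : Idx lam} (h : A ≤ B) (a : RA A) :
    rRes (ncProj n lam) (baseNbhd_mono h) (secHom A a) = secHom B (res h a) := by
  refine (evEquiv (base B)).injective ?_
  rw [evEquiv_rRes (base_le (j := base B) h), evEquiv_secHom, evEquiv_secHom, tm_alg]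

/-- The sections over an intersection of charts as a module over the corresponding ring. -/
def DSec (M : OMod (ncProj n lam)) (A : Idx lam) : Type := MSec M (baseNbhd A)

instance (M : OMod (ncProj n lam)) (A : Idx lam) : AddCommGroup (DSec M A) :=
  inferInstanceAs (AddCommGroup (MSec M (baseNbhd A)))

instance (M : OMod (ncProj n lam)) (A : Idx lam) : Module (RA A) (DSec M A) :=
  Module.compHom (MSec M (baseNbhd A)) (secHom A)

/-- The identification of the two modules of sections. -/
def dSec (M : OMod (ncProj n lam)) (A : Idx lam) : DSec M A ≃+ MSec M (baseNbhd A) :=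
  AddEquiv.refl _

theorem dSec_smul (M : OMod (ncProj n lam)) (A : Idx lam) (a : RA A) (m : DSec M A) :
    dSec M A (a • m) = secHom A a • dSec M A m := rfl

/-- Restriction of sections. -/
def dRes (M : OMod (ncProj n lam)) {A B : Idx lam} (h : A ≤ B) : DSec M A →+ DSec M B :=
  mRes M (baseNbhd_mono h)

theorem isBC_dRes {M : OMod (ncProj n lam)} (hM : IsQcoh _ M) {A B : Idx lam} (h : A ≤ B) :
    IsBC (res h) (dRes M h) :=
  (IsQcoh.isBC hM (baseNbhd_mono h) (isLeastNhd_nbhd _) (isLeastNhd_nbhd _)).transport_symm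
    (secHom_bijective A) (secHom_bijective B) (fun x => (rRes_secHom h x).symm)
    (α := (dSec M A).toAddMonoidHom) (β := (dSec M B).toAddMonoidHom) (dSec M A).bijective
    (dSec M B).bijective (dSec_smul M A) (dSec_smul M B) (fun _ => rfl)

/-- The action of morphisms of sheaves on sections. -/
def dApp {M N : OMod (ncProj n lam)} (φ : M ⟶ N) (A : Idx lam) : DSec M A →ₗ[RA A] DSec N A where
  toFun := mApp φ (baseNbhd A)
  map_add' := (mApp φ (baseNbhd A)).map_add
  map_smul' a m := (mApp φ (baseNbhd A)).map_smul (secHom A a) m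

variable (lam) in
/-- The descent datum of a quasicoherent sheaf. -/
def toDMod : Qcoh (ncProj n lam) ⥤ DMod lam where
  obj M :=
    { obj := DSec M.obj
      map := dRes M.obj
      map_refl := fun _ m => mRes_refl M.obj m
      map_map := fun _ _ m => mRes_mRes M.obj _ _ m
      isBC := isBC_dRes M.property }
  map φ := ⟨dApp φ.hom, fun h m => mApp_mRes φ.hom (baseNbhd_mono h) m⟩
  map_id _ := rfl
  map_comp _ _ := rfl

/-- The minimal open subsets which cover an open subset. -/
abbrev cov (V : Opens (ncProj n lam)) (j : {j : Node lam // j.point ∈ V}) : Opens (ncProj n lam) :=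
  j.1.nbhd

theorem cov_le (V : Opens (ncProj n lam)) (j : {j : Node lam // j.point ∈ V}) : cov V j ≤ V :=
  nbhd_le_iff.mpr j.2

theorem le_iSup_cov (V : Opens (ncProj n lam)) : V ≤ iSup (cov V) := fun p hp => by
  obtain ⟨j, hpj, hj⟩ := exists_nbhd hp
  exact Opens.mem_iSup.mpr ⟨⟨j, nbhd_le_iff.mp hj⟩, hpj⟩

variable {M N : OMod (ncProj n lam)}

theorem mRes_base_ext (hM : IsQcoh _ M) (j : Node lam) {f g : MSec M j.nbhd →+ MSec N j.nbhd}
    (hf : ∀ (r : RSec (ncProj n lam) j.nbhd) m, f (r • m) = r • f m)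
    (hg : ∀ (r : RSec (ncProj n lam) j.nbhd) m, g (r • m) = r • g m)
    (h : ∀ m : MSec M (baseNbhd j.set), f (mRes M (nbhd_mono (base_le (j := j) le_rfl)) m) =
      g (mRes M (nbhd_mono (base_le (j := j) le_rfl)) m)) (m : MSec M j.nbhd) : f m = g m :=
  (IsQcoh.isBC hM (nbhd_mono (base_le le_rfl)) (isLeastNhd_nbhd _) (isLeastNhd_nbhd _)).addHom_ext
    (φ := RingHom.id _) hf hg h m

/-- Smallest neighbourhoods of nodes cover every open set, and the sections over each are extended
from those over an intersection of charts. -/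
instance : (toDMod lam).Faithful where
  map_injective {M N} φ ψ h := by
    refine ObjectProperty.hom_ext _ (mHom_ext fun V m => ?_)
    refine mSec_ext (cov V) (cov_le V) (le_iSup_cov V) fun j => ?_
    rw [← mApp_mRes, ← mApp_mRes]
    refine mRes_base_ext M.property j.1 (f := (mApp φ.hom j.1.nbhd).toAddMonoidHom)
      (g := (mApp ψ.hom j.1.nbhd).toAddMonoidHom) (mApp φ.hom j.1.nbhd).map_smul
      (mApp ψ.hom j.1.nbhd).map_smul (fun m => ?_) _
    have h1 := congrArg (fun f => DMod.Hom.app f j.1.set m) h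
    exact (mApp_mRes φ.hom _ m).trans ((congrArg _ h1).trans (mApp_mRes ψ.hom _ m).symm)

/-- A family of maps on sections over minimal open subsets defines a morphism of sheaves. -/
theorem exists_hom (f : ∀ j : Node lam, MSec M j.nbhd →ₗ[RSec (ncProj n lam) j.nbhd] MSec N j.nbhd)
    (hf : ∀ (j k : Node lam) (h : k.nbhd ≤ j.nbhd) m,
      f k (mRes M h m) = mRes N h (f j m)) :
    ∃ φ : M ⟶ N, ∀ j, mApp φ j.nbhd = f j := by
  have hV : ∀ (V : Opens (ncProj n lam)) (m : MSec M V), ∃ t : MSec N V,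
      ∀ (j : Node lam) (hj : j.nbhd ≤ V), mRes N hj t = f j (mRes M hj m) := by
    intro V m
    obtain ⟨t, ht⟩ := mSec_glue (M := N) (cov V) (cov_le V) (le_iSup_cov V)
      (fun j => f j.1 (mRes M (cov_le V j) m)) (fun j k => by
        refine mSec_ext (cov _) (cov_le _) (le_iSup_cov _) fun l => ?_
        have h1 : l.1.nbhd ≤ j.1.nbhd := (cov_le _ l).trans inf_le_left
        have h2 : l.1.nbhd ≤ k.1.nbhd := (cov_le _ l).trans inf_le_right
        have e1 := hf j.1 l.1 h1 (mRes M (cov_le V j) m)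
        have e2 := hf k.1 l.1 h2 (mRes M (cov_le V k) m)
        rw [mRes_mRes] at e1 e2
        refine (mRes_mRes N _ _ _).trans (e1.symm.trans (e2.trans (mRes_mRes N _ _ _).symm)))
    exact ⟨t, fun j hj => ht ⟨j, nbhd_le_iff.mp hj⟩⟩
  choose t ht using hV
  have ext : ∀ (V : Opens (ncProj n lam)) (s s' : MSec N V),
      (∀ (j : Node lam) (hj : j.nbhd ≤ V), mRes N hj s = mRes N hj s') → s = s' := fun V s s' h =>
    mSec_ext (cov V) (cov_le V) (le_iSup_cov V) fun j => h j.1 (cov_le V j)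
  refine ⟨mHomMk (fun V =>
    { toFun := t V
      map_add' := fun m m' => ext V _ _ fun j hj => by
        rw [map_add, ht, ht, ht, map_add, map_add]
      map_smul' := fun r m => ext V _ _ fun j hj => by
        rw [RingHom.id_apply, mRes_smul, ht, ht, mRes_smul, map_smul] }) ?_, fun j => ?_⟩
  · intro U V h m
    refine ext U _ _ fun j hj => ?_
    refine (ht U _ j hj).trans ?_
    rw [mRes_mRes, mRes_mRes]
    exact (ht V m j _).symm
  · refine LinearMap.ext fun m => ?_
    have := ht j.nbhd m j le_rfl
    rw [mRes_refl, mRes_refl] at this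
    exact this

/-- Base change extends the given maps to the smallest neighbourhoods of all nodes; uniqueness of
such extensions makes them compatible, and they glue. -/
theorem exists_extension (hM : IsQcoh _ M)
    (g : ∀ A, DSec M A →ₗ[RA A] DSec N A)
    (hg : ∀ {A B : Idx lam} (h : A ≤ B) m, g B (dRes M h m) = dRes N h (g A m)) :
    ∃ φ : M ⟶ N, ∀ A m, dApp φ A m = g A m := by
  have hbase : ∀ j : Node lam, j.nbhd ≤ baseNbhd j.set := fun j => nbhd_mono (base_le le_rfl)
  have hex : ∀ j : Node lam, ∃ f : MSec M j.nbhd →ₗ[RSec (ncProj n lam) j.nbhd] MSec N j.nbhd,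
      ∀ m : DSec M j.set, f (mRes M (hbase j) m) = mRes N (hbase j) (g j.set m) := by
    intro j
    refine (IsQcoh.isBC hM (hbase j) (isLeastNhd_nbhd _) (isLeastNhd_nbhd _)).exists_lift
      ((mRes N (hbase j)).comp (g j.set).toAddMonoidHom) fun r m => ?_
    obtain ⟨a, rfl⟩ := (secHom_bijective j.set).2 r
    refine (congrArg (mRes N (hbase j)) ((g j.set).map_smul a m)).trans ?_
    exact mRes_smul N (hbase j) (secHom j.set a) _
  choose f hf using hex
  have hle : ∀ (j k : Node lam) (h : j ≤ k) (h' : k.nbhd ≤ j.nbhd) m,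
      f k (mRes M h' m) = mRes N h' (f j m) := by
    intro j k h h' m
    refine (IsQcoh.isBC hM (hbase j) (isLeastNhd_nbhd _) (isLeastNhd_nbhd _)).addHom_ext
      (φ := rRes (ncProj n lam) h') (h := (f k).toAddMonoidHom.comp (mRes M h'))
      (h' := (mRes N h').comp (f j).toAddMonoidHom) (fun b m => ?_) (fun b m => ?_) (fun m => ?_) m
    · exact (congrArg (f k) (mRes_smul M h' b m)).trans ((f k).map_smul _ _)
    · exact (congrArg (mRes N h') ((f j).map_smul b m)).trans (mRes_smul N h' _ _)
    · change f k (mRes M h' (mRes M (hbase j) m)) = mRes N h' (f j (mRes M (hbase j) m))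
      have e4 := mRes_mRes N (hbase j) h' (g j.set m)
      rw [hf j m, mRes_mRes]
      refine Eq.trans ?_ e4.symm
      have e1 := hf k (dRes M h.fst m)
      rw [hg h.fst m] at e1
      have e2 := mRes_mRes M (baseNbhd_mono h.fst) (hbase k) m
      have e3 := mRes_mRes N (baseNbhd_mono h.fst) (hbase k) (g j.set m)
      exact (congrArg (f k) e2.symm).trans (e1.trans e3)
  -- Inclusion of neighbourhoods only gives `Pre j k`. The join of j and k has the same
  -- neighbourhood as k and lies above both, so compatibility along ≤ suffices.
  obtain ⟨φ, hφ⟩ := exists_hom f fun j k h m => by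
    have hp : Pre j k := nbhd_le_nbhd_iff.mp h
    have e : (join j k).nbhd = k.nbhd := le_antisymm (nbhd_mono (le_join_right j k))
      (nbhd_le_nbhd_iff.mpr (Pre.trans (Weak.pre hp) (pre_of_le le_rfl)))
    have e1 := hle j (join j k) (le_join_left j k) (nbhd_mono (le_join_left j k)) m
    have e2 := hle k (join j k) (le_join_right j k) e.le (mRes M h m)
    rw [mRes_mRes] at e2
    have e3 := congrArg (mRes N e.ge) (e2.symm.trans e1)
    rwa [mRes_mRes, mRes_mRes, mRes_refl] at e3
  refine ⟨φ, fun A m => ?_⟩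
  have h1 := hf (base A) m
  have h2 : mRes M (hbase (base A)) m = m := mRes_refl M _
  have h3 : mRes N (hbase (base A)) (g A m) = g A m := mRes_refl N _
  have h4 := LinearMap.congr_fun (hφ (base A)) m
  refine h4.trans ((congrArg (f (base A)) h2).symm.trans (h1.trans h3))

instance : (toDMod lam).Full where
  map_surjective {M N} g := by
    obtain ⟨φ, hφ⟩ := exists_extension M.property g.app (fun h m => g.naturality h m)
    exact ⟨ObjectProperty.homMk φ, DMod.hom_ext hφ⟩

/-- Evaluation of families at the node of an intersection of charts. -/
def baseEval (D : DMod lam) (A : Idx lam) : DSec D.sheaf A ≃+ D.at_ (base A) :=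
  AddEquiv.ofBijective
    ({ toFun := fun s => s.1 ⟨base A, point_mem_nbhd _⟩
       map_zero' := rfl
       map_add' := fun _ _ => rfl } : D.nodeSys.fam (baseNbhd A) →+ D.at_ (base A))
    (D.nodeSys.fam_nbhd_bijective (base A))

theorem baseEval_smul (D : DMod lam) (A : Idx lam) (a : RA A) (s : DSec D.sheaf A) :
    baseEval D A (a • s) = (base A).alg a • baseEval D A s :=
  congrArg (fun z : (base A).T => z • baseEval D A s) (evEquiv_secHom A a)

theorem baseEval_dRes (D : DMod lam) {A B : Idx lam} (h : A ≤ B) (s : DSec D.sheaf A) :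
    baseEval D B (dRes D.sheaf h s) = D.atMap (base_le (j := base B) h) (baseEval D A s) :=
  ((show D.nodeSys.fam (baseNbhd A) from s).2 ⟨base A, point_mem_nbhd _⟩
    ⟨base B, baseNbhd_mono h (point_mem_nbhd _)⟩ (base_le (j := base B) h)).symm

/-- The canonical map from a descent datum to the sections of its sheaf. -/
def toSec (D : DMod lam) (A : Idx lam) : D.obj A →ₗ[RA A] DSec D.sheaf A where
  toFun m := (baseEval D A).symm (D.toAt (base A) m)
  map_add' m m' := by rw [map_add, map_add]
  map_smul' a m := (baseEval D A).injective (by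
    rw [AddEquiv.apply_symm_apply, RingHom.id_apply, baseEval_smul, AddEquiv.apply_symm_apply]
    exact (D.isBC_toAt (base A)).map_smul a m)

theorem toSec_bijective (D : DMod lam) (A : Idx lam) : Function.Bijective (toSec D A) :=
  (baseEval D A).symm.bijective.comp ((D.isBC_toAt (base A)).bijective (alg_base_bijective A))

/-- Over an intersection of charts the families of D reduce to their value at the node with empty
finite subset, where nothing is localized, so D is recovered. -/
instance : (toDMod lam).EssSurj where
  mem_essImage D := by
    refine ⟨⟨D.sheaf, D.isQcoh_sheaf⟩, ⟨(DMod.isoMk (M := D)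
      (N := (toDMod lam).obj ⟨D.sheaf, D.isQcoh_sheaf⟩) ⟨toSec D, fun {A B} h m => ?_⟩
      (toSec_bijective D)).symm⟩⟩
    refine (baseEval D B).injective ?_
    refine ((baseEval D B).apply_symm_apply _).trans
      (Eq.trans ?_ (baseEval_dRes D h (toSec D A m)).symm)
    refine Eq.trans ?_ (congrArg _ ((baseEval D A).apply_symm_apply _).symm)
    exact (D.atMap_toAt (j := base A) (k := base B) _ m).symm

instance : (toDMod lam).IsEquivalence where

end Equiv

/-! ### Twists -/

section Twists

open SkewPoly

variable {n : ℕ} {lam : Fin n → Fin n → ℂ}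

/-- Multiplication by `r` raises degrees from `d` to `d'`. -/
def HDeg (d d' : ℤ) (r : SkewPoly n lam) : Prop := ∃ e : ℕ, r ∈ deg n lam e ∧ d' = d + e

namespace HDeg

variable {d d' d'' : ℤ} {r s : SkewPoly n lam}

theorem of_mem (d : ℤ) {e : ℕ} (hr : r ∈ deg n lam e) : HDeg d (d + e) r := ⟨e, hr, rfl⟩

theorem const (d : ℤ) (c : ℂ) : HDeg d d (algebraMap ℂ (SkewPoly n lam) c) :=
  ⟨0, const_mem_deg c, by simp⟩

theorem one (d : ℤ) : HDeg d d (1 : SkewPoly n lam) := ⟨0, one_mem_deg lam, by simp⟩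

theorem x (d : ℤ) (i : Fin n) : HDeg d (d + 1) (x lam i) := ⟨1, x_mem_deg i, by simp⟩

theorem xpow (d : ℤ) (i : Fin n) (k : ℕ) : HDeg d (d + k) (SkewPoly.x lam i ^ k) :=
  ⟨k, (Mon.xpow (A := Set.univ) trivial k).mem_deg, rfl⟩

theorem mul (hs : HDeg d' d'' s) (hr : HDeg d d' r) : HDeg d d'' (s * r) := by
  obtain ⟨e, hr, rfl⟩ := hr
  obtain ⟨e', hs, rfl⟩ := hs
  exact ⟨e' + e, mul_mem_deg hs hr, by push_cast; ring⟩

theorem add (hr : HDeg d d' r) (hs : HDeg d d' s) : HDeg d d' (r + s) := by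
  obtain ⟨e, hr, rfl⟩ := hr
  obtain ⟨e', hs, h⟩ := hs
  obtain rfl : e = e' := by omega
  exact ⟨e, add_mem hr hs, rfl⟩

theorem smul (c : ℂ) (hr : HDeg d d' r) : HDeg d d' (c • r) := by
  obtain ⟨e, hr, rfl⟩ := hr
  exact ⟨e, Submodule.smul_mem _ _ hr, rfl⟩

theorem locDeg {A : Set (SkewPoly n lam)} (hr : HDeg d d' r) :
    LocDeg lam A (d' - d) (Loc.of _ A r) := by
  obtain ⟨e, hr, rfl⟩ := hr
  rw [add_sub_cancel_left]
  exact LocDeg.of hr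

end HDeg

variable {A B : Idx lam} {i j k : Fin n} {d d' d'' : ℤ} {r s : SkewPoly n lam}

/-- Multiplication by `r`, from the twist of degree `d` to the twist of degree `d'`, in the
trivializations of the twists by powers of `x_i` and `x_j`. -/
def tw (hi : x lam i ∈ A.1) (hj : x lam j ∈ A.1) (hr : HDeg d d' r) : RA A :=
  ⟨↑(xu hj ^ (-d')) * ofA A r * ↑(xu hi ^ d), by
    have h := ((locDeg_zpow hj (-d')).mul (hr.locDeg (A := A.1))).mul (locDeg_zpow hi d)
    have e : -d' + (d' - d) + d = 0 := by ring
    rw [e] at h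
    exact h⟩

variable (hi : x lam i ∈ A.1) (hj : x lam j ∈ A.1) (hk : x lam k ∈ A.1)

/-- The intermediate powers of x_j cancel. For r = s = 1 this is the cocycle condition for the
transition functions of a twist. -/
theorem tw_mul_tw (hs : HDeg d' d'' s) (hr : HDeg d d' r) :
    tw hj hk hs * tw hi hj hr = tw hi hk (hs.mul hr) := by
  refine Subtype.ext ?_
  simp only [tw, Subring.coe_mul, map_mul, mul_assoc]
  rw [← mul_assoc _ (↑(xu hj ^ (-d')) : SA A), ← Units.val_mul, ← zpow_add, add_neg_cancel,
    zpow_zero, Units.val_one, one_mul]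

theorem tw_one (d : ℤ) : tw hi hi (HDeg.one d) = 1 := by
  refine Subtype.ext ?_
  simp only [tw, map_one, mul_one]
  rw [← Units.val_mul, ← zpow_add, neg_add_cancel, zpow_zero]
  rfl

theorem tw_add (hr : HDeg d d' r) (hs : HDeg d d' s) :
    tw hi hj (hr.add hs) = tw hi hj hr + tw hi hj hs := by
  refine Subtype.ext ?_
  simp only [tw, Subring.coe_add, map_add, mul_add, add_mul]

/-- The powers of x_i are the trivializing sections on the i-th chart, so multiplication by them is
invisible there. -/
theorem tw_xpow (d : ℤ) (k : ℕ) : tw hi hi (HDeg.xpow d i k) = 1 := by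
  refine Subtype.ext ?_
  have : ofA A (x lam i ^ k) = ↑(xu hi ^ (k : ℤ)) := by
    rw [map_pow, zpow_natCast, Units.val_pow_eq_pow_val]; rfl
  simp only [tw]
  rw [this, ← Units.val_mul, ← Units.val_mul, ← zpow_add, ← zpow_add]
  have e : -(d + (k : ℤ)) + k + d = 0 := by ring
  rw [e, zpow_zero]
  rfl

theorem res_tw (h : A ≤ B) (hr : HDeg d d' r) :
    res h (tw hi hj hr) = tw (A := B) (h hi) (h hj) hr := by
  refine Subtype.ext ?_
  rw [coe_res]
  simp only [tw, map_mul, resS_of]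
  rw [resS_zpow, resS_zpow]

theorem tw_congr (h : r = s) (hr : HDeg d d' r) (hs : HDeg d d' s) :
    tw hi hj hr = tw hi hj hs := by subst h; rfl

theorem const_mul_xzpow (c : ℂ) (k : ℤ) : ofA A (algebraMap ℂ _ c) * (↑(xu hi ^ k) : SA A) =
    ↑(xu hi ^ k) * ofA A (algebraMap ℂ _ c) := by
  have hc : Commute (ofA A (algebraMap ℂ _ c)) (xu hi : SA A) := by
    rw [val_xu, Commute, SemiconjBy, ← map_mul, Algebra.commutes, map_mul]
  exact hc.units_zpow_right k

/-- Multiplication by a monomial in the elements of `A` is invertible. -/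
theorem isUnit_tw {e : ℕ} {y : SkewPoly n lam} (hy : Mon A.1 e y) (h : HDeg d d' y)
    (hd : d' = d + e) : IsUnit (tw hi hj h) := by
  obtain ⟨w, hw, h1, h2⟩ := hy.exists_inv
  refine isUnit_degZero (w := ↑(xu hi ^ (-d)) * w * ↑(xu hj ^ d')) ?_ ?_ ?_
  · have h := ((locDeg_zpow hi (-d)).mul hw).mul (locDeg_zpow hj d')
    have e : -d + -(e : ℤ) + d' = 0 := by rw [hd]; ring
    rw [e] at h
    exact h
  · simp only [tw, mul_assoc]
    rw [← mul_assoc _ (↑(xu hi ^ (-d)) : SA A), ← Units.val_mul, ← zpow_add, add_neg_cancel,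
      zpow_zero, Units.val_one, one_mul, ← mul_assoc _ w, h1, one_mul, ← Units.val_mul,
      ← zpow_add, neg_add_cancel, zpow_zero, Units.val_one]
  · simp only [tw, mul_assoc]
    rw [← mul_assoc _ (↑(xu hj ^ (-d')) : SA A), ← Units.val_mul, ← zpow_add, add_neg_cancel,
      zpow_zero, Units.val_one, one_mul, ← mul_assoc w, h2, one_mul, ← Units.val_mul,
      ← zpow_add, neg_add_cancel, zpow_zero, Units.val_one]

theorem xzpow_comm (hlam : ∀ i j : Fin n, i < j → lam i j ≠ 0) {e : ℕ} {y : SkewPoly n lam}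
    (hy : Mon Set.univ e y) (d : ℤ) :
    ∃ c : ℂ, c ≠ 0 ∧ ofA A y * ↑(xu hj ^ d) =
      ofA A (algebraMap ℂ _ c) * (↑(xu hj ^ d) * ofA A y) := by
  obtain ⟨c, hc, h⟩ := hy.mul_comm' hlam (Mon.x (A := A.1) hj)
  have hcen := const_mul_xzpow (lam := lam) hj
  have h1 : ofA A y * (xu hj : SA A) = ofA A (algebraMap ℂ _ c) * ((xu hj : SA A) * ofA A y) := by
    rw [val_xu, ← map_mul, h, of_smul, map_mul]
  have h2 : ofA A y * (↑(xu hj)⁻¹ : SA A) =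
      ofA A (algebraMap ℂ _ c⁻¹) * (↑(xu hj)⁻¹ * ofA A y) := by
    refine (Units.mul_left_inj (xu hj)).mp ?_
    rw [mul_assoc, Units.inv_mul, mul_one, mul_assoc, mul_assoc, h1]
    have := hcen c (-1)
    rw [zpow_neg_one] at this
    rw [← mul_assoc (↑(xu hj)⁻¹ : SA A), ← this, mul_assoc (ofA A (algebraMap ℂ _ c)),
      Units.inv_mul_cancel_left, ← mul_assoc, ← map_mul, ← map_mul, ← map_mul (algebraMap ℂ (SkewPoly n lam)),
      inv_mul_cancel₀ hc, map_one, one_mul]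
  refine ⟨c ^ d, zpow_ne_zero _ hc, ?_⟩
  induction d using Int.induction_on with
  | zero => simp
  | succ k ih =>
    rw [zpow_add_one, Units.val_mul, ← mul_assoc, ih, mul_assoc, mul_assoc, h1, zpow_add_one₀ hc,
      map_mul, map_mul, ← mul_assoc (↑(xu hj ^ (k : ℤ)) : SA A), ← hcen]
    simp only [mul_assoc]
  | pred k ih =>
    rw [zpow_sub_one, Units.val_mul, ← mul_assoc, ih, mul_assoc, mul_assoc, h2, zpow_sub_one₀ hc,
      map_mul, map_mul, ← mul_assoc (↑(xu hj ^ (-(k : ℤ))) : SA A), ← hcen]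
    simp only [mul_assoc]

/-- The dependence of a twist by a monomial on the degree. -/
theorem exists_tw_eq (hlam : ∀ i j : Fin n, i < j → lam i j ≠ 0) {e : ℕ} {y : SkewPoly n lam}
    (hy : Mon Set.univ e y) (a b : ℤ) :
    ∃ c : ℂ, c ≠ 0 ∧ tw hi hi (HDeg.of_mem b hy.mem_deg) =
      constA A c * tw hi hi (HDeg.of_mem a hy.mem_deg) := by
  obtain ⟨c, hc, h⟩ := xzpow_comm hi hlam hy (b - a)
  have hcen := const_mul_xzpow (lam := lam) hi
  refine ⟨c, hc, Subtype.ext ?_⟩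
  simp only [tw, Subring.coe_mul, constA]
  have e1 : (↑(xu hi ^ b) : SA A) = ↑(xu hi ^ (b - a)) * ↑(xu hi ^ a) := by
    rw [← Units.val_mul, ← zpow_add, sub_add_cancel]
  have e2 : (↑(xu hi ^ (-(a + e))) : SA A) = ↑(xu hi ^ (-(b + e))) * ↑(xu hi ^ (b - a)) := by
    rw [← Units.val_mul, ← zpow_add]
    congr 2; ring
  rw [e1, e2, mul_assoc, ← mul_assoc (ofA A y), h]
  simp only [mul_assoc]
  rw [← mul_assoc (ofA A (algebraMap ℂ _ c)) (↑(xu hi ^ (-(b + e))) : SA A), hcen, mul_assoc]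

end Twists

/-! ### Reduction of morphisms of descent data to the charts -/

namespace DMod

open SkewPoly

variable {n : ℕ} {lam : Fin n → Fin n → ℂ} {M N : DMod lam}

theorem hom_ext_sgl {f g : M ⟶ N}
    (h : ∀ i m, Hom.app f (sgl lam i) m = Hom.app g (sgl lam i) m) : f = g := by
  refine hom_ext fun A m => ?_
  obtain ⟨i, hi⟩ := A.2.1
  refine LinearMap.congr_fun ((M.isBC (sgl_le hi)).hom_ext (Hom.app f A) (Hom.app g A)
    fun m => ?_) m
  rw [Hom.naturality, Hom.naturality, h]

/-- The component at A is a base change along the identity of R_A, by cancelling the restriction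
from a chart. -/
theorem bijective_of_sgl {f : M ⟶ N} (h : ∀ i, Function.Bijective (Hom.app f (sgl lam i)))
    (A : Idx lam) : Function.Bijective (Hom.app f A) := by
  obtain ⟨i, hi⟩ := A.2.1
  have h1 : IsBC (RingHom.id (RA (sgl lam i))) (Hom.app f (sgl lam i)).toAddMonoidHom :=
    IsBC.of_bijective Function.bijective_id (h i) (fun a m => (Hom.app f _).map_smul a m)
  have h2 := h1.comp (N.isBC (sgl_le hi))
  have h3 : (N.map (sgl_le hi)).comp (Hom.app f (sgl lam i)).toAddMonoidHom =
      (Hom.app f A).toAddMonoidHom.comp (M.map (sgl_le hi)) :=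
    AddMonoidHom.ext fun m => (Hom.naturality f (sgl_le hi) m).symm
  rw [RingHom.comp_id, h3] at h2
  have h4 : IsBC (RingHom.id (RA A)) (Hom.app f A).toAddMonoidHom :=
    (M.isBC (sgl_le hi)).cancel (by rw [RingHom.id_comp]; exact h2)
      (fun b m => (Hom.app f A).map_smul b m)
  exact h4.bijective Function.bijective_id

theorem isIso_of_sgl {f : M ⟶ N} (h : ∀ i, Function.Bijective (Hom.app f (sgl lam i))) :
    IsIso f :=
  (isoMk f (bijective_of_sgl h)).isIso_hom

theorem bijective_of_isIso (f : M ⟶ N) [IsIso f] (A : Idx lam) :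
    Function.Bijective (Hom.app f A) := by
  refine Function.bijective_iff_has_inverse.mpr ⟨Hom.app (inv f) A, fun m => ?_, fun m => ?_⟩
  · rw [← comp_app, IsIso.hom_inv_id, id_app]
  · rw [← comp_app, IsIso.inv_hom_id, id_app]

/-- Extension of a compatible family of linear maps on the charts to a morphism. -/
theorem exists_hom_of_sgl (g : ∀ i, M.obj (sgl lam i) →ₗ[RA (sgl lam i)] N.obj (sgl lam i))
    (hg : ∀ i j (h : M.obj (pr lam i j) →ₗ[RA (pr lam i j)] N.obj (pr lam i j)),
      (∀ m, h (M.map (sgl_le_left i j) m) = N.map (sgl_le_left i j) (g i m)) →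
      ∀ m, h (M.map (sgl_le_right i j) m) = N.map (sgl_le_right i j) (g j m)) :
    ∃ f : M ⟶ N, ∀ i m, Hom.app f (sgl lam i) m = g i m := by
  have hex : ∀ {i : Fin n} {A : Idx lam} (hA : sgl lam i ≤ A),
      ∃ h : M.obj A →ₗ[RA A] N.obj A, ∀ m, h (M.map hA m) = N.map hA (g i m) := by
    intro i A hA
    exact (M.isBC hA).exists_lift ((N.map hA).comp (g i).toAddMonoidHom) fun a m => by
      simp only [AddMonoidHom.comp_apply, LinearMap.toAddMonoidHom_coe, map_smul]
      exact (N.isBC hA).map_smul a _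
  -- Agreement on the pairwise overlap propagates to every A containing x_i and x_j, so an extension
  -- from one chart of A is an extension from all of them.
  have key : ∀ (A : Idx lam) {i j : Fin n} (hi : x lam i ∈ A.1) (hj : x lam j ∈ A.1)
      (h : M.obj A →ₗ[RA A] N.obj A),
      (∀ m, h (M.map (sgl_le hi) m) = N.map (sgl_le hi) (g i m)) →
      ∀ m, h (M.map (sgl_le hj) m) = N.map (sgl_le hj) (g j m) := by
    intro A i j hi hj h hh m
    obtain ⟨h', hh'⟩ := hex (sgl_le_left i j)
    have hp := pr_le hi hj
    have h1 : ∀ m, h (M.map hp m) = N.map hp (h' m) := by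
      refine (M.isBC (sgl_le_left i j)).addHom_ext (φ := res hp)
        (h := h.toAddMonoidHom.comp (M.map hp)) (h' := (N.map hp).comp h'.toAddMonoidHom)
        (fun b m => ?_) (fun b m => ?_) (fun m => ?_)
      · simp [(M.isBC hp).map_smul]
      · simp [(N.isBC hp).map_smul]
      · simp only [AddMonoidHom.comp_apply, LinearMap.toAddMonoidHom_coe]
        rw [M.map_map, hh, hh', N.map_map]
    have h2 := h1 (M.map (sgl_le_right i j) m)
    rwa [M.map_map, hg i j h' hh', N.map_map] at h2
  choose G hG using fun A : Idx lam => hex (sgl_le A.2.1.choose_spec)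
  refine ⟨⟨G, fun {A B} h m => ?_⟩, fun i m => ?_⟩
  · have hA := A.2.1.choose_spec
    have h1 := key B B.2.1.choose_spec (h hA) (G B) (hG B)
    refine (M.isBC (sgl_le hA)).addHom_ext (φ := res h) (h := (G B).toAddMonoidHom.comp (M.map h))
        (h' := (N.map h).comp (G A).toAddMonoidHom)
        (fun b m => ?_) (fun b m => ?_) (fun m => ?_) m
    · simp [(M.isBC h).map_smul]
    · simp [(N.isBC h).map_smul]
    · simp only [AddMonoidHom.comp_apply, LinearMap.toAddMonoidHom_coe]
      rw [M.map_map, hG, N.map_map]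
      exact h1 m
  · have h1 := key (sgl lam i) (sgl lam i).2.1.choose_spec (j := i) rfl (G _) (hG _) m
    refine Eq.trans (congrArg (G _) (M.map_refl _ m).symm) (h1.trans (N.map_refl _ _))

end DMod

/-! ### Graded modules -/

section Graded

open SkewPoly

variable {n : ℕ} {lam : Fin n → Fin n → ℂ}

namespace GrMod

variable (M N : GrMod n lam)

instance : DirectSum.Decomposition M.deg := M.isInternal.chooseDecomposition

/-- The homogeneous component of degree `d`. -/
def proj (d : ℤ) : M.carrier →+ M.deg d :=
  { toFun := fun m => DirectSum.decompose M.deg m d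
    map_zero' := by simp
    map_add' := fun a b => by simp }

variable {M N}

theorem proj_of_mem {d : ℤ} {m : M.carrier} (hm : m ∈ M.deg d) : (M.proj d m : M.carrier) = m :=
  DirectSum.decompose_of_mem_same _ hm

theorem proj_of_mem_ne {d e : ℤ} {m : M.carrier} (hm : m ∈ M.deg d) (h : d ≠ e) :
    M.proj e m = 0 :=
  Subtype.ext (DirectSum.decompose_of_mem_ne _ hm h)

theorem eq_sum_proj (m : M.carrier) :
    ∃ s : Finset ℤ, m = ∑ d ∈ s, (M.proj d m : M.carrier) := by
  classical
  exact ⟨_, (DirectSum.sum_support_decompose M.deg m).symm⟩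

theorem homogeneous_induction {p : M.carrier → Prop} (hdeg : ∀ d, ∀ m ∈ M.deg d, p m)
    (hadd : ∀ a b, p a → p b → p (a + b)) (m : M.carrier) : p m :=
  DirectSum.Decomposition.inductionOn M.deg (hdeg 0 0 (zero_mem _)) (fun m => hdeg _ m m.2)
    hadd m

theorem smul_mem' {d d' : ℤ} {r : SkewPoly n lam} (h : HDeg d d' r) {m : M.carrier}
    (hm : m ∈ M.deg d) : r • m ∈ M.deg d' := by
  obtain ⟨e, hr, rfl⟩ := h
  rw [add_comm]
  exact M.smul_mem e d r m hr hm

theorem hom_ext {f g : M ⟶ N} (h : ∀ d, ∀ m ∈ M.deg d, Hom.lin f m = Hom.lin g m) : f = g :=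
  Hom.ext (LinearMap.ext fun m => homogeneous_induction h
    (fun a b ha hb => by rw [map_add, map_add, ha, hb]) m)

theorem lin_proj (f : M ⟶ N) (d : ℤ) (m : M.carrier) :
    Hom.lin f (M.proj d m) = N.proj d (Hom.lin f m) := by
  induction m using homogeneous_induction with
  | hdeg e m hm =>
    by_cases h : e = d
    · subst h
      rw [proj_of_mem hm, proj_of_mem (Hom.map_deg f _ _ hm)]
    · rw [proj_of_mem_ne hm h, proj_of_mem_ne (Hom.map_deg f _ _ hm) h]
      simp
  | hadd a b ha hb => simp only [map_add, AddSubgroup.coe_add, ha, hb]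

end GrMod

/-- A `ℤ`-indexed family of groups with an action of homogeneous elements. -/
structure GrFam (lam : Fin n → Fin n → ℂ) where
  /-- the components -/
  obj : ℤ → Type
  [grp : ∀ d, AddCommGroup (obj d)]
  /-- the action of homogeneous elements -/
  op : ∀ {d d' : ℤ} {r : SkewPoly n lam}, HDeg d d' r → obj d →+ obj d'
  op_one : ∀ d m, op (HDeg.one d) m = m
  op_mul : ∀ {d d' d'' : ℤ} {r s : SkewPoly n lam} (hs : HDeg d' d'' s) (hr : HDeg d d' r) m,
    op (hs.mul hr) m = op hs (op hr m)
  op_add : ∀ {d d' : ℤ} {r s : SkewPoly n lam} (hr : HDeg d d' r) (hs : HDeg d d' s) m,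
    op (hr.add hs) m = op hr m + op hs m

attribute [instance] GrFam.grp

namespace GrFam

variable (F : GrFam lam)

theorem op_congr {d d' : ℤ} {r s : SkewPoly n lam} (h : r = s) (hr : HDeg d d' r)
    (hs : HDeg d d' s) (m : F.obj d) : F.op hr m = F.op hs m := by
  subst h; rfl

theorem op_zero {d d' : ℤ} (h : HDeg (lam := lam) d d' 0) (m : F.obj d) : F.op h m = 0 := by
  have := F.op_add h h m
  rw [F.op_congr (add_zero 0) (h.add h) h] at this
  exact left_eq_add.mp this

/-- The scalars act through the constants of R. This lets the universal property of R be applied to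
ℂ-linear endomorphisms of the direct sum. -/
instance (d : ℤ) : Module ℂ (F.obj d) where
  smul c m := F.op (HDeg.const d c) m
  one_smul m := (F.op_congr (map_one _) _ (HDeg.one d) m).trans (F.op_one d m)
  mul_smul a b m := (F.op_congr (map_mul _ _ _) _ ((HDeg.const d a).mul (HDeg.const d b)) m).trans
    (F.op_mul _ _ m)
  smul_zero c := map_zero _
  smul_add c := map_add _
  add_smul a b m := (F.op_congr (map_add _ _ _) _ ((HDeg.const d a).add (HDeg.const d b)) m).trans
    (F.op_add _ _ m)
  zero_smul m := (F.op_congr (map_zero _) _ ⟨0, zero_mem _, by simp⟩ m).trans (F.op_zero _ m)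

theorem smul_def (d : ℤ) (c : ℂ) (m : F.obj d) : c • m = F.op (HDeg.const d c) m := rfl

theorem op_smul {d d' : ℤ} {r : SkewPoly n lam} (h : HDeg d d' r) (c : ℂ) (m : F.obj d) :
    F.op h (c • m) = c • F.op h m := by
  rw [smul_def, smul_def, ← F.op_mul, ← F.op_mul]
  exact F.op_congr (Algebra.commutes c r).symm _ _ m

theorem smul_op {d d' : ℤ} {r : SkewPoly n lam} (h : HDeg d d' r) (c : ℂ) (m : F.obj d) :
    F.op (h.smul c) m = c • F.op h m := by
  rw [smul_def, ← F.op_mul]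
  exact F.op_congr (Algebra.smul_def c r) _ _ m

/-- The action of a homogeneous element as a linear map. -/
def opLin {d d' : ℤ} {r : SkewPoly n lam} (h : HDeg d d' r) : F.obj d →ₗ[ℂ] F.obj d' where
  toFun := F.op h
  map_add' := map_add _
  map_smul' c m := F.op_smul h c m

/-- The direct sum of the components. -/
abbrev tot : Type := DirectSum ℤ F.obj

/-- Multiplication by a generator. -/
def mulX (i : Fin n) : Module.End ℂ F.tot :=
  DirectSum.toModule ℂ ℤ F.tot fun d => (DirectSum.lof ℂ ℤ F.obj (d + 1)).comp
    (F.opLin (HDeg.x d i))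

theorem mulX_of (i : Fin n) (d : ℤ) (m : F.obj d) :
    F.mulX i (DirectSum.of F.obj d m) = DirectSum.of F.obj (d + 1) (F.op (HDeg.x d i) m) :=
  DirectSum.toModule_lof ℂ (φ := fun d => (DirectSum.lof ℂ ℤ F.obj (d + 1)).comp
    (F.opLin (HDeg.x d i))) d m

theorem mulX_mulX {i j : Fin n} (h : i < j) :
    F.mulX i * F.mulX j = lam i j • (F.mulX j * F.mulX i) := by
  refine LinearMap.ext fun t => ?_
  induction t using DirectSum.induction_on with
  | zero => simp only [map_zero]
  | of d m =>
    rw [LinearMap.smul_apply, Module.End.mul_apply, Module.End.mul_apply, mulX_of, mulX_of,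
      mulX_of, mulX_of, ← F.op_mul, ← F.op_mul]
    refine Eq.trans ?_ ((DirectSum.lof ℂ ℤ F.obj (d + 1 + 1)).map_smul (lam i j) _)
    rw [← F.smul_op]
    exact congrArg _ (F.op_congr (x_mul_x h) _ _ m)
  | add a b ha hb => simp only [map_add, ha, hb]

/-- The algebra homomorphism which defines the module structure on the direct sum. -/
def act : SkewPoly n lam →ₐ[ℂ] Module.End ℂ F.tot :=
  lift F.mulX fun _ _ h => F.mulX_mulX h

instance : Module (SkewPoly n lam) F.tot := Module.compHom _ F.act.toRingHom

theorem smul_tot (r : SkewPoly n lam) (t : F.tot) : r • t = F.act r t := rfl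

theorem smul_of {d d' : ℤ} {r : SkewPoly n lam} (h : HDeg d d' r) (m : F.obj d) :
    r • (DirectSum.of F.obj d m : F.tot) = DirectSum.of F.obj d' (F.op h m) := by
  obtain ⟨e, hr, h'⟩ := id h
  -- Induction on degree requires the exponent hidden in `HDeg` to be explicit; membership is
  -- carried along so that witnesses for the factors can be rebuilt.
  suffices H : r ∈ deg n lam e ∧ ∀ {d d' : ℤ} (h : HDeg d d' r) (m : F.obj d), d' = d + e →
      r • (DirectSum.of F.obj d m : F.tot) = DirectSum.of F.obj d' (F.op h m) from
    H.2 h m h'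
  refine deg_induction (p := fun e r => r ∈ deg n lam e ∧
    ∀ {d d' : ℤ} (h : HDeg d d' r) (m : F.obj d), d' = d + e →
      r • (DirectSum.of F.obj d m : F.tot) = DirectSum.of F.obj d' (F.op h m)) ?_ ?_ ?_ ?_ ?_ hr
  · refine fun c => ⟨const_mem_deg c, ?_⟩
    rintro d d' h m e
    obtain rfl : d' = d := by simpa using e
    rw [smul_tot, AlgHom.commutes]
    exact ((DirectSum.lof ℂ ℤ F.obj d').map_smul c m).symm
  · rintro e a b ⟨ha, ha'⟩ ⟨hb, hb'⟩
    refine ⟨add_mem ha hb, ?_⟩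
    rintro d d' h m rfl
    rw [add_smul, ha' (HDeg.of_mem d ha) m rfl, hb' (HDeg.of_mem d hb) m rfl, ← map_add, ← F.op_add]
  · rintro e i a ⟨ha, ha'⟩
    refine ⟨by rw [add_comm]; exact mul_mem_deg (x_mem_deg i) ha, ?_⟩
    rintro d d' h m h'
    obtain rfl : d' = d + e + 1 := by push_cast at h'; omega
    rw [mul_smul, ha' (HDeg.of_mem d ha) m rfl, smul_tot, act, lift_x, mulX_of, ← F.op_mul]
  · refine fun e => ⟨zero_mem _, ?_⟩
    rintro d d' h m h'
    rw [zero_smul, op_zero, map_zero]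
  · rintro e c a ⟨ha, ha'⟩
    refine ⟨Submodule.smul_mem _ _ ha, ?_⟩
    rintro d d' h m rfl
    have h1 : HDeg d (d + e) a := ⟨e, ha, rfl⟩
    rw [smul_tot, map_smul, LinearMap.smul_apply, ← smul_tot, ha' h1 m rfl]
    exact ((DirectSum.lof ℂ ℤ F.obj _).map_smul c _).symm.trans
      (congrArg _ (F.smul_op h1 c m).symm)

/-- The homogeneous components of the direct sum. -/
def totDeg (d : ℤ) : AddSubgroup F.tot := (DirectSum.of F.obj d).range

theorem of_mem_totDeg (d : ℤ) (m : F.obj d) : DirectSum.of F.obj d m ∈ F.totDeg d := ⟨m, rfl⟩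

/-- The inclusion of a component into the corresponding homogeneous component. -/
def toTotDeg (d : ℤ) : F.obj d →+ F.totDeg d :=
  (DirectSum.of F.obj d).codRestrict (F.totDeg d) (F.of_mem_totDeg d)

theorem coe_toTotDeg (d : ℤ) (m : F.obj d) : (F.toTotDeg d m : F.tot) = DirectSum.of F.obj d m :=
  rfl

instance : DirectSum.Decomposition F.totDeg :=
  DirectSum.Decomposition.ofAddHom F.totDeg
    (DirectSum.toAddMonoid fun d =>
      (DirectSum.of (fun d => F.totDeg d) d).comp (F.toTotDeg d))
    (by
      refine DirectSum.addHom_ext fun d m => ?_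
      rw [AddMonoidHom.comp_apply, DirectSum.toAddMonoid_of, AddMonoidHom.comp_apply,
        DirectSum.coeAddMonoidHom_of, coe_toTotDeg, AddMonoidHom.id_apply])
    (by
      refine DirectSum.addHom_ext fun d m => ?_
      obtain ⟨_, m, rfl⟩ := m
      simp only [AddMonoidHom.comp_apply, DirectSum.coeAddMonoidHom_of,
        DirectSum.toAddMonoid_of, AddMonoidHom.id_apply]
      rfl)

/-- The graded module of a graded family. -/
def grMod : GrMod n lam where
  carrier := F.tot
  deg := F.totDeg
  isInternal := DirectSum.Decomposition.isInternal _
  smul_mem := by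
    rintro e d r _ hr ⟨m, rfl⟩
    rw [F.smul_of (HDeg.of_mem d hr), add_comm]
    exact F.of_mem_totDeg _ _

variable {F} {M : GrMod n lam}

theorem of_apply_of_mem {d : ℤ} {t : F.tot} (ht : t ∈ F.totDeg d) :
    DirectSum.of F.obj d (t d) = t := by
  obtain ⟨m, rfl⟩ := ht
  rw [DirectSum.of_eq_same]

/-- The components of a morphism of graded modules to the graded module of a graded family. -/
def comp (f : M ⟶ F.grMod) (d : ℤ) : M.deg d →+ F.obj d where
  toFun m := (show F.tot from GrMod.Hom.lin f m) d
  map_zero' := by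
    rw [AddSubgroup.coe_zero, map_zero]; rfl
  map_add' a b := by
    rw [AddSubgroup.coe_add, map_add]; rfl

theorem of_comp (f : M ⟶ F.grMod) {d : ℤ} (m : M.deg d) :
    DirectSum.of F.obj d (comp f d m) = (GrMod.Hom.lin f m : F.tot) :=
  of_apply_of_mem (GrMod.Hom.map_deg f d m m.2)

theorem comp_smul (f : M ⟶ F.grMod) {d d' : ℤ} {r : SkewPoly n lam} (h : HDeg d d' r)
    (m : M.deg d) : comp f d' ⟨r • m, GrMod.smul_mem' h m.2⟩ = F.op h (comp f d m) := by
  refine DirectSum.of_injective d' ?_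
  rw [of_comp, ← F.smul_of, of_comp]
  exact (GrMod.Hom.lin f).map_smul r m

/-- A morphism of graded modules from its components. -/
def ofComp (φ : ∀ d, M.deg d →+ F.obj d) (hφ : ∀ {d d' : ℤ} {r : SkewPoly n lam}
    (h : HDeg d d' r) (m : M.deg d), φ d' ⟨r • m, GrMod.smul_mem' h m.2⟩ = F.op h (φ d m)) :
    M ⟶ F.grMod :=
  let f : M.carrier →+ F.tot := (DirectSum.toAddMonoid fun d => (DirectSum.of F.obj d).comp (φ d)).comp
    (DirectSum.decomposeAddEquiv M.deg).toAddMonoidHom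
  have hf : ∀ d (m : M.deg d), f m = DirectSum.of F.obj d (φ d m) := fun d m => by
    simp [f]
  have hs : ∀ (r : SkewPoly n lam) m, f (r • m) = r • f m := fun r => by
    -- Linearity over homogeneous elements covers the constants and the generators, from which all
    -- of R is obtained by sums and products.
    have hom : ∀ (r : SkewPoly n lam) (e : ℕ), r ∈ deg n lam e → ∀ m, f (r • m) = r • f m := by
      intro r e hr m
      induction m using GrMod.homogeneous_induction with
      | hdeg d m hm =>
        have h := HDeg.of_mem d hr
        exact (hf _ ⟨r • m, GrMod.smul_mem' h hm⟩).trans ((congrArg _ (hφ h ⟨m, hm⟩)).trans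
          ((F.smul_of h _).symm.trans (congrArg _ (hf d ⟨m, hm⟩).symm)))
      | hadd a b ha hb => rw [smul_add, map_add, ha, hb, map_add, smul_add]
    induction r using SkewPoly.induction with
    | hc c => exact hom _ 0 (const_mem_deg c)
    | hx i => exact hom _ 1 (x_mem_deg i)
    | hadd a b ha hb => intro m; rw [add_smul, map_add, ha, hb, add_smul]
    | hmul a b ha hb => intro m; rw [mul_smul, ha, hb, mul_smul]
  { lin := { f with map_smul' := hs }
    map_deg := fun d m hm => by
      have := hf d ⟨m, hm⟩
      exact ⟨_, this.symm⟩ }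

theorem comp_ofComp (φ : ∀ d, M.deg d →+ F.obj d) (hφ : ∀ {d d' : ℤ} {r : SkewPoly n lam}
    (h : HDeg d d' r) (m : M.deg d), φ d' ⟨r • m, GrMod.smul_mem' h m.2⟩ = F.op h (φ d m))
    (d : ℤ) (m : M.deg d) : comp (ofComp φ hφ) d m = φ d m := by
  have h : GrMod.Hom.lin (ofComp φ hφ) m = DirectSum.of F.obj d (φ d m) := by
    change DirectSum.toAddMonoid (fun d => (DirectSum.of F.obj d).comp (φ d))
      (DirectSum.decompose M.deg m) = _
    simp
  refine DirectSum.of_injective d ?_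
  rw [of_comp]
  exact h

theorem hom_ext {f g : M ⟶ F.grMod} (h : ∀ d m, comp f d m = comp g d m) : f = g :=
  GrMod.hom_ext fun d m hm => by
    have h1 := of_comp f ⟨m, hm⟩
    rw [h, of_comp] at h1
    exact h1.symm

end GrFam

end Graded

/-! ### The descent datum of a graded module -/

section Lambda

open SkewPoly

variable {n : ℕ} {lam : Fin n → Fin n → ℂ}

theorem Mon.exists_eq_pow {i : Fin n} {d : ℕ} {y : SkewPoly n lam}
    (hy : Mon {SkewPoly.x lam i} d y) : ∃ c : ℂ, c ≠ 0 ∧ y = c • SkewPoly.x lam i ^ d := by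
  induction hy with
  | @const c hc => exact ⟨c, hc, by rw [pow_zero, Algebra.algebraMap_eq_smul_one]⟩
  | @mul j hj d y _ ih =>
    obtain ⟨c, hc, rfl⟩ := ih
    have h : SkewPoly.x lam j = SkewPoly.x lam i := hj
    exact ⟨c, hc, by rw [h, mul_smul_comm, pow_succ']⟩

theorem mem_sgl (i : Fin n) : x lam i ∈ (sgl lam i).1 := rfl

theorem mem_pr_left (i j : Fin n) : x lam i ∈ (pr lam i j).1 := Or.inl rfl

theorem mem_pr_right (i j : Fin n) : x lam j ∈ (pr lam i j).1 := Or.inr rfl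

/-- The localization of a module at a set of generators. -/
abbrev LocExt (A : Idx lam) (M : Type) [AddCommGroup M] [Module (SkewPoly n lam) M] : Type :=
  Ext (ofA A) M

section

variable (A : Idx lam) (M : Type) [AddCommGroup M] [Module (SkewPoly n lam) M]

/-- The canonical map to a localization. -/
def toExt : M →+ LocExt A M where
  toFun := fun m => Ext.tmul (ofA A) 1 m
  map_zero' := by simp [Ext.tmul]
  map_add' := fun x y => by simp [Ext.tmul, TensorProduct.tmul_add]

theorem isBC_toExt : IsBC (ofA A) (toExt A M) := isBC_ext _ _

variable {A M}

theorem toExt_smul (r : SkewPoly n lam) (m : M) :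
    toExt A M (r • m) = ofA A r • toExt A M m := (isBC_toExt A M).map_smul r m

/-- Restriction between localizations. -/
def extRes {A B : Idx lam} (h : A ≤ B) : LocExt A M →ₛₗ[resS h] LocExt B M :=
  Ext.map (resS h) (resS_of h) M

theorem extRes_toExt {A B : Idx lam} (h : A ≤ B) (m : M) :
    extRes h (toExt A M m) = toExt B M m := by
  refine (Ext.map_tmul (resS h) (resS_of h) (1 : SA A) m).trans ?_
  rw [map_one]; rfl

theorem extRes_refl (t : LocExt A M) : extRes (le_refl A) t = t := by
  refine (isBC_toExt A M).addHom_ext (φ := RingHom.id _) (h := (extRes (le_refl A)).toAddMonoidHom)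
    (h' := AddMonoidHom.id _) (fun b m => ?_) (fun b m => rfl) (fun m => ?_) t
  · refine (map_smulₛₗ (extRes (le_refl A)) b m).trans ?_
    rw [resS_refl]; rfl
  · exact extRes_toExt (M := M) (le_refl A) m

theorem extRes_extRes {A B C : Idx lam} (h : A ≤ B) (h' : B ≤ C) (t : LocExt A M) :
    extRes h' (extRes h t) = extRes (h.trans h') t := by
  refine (isBC_toExt A M).addHom_ext (φ := resS (h.trans h'))
    (h := (extRes h').toAddMonoidHom.comp (extRes h).toAddMonoidHom)
    (h' := (extRes (h.trans h')).toAddMonoidHom) (fun b m => ?_)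
    (fun b m => map_smulₛₗ (extRes (h.trans h')) b m) (fun m => ?_) t
  · change extRes h' (extRes h (b • m)) = _ • extRes h' (extRes h m)
    rw [map_smulₛₗ, map_smulₛₗ, resS_resS]
  · change extRes h' (extRes h (toExt A M m)) = extRes (h.trans h') (toExt A M m)
    rw [extRes_toExt, extRes_toExt, extRes_toExt]

variable {N : Type} [AddCommGroup N] [Module (SkewPoly n lam) N]

theorem exists_extHom (A : Idx lam) (f : M →ₗ[SkewPoly n lam] N) :
    ∃ g : LocExt A M →ₗ[SA A] LocExt A N, ∀ m, g (toExt A M m) = toExt A N (f m) :=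
  (isBC_toExt A M).exists_lift ((toExt A N).comp f.toAddMonoidHom) fun r m => by
    simp [toExt_smul]

/-- The map between localizations induced by a linear map. -/
def extHom (A : Idx lam) (f : M →ₗ[SkewPoly n lam] N) : LocExt A M →ₗ[SA A] LocExt A N :=
  (exists_extHom A f).choose

@[simp]
theorem extHom_toExt (f : M →ₗ[SkewPoly n lam] N) (m : M) :
    extHom A f (toExt A M m) = toExt A N (f m) := (exists_extHom A f).choose_spec m

theorem extHom_extRes (f : M →ₗ[SkewPoly n lam] N) {A B : Idx lam} (h : A ≤ B)
    (t : LocExt A M) : extHom B f (extRes h t) = extRes h (extHom A f t) := by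
  refine (isBC_toExt A M).addHom_ext (φ := resS h)
    (h := (extHom B f).toAddMonoidHom.comp (extRes h).toAddMonoidHom)
    (h' := (extRes h).toAddMonoidHom.comp (extHom A f).toAddMonoidHom) (fun b m => ?_)
    (fun b m => ?_) (fun m => ?_) t
  · change extHom B f (extRes h (b • m)) = _ • extHom B f (extRes h m)
    rw [map_smulₛₗ, map_smul]
  · change extRes h (extHom A f (b • m)) = _ • extRes h (extHom A f m)
    rw [map_smul, map_smulₛₗ]
  · change extHom B f (extRes h (toExt A M m)) = extRes h (extHom A f (toExt A M m))
    rw [extRes_toExt, extHom_toExt, extHom_toExt, extRes_toExt]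

end

section

variable [hlam : Fact (∀ i j : Fin n, i < j → lam i j ≠ 0)]

variable (M : GrMod n lam) (A : Idx lam)

/-- The degree zero component of the localization of a graded module. -/
def extZero : Submodule (RA A) (LocExt A M.carrier) where
  carrier := {t | ∃ d y, Mon A.1 d y ∧ ∃ m ∈ M.deg d, ofA A y • t = toExt A M.carrier m}
  zero_mem' := ⟨0, 1, Mon.one, 0, zero_mem _, by simp⟩
  add_mem' := by
    rintro t t' ⟨d, y, hy, m, hm, h⟩ ⟨d', y', hy', m', hm', h'⟩
    obtain ⟨k, hk, hc⟩ := hy'.mul_comm' hlam.out hy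
    refine ⟨d' + d, y' * y, hy'.mul' hy, y' • m + (k • y) • m', ?_, ?_⟩
    · refine add_mem ?_ ?_
      · have := M.smul_mem d' d y' m hy'.mem_deg hm
        exact_mod_cast this
      · have := M.smul_mem d d' (k • y) m' (hy.smul hk).mem_deg hm'
        rw [add_comm] at this
        exact_mod_cast this
    · rw [smul_add, map_add, toExt_smul, toExt_smul, ← h, ← h', smul_smul, smul_smul, ← map_mul,
        ← map_mul, smul_mul_assoc, ← hc]
  smul_mem' := by
    rintro s t ⟨d, y, hy, m, hm, h⟩
    obtain ⟨w, hw, h1, h2⟩ := hy.exists_inv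
    have hs : LocDeg lam A.1 0 (s : SA A) := s.2
    -- With t = y⁻¹ m, the element s y⁻¹ of degree -d is rewritten as y'⁻¹ r, so that s t = y'⁻¹ (r
    -- m).
    obtain ⟨d', y', hy', e, r, hr, he, hb⟩ := (hs.mul hw).exists_frac hlam.out A.2.2
    refine ⟨d', y', hy', r • m, ?_, ?_⟩
    · have := M.smul_mem e d r m hr hm
      have e' : (e : ℤ) + d = d' := by omega
      rwa [e'] at this
    · rw [toExt_smul, ← h, ← hb, smul_smul, mul_assoc, mul_assoc, h2, mul_one, mul_smul]
      rfl

variable {M A}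

theorem extRes_mem {B : Idx lam} (h : A ≤ B) {t : LocExt A M.carrier} (ht : t ∈ extZero M A) :
    extRes h t ∈ extZero M B := by
  obtain ⟨d, y, hy, m, hm, e⟩ := ht
  refine ⟨d, y, hy.mono h, m, hm, ?_⟩
  rw [← extRes_toExt h, ← e, map_smulₛₗ, resS_of]

variable {i j : Fin n} (hi : x lam i ∈ A.1) (hj : x lam j ∈ A.1)

omit hlam in
theorem ofA_xpow (k : ℕ) : ofA A (x lam i ^ k) = ↑(xu hi ^ (k : ℤ)) := by
  rw [map_pow, zpow_natCast, Units.val_pow_eq_pow_val]; rfl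

theorem frac_mem {d : ℤ} {m : M.carrier} (hm : m ∈ M.deg d) :
    (↑(xu hi ^ (-d)) : SA A) • toExt A M.carrier m ∈ extZero M A := by
  rcases Int.le_total 0 d with h | h
  · lift d to ℕ using h
    refine ⟨d, _, Mon.xpow hi d, m, hm, ?_⟩
    rw [ofA_xpow hi, smul_smul, ← Units.val_mul, ← zpow_add, add_neg_cancel, zpow_zero,
      Units.val_one, one_smul]
  -- In negative degree -k the fraction is simply x_iᵏ m, with denominator 1.
  · obtain ⟨k, rfl⟩ : ∃ k : ℕ, d = -k := ⟨(-d).toNat, by omega⟩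
    refine ⟨0, 1, Mon.one, x lam i ^ k • m, ?_, ?_⟩
    · have := GrMod.smul_mem' (HDeg.xpow (-(k : ℤ)) i k) hm
      rwa [neg_add_cancel] at this
    · rw [map_one, one_smul, toExt_smul, ofA_xpow hi, neg_neg]

/-- The fraction `x_i⁻ᵈ m` for `m` of degree `d`. -/
def frac (d : ℤ) : M.deg d →+ extZero M A where
  toFun m := ⟨_, frac_mem hi m.2⟩
  map_zero' := Subtype.ext (by simp)
  map_add' a b := Subtype.ext (by simp)

theorem coe_frac {d : ℤ} (m : M.deg d) :
    (frac hi d m : LocExt A M.carrier) = (↑(xu hi ^ (-d)) : SA A) • toExt A M.carrier m := rfl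

theorem tw_smul_frac {d d' : ℤ} {r : SkewPoly n lam} (hr : HDeg d d' r) (m : M.deg d) :
    tw hi hj hr • frac hi d m = frac hj d' ⟨r • (m : M.carrier), GrMod.smul_mem' hr m.2⟩ := by
  refine Subtype.ext ?_
  rw [coe_frac, Submodule.coe_smul, coe_frac, toExt_smul, smul_smul]
  refine (smul_smul (tw hi hj hr : SA A) (↑(xu hi ^ (-d)) : SA A) (toExt A M.carrier m)).trans ?_
  congr 1
  simp only [tw]
  rw [mul_assoc, ← Units.val_mul, ← zpow_add, add_neg_cancel, zpow_zero, Units.val_one, mul_one]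

/-- On a single chart the only monomials are scalar multiples of powers of x_i, and the scalar is
absorbed into the numerator. -/
theorem exists_eq_frac {i : Fin n} (t : extZero M (sgl lam i)) :
    ∃ (d : ℕ) (m : M.deg d), t = frac (mem_sgl i) d m := by
  obtain ⟨t, d, y, hy, m, hm, h⟩ := t
  obtain ⟨c, hc, rfl⟩ := hy.exists_eq_pow
  have hm' := GrMod.smul_mem' (HDeg.const (d : ℤ) c⁻¹) hm
  refine ⟨d, ⟨_, hm'⟩, Subtype.ext ?_⟩
  have hi := mem_sgl (lam := lam) i
  change t = (↑(xu hi ^ (-(d : ℤ))) : SA (sgl lam i)) • toExt (sgl lam i) M.carrier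
    (algebraMap ℂ (SkewPoly n lam) c⁻¹ • m)
  rw [toExt_smul, ← h, smul_smul (ofA (sgl lam i) _), ← map_mul, ← Algebra.smul_def, smul_smul c⁻¹,
    inv_mul_cancel₀ hc, one_smul, ofA_xpow hi, smul_smul, ← Units.val_mul, ← zpow_add,
    neg_add_cancel, zpow_zero, Units.val_one, one_smul]

theorem frac_eq_zero_iff {i : Fin n} {d : ℤ} {m : M.deg d} :
    frac (mem_sgl i) d m = 0 ↔ ∃ k : ℕ, x lam i ^ k • (m : M.carrier) = 0 := by
  rw [← Submodule.coe_eq_zero, coe_frac, (Units.isUnit _).smul_eq_zero]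
  constructor
  · intro h
    obtain ⟨y, ⟨d, hy⟩, h⟩ := (isOre_of hlam.out (sgl lam i).2.2).ker_of_isBC
      (isBC_toExt (sgl lam i) M.carrier) h
    obtain ⟨c, hc, rfl⟩ := hy.exists_eq_pow
    refine ⟨d, ?_⟩
    have h1 := congrArg (fun t => algebraMap ℂ (SkewPoly n lam) c⁻¹ • t) h
    simp only [smul_zero, smul_smul] at h1
    rwa [← Algebra.smul_def, smul_smul, inv_mul_cancel₀ hc, one_smul] at h1
  · rintro ⟨k, hk⟩
    have hi := mem_sgl (lam := lam) i
    have h := toExt_smul (A := sgl lam i) (x lam i ^ k) (m : M.carrier)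
    rw [hk, map_zero, ofA_xpow hi] at h
    exact (Units.isUnit _).smul_eq_zero.mp h.symm

variable (M)

/-- The descent datum of a graded module. -/
def lambdaObj : DMod lam where
  obj A := extZero M A
  grp A := Submodule.addCommGroup (extZero M A)
  mod A := Submodule.module (extZero M A)
  map h :=
    { toFun := fun t => ⟨extRes h t, extRes_mem h t.2⟩
      map_zero' := Subtype.ext (map_zero _)
      map_add' := fun a b => Subtype.ext (map_add _ _ _) }
  map_refl A t := Subtype.ext (extRes_refl _)
  map_map h h' t := Subtype.ext (extRes_extRes h h' _)
  isBC {A B} h := by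
    obtain ⟨i, hi⟩ := A.2.1
    refine (isOre_res hlam.out h hi).isBC (fun a t => Subtype.ext ?_) (fun t => ?_) (fun t ht => ?_)
    · exact map_smulₛₗ (extRes h) (a : SA A) (t : LocExt A M.carrier)
    · obtain ⟨t, d, y, hy, m, hm, e⟩ := t
      -- The fraction y⁻¹ m becomes (x_i⁻ᵈ y)⁻¹ (x_i⁻ᵈ m).
      refine ⟨divx hi hy.mem_deg, divx_mem_den hlam.out hi hy, frac hi d ⟨m, hm⟩, Subtype.ext ?_⟩
      rw [res_divx]
      change (divx (A := B) (h hi) hy.mem_deg : SA B) • t = extRes h ((↑(xu hi ^ (-(d : ℤ))) : SA A) •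
        toExt A M.carrier m)
      rw [map_smulₛₗ, resS_zpow, extRes_toExt, ← e, smul_smul]
      rfl
    · obtain ⟨t, d, y, hy, m, hm, e⟩ := t
      have h0 : extRes h t = 0 := congrArg Subtype.val ht
      have h1 : toExt B M.carrier m = 0 := by
        rw [← extRes_toExt h, ← e, map_smulₛₗ, h0, smul_zero]
      obtain ⟨z, ⟨f, hz⟩, hzm⟩ := (isOre_of hlam.out B.2.2).ker_of_isBC
        (isBC_toExt B M.carrier) h1
      have hzy := hz.mul' (hy.mono h)
      refine ⟨divx hi hzy.mem_deg, divx_mem_den hlam.out hi hzy, Subtype.ext ?_⟩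
      change ((↑(xu hi ^ (-((f + d : ℕ) : ℤ))) : SA A) * ofA A (z * y)) • t = 0
      rw [map_mul, mul_smul, mul_smul, e, ← toExt_smul, hzm, map_zero, smul_zero]

/-- The fraction `x_i⁻ᵈ m`, as an element of the descent datum of `M`. -/
def fr {A : Idx lam} {i : Fin n} (hi : x lam i ∈ A.1) (d : ℤ) : M.deg d →+ (lambdaObj M).obj A :=
  frac hi d

variable {M}

theorem tw_smul_fr {A : Idx lam} {i j : Fin n} (hi : x lam i ∈ A.1) (hj : x lam j ∈ A.1)
    {d d' : ℤ} {r : SkewPoly n lam} (hr : HDeg d d' r) (m : M.deg d) :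
    tw hi hj hr • fr M hi d m = fr M hj d' ⟨r • (m : M.carrier), GrMod.smul_mem' hr m.2⟩ :=
  tw_smul_frac hi hj hr m

theorem exists_eq_fr {i : Fin n} (t : (lambdaObj M).obj (sgl lam i)) :
    ∃ (d : ℕ) (m : M.deg d), t = fr M (mem_sgl i) d m := exists_eq_frac t

theorem fr_eq_zero_iff {i : Fin n} {d : ℤ} {m : M.deg d} :
    fr M (mem_sgl i) d m = 0 ↔ ∃ k : ℕ, x lam i ^ k • (m : M.carrier) = 0 := frac_eq_zero_iff

theorem map_fr {A B : Idx lam} (h : A ≤ B) {i : Fin n} (hi : x lam i ∈ A.1) {d : ℤ}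
    (m : M.deg d) : (lambdaObj M).map h (fr M hi d m) = fr M (A := B) (h hi) d m := by
  refine Subtype.ext ?_
  change extRes h ((↑(xu hi ^ (-d)) : SA A) • toExt A M.carrier m) = _
  rw [map_smulₛₗ, resS_zpow, extRes_toExt]
  rfl

variable {N : GrMod n lam}

theorem extHom_mem (f : M ⟶ N) {A : Idx lam} {t : LocExt A M.carrier} (ht : t ∈ extZero M A) :
    extHom A (GrMod.Hom.lin f) t ∈ extZero N A := by
  obtain ⟨d, y, hy, m, hm, e⟩ := ht
  exact ⟨d, y, hy, _, GrMod.Hom.map_deg f _ _ hm, by rw [← map_smul, e, extHom_toExt]⟩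

/-- The morphism of descent data induced by a morphism of graded modules. -/
def lambdaMap (f : M ⟶ N) : lambdaObj M ⟶ lambdaObj N where
  app A :=
    { toFun := fun t => ⟨extHom A (GrMod.Hom.lin f) t.1, extHom_mem f t.2⟩
      map_add' := fun _ _ => Subtype.ext (map_add _ _ _)
      map_smul' := fun c t => Subtype.ext ((extHom A (GrMod.Hom.lin f)).map_smul (c : SA A) t.1) }
  naturality h _ := Subtype.ext (extHom_extRes _ h _)

theorem lambdaMap_fr (f : M ⟶ N) {A : Idx lam} {i : Fin n} (hi : x lam i ∈ A.1) {d : ℤ}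
    (m : M.deg d) : DMod.Hom.app (lambdaMap f) A (fr M hi d m) =
      fr N hi d ⟨GrMod.Hom.lin f m, GrMod.Hom.map_deg f d m m.2⟩ := by
  refine Subtype.ext ?_
  change extHom A (GrMod.Hom.lin f) ((↑(xu hi ^ (-d)) : SA A) • toExt A M.carrier m) = _
  rw [map_smul, extHom_toExt]
  rfl

theorem lambda_hom_ext {D : DMod lam} {f g : lambdaObj M ⟶ D}
    (h : ∀ i d (m : M.deg d), DMod.Hom.app f (sgl lam i) (fr M (mem_sgl i) d m) =
      DMod.Hom.app g (sgl lam i) (fr M (mem_sgl i) d m)) : f = g :=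
  DMod.hom_ext_sgl fun i t => by
    obtain ⟨d, m, rfl⟩ := exists_eq_fr t
    exact h i d m

variable (lam)

/-- The functor from graded modules to descent data. -/
def lambda : GrMod n lam ⥤ DMod lam where
  obj := lambdaObj
  map := lambdaMap
  map_id M := lambda_hom_ext fun i d m => by
    exact lambdaMap_fr _ _ m
  map_comp f g := lambda_hom_ext fun i d m => by
    refine (lambdaMap_fr _ _ m).trans (Eq.symm ?_)
    exact (congrArg (DMod.Hom.app (lambdaMap g) _) (lambdaMap_fr f _ m)).trans
      (lambdaMap_fr g _ _)

end

end Lambda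

/-! ### The graded module of sections of twists -/

section Gamma

open SkewPoly

variable {n : ℕ} {lam : Fin n → Fin n → ℂ} (D : DMod lam)

/-- The compatible families of elements of degree `d`. -/
def gammaDeg (d : ℤ) : AddSubgroup (∀ i, D.obj (sgl lam i)) where
  carrier := {m | ∀ i j, tw (mem_pr_left (lam := lam) i j) (mem_pr_right (lam := lam) i j) (HDeg.one d) •
    D.map (sgl_le_left i j) (m i) = D.map (sgl_le_right i j) (m j)}
  zero_mem' i j := by simp
  add_mem' ha hb i j := by
    rw [Pi.add_apply, Pi.add_apply, map_add, map_add, smul_add, ha i j, hb i j]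
  neg_mem' ha i j := by
    rw [Pi.neg_apply, Pi.neg_apply, map_neg, map_neg, smul_neg, ha i j]

variable {D}

theorem tw_smul_gamma {d d' : ℤ} {r : SkewPoly n lam} (hr : HDeg d d' r)
    {m : ∀ i, D.obj (sgl lam i)} (hm : m ∈ gammaDeg D d) (i j : Fin n) :
    tw (mem_pr_left (lam := lam) i j) (mem_pr_right (lam := lam) i j) hr • D.map (sgl_le_left i j) (m i) =
      D.map (sgl_le_right i j) (tw (mem_sgl (lam := lam) j) (mem_sgl (lam := lam) j) hr • m j) := by
  rw [(D.isBC _).map_smul, res_tw, ← hm i j, smul_smul, tw_mul_tw]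
  exact congrArg (· • _) (tw_congr _ _ (mul_one r).symm _ _)

theorem tw_smul_mem_gammaDeg {d d' : ℤ} {r : SkewPoly n lam} (hr : HDeg d d' r)
    {m : ∀ i, D.obj (sgl lam i)} (hm : m ∈ gammaDeg D d) :
    (fun i => tw (mem_sgl (lam := lam) i) (mem_sgl (lam := lam) i) hr • m i) ∈ gammaDeg D d' := fun i j => by
  rw [← tw_smul_gamma hr hm, (D.isBC _).map_smul, res_tw, smul_smul, tw_mul_tw]
  exact congrArg (· • _) (tw_congr _ _ (one_mul r) _ _)

variable (D)

/-- The graded family of sections of the twists of a descent datum. -/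
def gammaFam : GrFam lam where
  obj d := gammaDeg D d
  op hr :=
    { toFun := fun m => ⟨_, tw_smul_mem_gammaDeg hr m.2⟩
      map_zero' := Subtype.ext (funext fun i => smul_zero _)
      map_add' := fun a b => Subtype.ext (funext fun i => smul_add _ _ _) }
  op_one d m := Subtype.ext (funext fun i => by
    change tw (mem_sgl (lam := lam) i) (mem_sgl (lam := lam) i) (HDeg.one d) • m.1 i = _
    rw [tw_one, one_smul])
  op_mul hs hr m := Subtype.ext (funext fun i => by
    change tw (mem_sgl (lam := lam) i) (mem_sgl (lam := lam) i) (hs.mul hr) • m.1 i =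
      tw (mem_sgl (lam := lam) i) (mem_sgl (lam := lam) i) hs • tw (mem_sgl (lam := lam) i) (mem_sgl (lam := lam) i) hr • m.1 i
    rw [smul_smul, tw_mul_tw])
  op_add hr hs m := Subtype.ext (funext fun i => by
    change tw (mem_sgl (lam := lam) i) (mem_sgl (lam := lam) i) (hr.add hs) • m.1 i =
      tw (mem_sgl (lam := lam) i) (mem_sgl (lam := lam) i) hr • m.1 i + tw (mem_sgl (lam := lam) i) (mem_sgl (lam := lam) i) hs • m.1 i
    rw [tw_add, add_smul])

variable [hlam : Fact (∀ i j : Fin n, i < j → lam i j ≠ 0)]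

/-- In any chosen degree d, scalars from R_i act as multiplication by homogeneous elements of R.
Hence a map respecting homogeneous multiplication is R_i-linear. -/
theorem exists_eq_tw (i : Fin n) (d : ℤ) (a : RA (sgl lam i)) :
    ∃ (e : ℕ) (r : SkewPoly n lam) (hr : r ∈ deg n lam e),
      a = tw (mem_sgl (lam := lam) i) (mem_sgl (lam := lam) i) (HDeg.of_mem d hr) := by
  have hi := mem_sgl (lam := lam) i
  have hb := ((locDeg_zpow hi d).mul (show LocDeg lam _ 0 (a : SA (sgl lam i)) from a.2)).mul
    (locDeg_zpow hi (-d))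
  obtain ⟨d', y, hy, e, r, hr, he, h⟩ := hb.exists_frac hlam.out (sgl lam i).2.2
  obtain rfl : e = d' := by omega
  obtain ⟨c, hc, rfl⟩ := hy.exists_eq_pow
  refine ⟨e, c⁻¹ • r, Submodule.smul_mem _ _ hr, Subtype.ext ?_⟩
  simp only [tw]
  rw [of_smul, ← h, ← mul_assoc (ofA _ (algebraMap ℂ _ c⁻¹)), ← map_mul, ← Algebra.smul_def,
    smul_smul, inv_mul_cancel₀ hc, one_smul, ofA_xpow hi]
  simp only [mul_assoc]
  rw [← Units.val_mul, ← zpow_add, neg_add_cancel, zpow_zero, Units.val_one, mul_one,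
    ← mul_assoc, ← mul_assoc, ← Units.val_mul, ← Units.val_mul, ← zpow_add, ← zpow_add]
  have : -(d + (e : ℤ)) + e + d = 0 := by ring
  rw [this, zpow_zero, Units.val_one, one_mul]

variable {M : GrMod n lam}

theorem fr_xpow {A : Idx lam} {i : Fin n} (hi : x lam i ∈ A.1) {d : ℤ} (m : M.deg d) (k : ℕ) :
    fr M hi (d + k) ⟨x lam i ^ k • (m : M.carrier), GrMod.smul_mem' (HDeg.xpow d i k) m.2⟩ =
      fr M hi d m := by
  rw [← tw_smul_fr hi hi (HDeg.xpow d i k), tw_xpow, one_smul]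

/-- The module on the i-th chart behaves as the direct limit of the groups M_d under multiplication
by x_i: two fractions are compared in the larger of their degrees, and a fraction vanishes only if a
power of x_i kills its numerator. -/
theorem exists_addHom_of_fr (i : Fin n) {Q : Type} [AddCommGroup Q] (v : ∀ d, M.deg d →+ Q)
    (hv : ∀ d (m : M.deg d) (k : ℕ), v (d + k)
      ⟨x lam i ^ k • (m : M.carrier), GrMod.smul_mem' (HDeg.xpow d i k) m.2⟩ = v d m) :
    ∃ g : (lambdaObj M).obj (sgl lam i) →+ Q, ∀ d m, g (fr M (mem_sgl (lam := lam) i) d m) = v d m := by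
  have shift : ∀ (d e : ℤ) (m : M.deg d), d ≤ e → ∃ m' : M.deg e,
      fr M (mem_sgl (lam := lam) i) e m' = fr M (mem_sgl (lam := lam) i) d m ∧ v e m' = v d m := by
    intro d e m h
    obtain ⟨k, rfl⟩ := Int.le.dest h
    exact ⟨_, fr_xpow (mem_sgl (lam := lam) i) m k, hv d m k⟩
  have zero : ∀ d (m : M.deg d), fr M (mem_sgl (lam := lam) i) d m = 0 → v d m = 0 := by
    intro d m h
    obtain ⟨k, hk⟩ := fr_eq_zero_iff.mp h
    rw [← hv d m k, ← map_zero (v (d + k))]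
    exact congrArg _ (Subtype.ext hk)
  have well : ∀ d (m : M.deg d) d' (m' : M.deg d'),
      fr M (mem_sgl (lam := lam) i) d m = fr M (mem_sgl (lam := lam) i) d' m' → v d m = v d' m' := by
    intro d m d' m' h
    obtain ⟨a, ha, ha'⟩ := shift d (max d d') m (le_max_left _ _)
    obtain ⟨b, hb, hb'⟩ := shift d' (max d d') m' (le_max_right _ _)
    rw [← ha', ← hb', ← sub_eq_zero, ← map_sub]
    refine zero _ _ ?_
    rw [map_sub, ha, hb, h, sub_self]
  choose δ μ hμ using exists_eq_fr (M := M) (i := i)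
  have hG : ∀ d m, v _ (μ (fr M (mem_sgl (lam := lam) i) d m)) = v d m := fun d m =>
    well _ _ _ _ (hμ _).symm
  refine ⟨⟨⟨fun t => v _ (μ t), ?_⟩, fun t t' => ?_⟩, hG⟩
  · have := hG 0 0
    rwa [map_zero, map_zero] at this
  · obtain ⟨a, ha, ha'⟩ := shift _ (max (δ t) (δ t')) (μ t) (le_max_left _ _)
    obtain ⟨b, hb, hb'⟩ := shift _ (max (δ t) (δ t')) (μ t') (le_max_right _ _)
    have h : t + t' = fr M (mem_sgl (lam := lam) i) _ (a + b) := by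
      rw [map_add, ha, hb, ← hμ, ← hμ]
    change v _ (μ (t + t')) = v _ (μ t) + v _ (μ t')
    rw [h, hG, map_add, ha', hb']

theorem exists_linear_of_fr (i : Fin n) {Q : Type} [AddCommGroup Q] [Module (RA (sgl lam i)) Q]
    (v : ∀ d, M.deg d →+ Q)
    (hv : ∀ {d d' : ℤ} {r : SkewPoly n lam} (hr : HDeg d d' r) (m : M.deg d), v d'
      ⟨r • (m : M.carrier), GrMod.smul_mem' hr m.2⟩ = tw (mem_sgl (lam := lam) i) (mem_sgl (lam := lam) i) hr • v d m) :
    ∃ g : (lambdaObj M).obj (sgl lam i) →ₗ[RA (sgl lam i)] Q,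
      ∀ d m, g (fr M (mem_sgl (lam := lam) i) d m) = v d m := by
  obtain ⟨g, hg⟩ := exists_addHom_of_fr i v fun d m k => by
    rw [hv (HDeg.xpow d i k), tw_xpow, one_smul]
  refine ⟨{ g with map_smul' := fun a t => ?_ }, hg⟩
  obtain ⟨d, m, rfl⟩ := exists_eq_fr t
  obtain ⟨e, r, hr, rfl⟩ := exists_eq_tw i d a
  change g (_ • _) = _ • g _
  rw [tw_smul_fr, hg, hg, hv (HDeg.of_mem _ hr)]
  rfl

variable {D}

/-- The sections defined by a morphism of descent data. -/
def toGammaDeg (g : lambdaObj M ⟶ D) (d : ℤ) : M.deg d →+ gammaDeg D d where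
  toFun := fun m => ⟨fun i => DMod.Hom.app g (sgl lam i) (fr M (mem_sgl i) d m), fun i j => by
    rw [← DMod.Hom.naturality, ← DMod.Hom.naturality, map_fr, map_fr, ← map_smul]
    refine congrArg _ ((tw_smul_fr _ _ _ _).trans ?_)
    exact congrArg _ (Subtype.ext (one_smul _ _))⟩
  map_zero' := Subtype.ext (funext fun i => by
    change DMod.Hom.app g (sgl lam i) (fr M (mem_sgl i) d 0) = 0
    rw [map_zero]; exact map_zero _)
  map_add' := fun a b => Subtype.ext (funext fun i => by
    change DMod.Hom.app g (sgl lam i) (fr M (mem_sgl i) d (a + b)) =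
      DMod.Hom.app g (sgl lam i) (fr M (mem_sgl i) d a) +
        DMod.Hom.app g (sgl lam i) (fr M (mem_sgl i) d b)
    rw [map_add]; exact map_add _ _ _)

theorem toGammaDeg_smul (g : lambdaObj M ⟶ D) {d d' : ℤ} {r : SkewPoly n lam}
    (h : HDeg d d' r) (m : M.deg d) :
    toGammaDeg g d' ⟨r • (m : M.carrier), GrMod.smul_mem' h m.2⟩ =
      (gammaFam D).op h (toGammaDeg g d m) :=
  Subtype.ext (funext fun i => by
    change DMod.Hom.app g (sgl lam i) (fr M (mem_sgl i) d' _) =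
      tw (mem_sgl (lam := lam) i) (mem_sgl (lam := lam) i) h •
        DMod.Hom.app g (sgl lam i) (fr M (mem_sgl i) d m)
    rw [← map_smul]
    exact congrArg _ (tw_smul_fr _ _ _ _).symm)

/-- The morphism of graded modules which corresponds to a morphism of descent data. -/
def toGamma (g : lambdaObj M ⟶ D) : M ⟶ (gammaFam D).grMod :=
  GrFam.ofComp (F := gammaFam D) (toGammaDeg g) (toGammaDeg_smul g)

/-- The components of a morphism to the graded module of sections. -/
def gammaComp (f : M ⟶ (gammaFam D).grMod) (i : Fin n) (d : ℤ) : M.deg d →+ D.obj (sgl lam i) :=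
  ((Pi.evalAddMonoidHom (fun i => D.obj (sgl lam i)) i).comp (gammaDeg D d).subtype).comp
    (GrFam.comp f d)

omit hlam in
theorem gammaComp_smul (f : M ⟶ (gammaFam D).grMod) (i : Fin n) {d d' : ℤ} {r : SkewPoly n lam}
    (hr : HDeg d d' r) (m : M.deg d) :
    gammaComp f i d' ⟨r • (m : M.carrier), GrMod.smul_mem' hr m.2⟩ =
      tw (mem_sgl (lam := lam) i) (mem_sgl (lam := lam) i) hr • gammaComp f i d m :=
  congrArg (fun t : gammaDeg D d' => t.1 i) (GrFam.comp_smul f hr m)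

omit hlam in
theorem gammaComp_mem (f : M ⟶ (gammaFam D).grMod) {d : ℤ} (m : M.deg d) :
    (fun i => gammaComp f i d m) ∈ gammaDeg D d :=
  (show gammaDeg D d from GrFam.comp f d m).2

theorem gammaComp_toGamma (g : lambdaObj M ⟶ D) (i : Fin n) (d : ℤ) (m : M.deg d) :
    gammaComp (toGamma g) i d m = DMod.Hom.app g (sgl lam i) (fr M (mem_sgl (lam := lam) i) d m) :=
  congrArg (fun t : gammaDeg D d => t.1 i)
    (GrFam.comp_ofComp (F := gammaFam D) (toGammaDeg g) (toGammaDeg_smul g) d m)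

omit hlam in
theorem gamma_hom_ext {f g : M ⟶ (gammaFam D).grMod}
    (h : ∀ i d m, gammaComp f i d m = gammaComp g i d m) : f = g :=
  GrFam.hom_ext fun d m => Subtype.ext (funext fun i => h i d m)

/-- On the i-th chart m/x_iᵈ goes to the i-th component of the section f(m). The condition defining
`gammaDeg` is exactly agreement on pairwise overlaps. -/
theorem exists_ofGamma (f : M ⟶ (gammaFam D).grMod) : ∃ g : lambdaObj M ⟶ D,
    ∀ i d m, DMod.Hom.app g (sgl lam i) (fr M (mem_sgl (lam := lam) i) d m) = gammaComp f i d m := by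
  choose g hg using fun i => exists_linear_of_fr i (gammaComp f i)
    (fun hr m => gammaComp_smul f i hr m)
  obtain ⟨G, hG⟩ := DMod.exists_hom_of_sgl (M := lambdaObj M) (N := D) g (fun i j h hh t => by
    obtain ⟨d, m, rfl⟩ := exists_eq_fr t
    have h1 := tw_smul_fr (mem_pr_left (lam := lam) i j) (mem_pr_right (lam := lam) i j) (HDeg.one d) m
    have h2 : (⟨(1 : SkewPoly n lam) • (m : M.carrier), GrMod.smul_mem' (HDeg.one d) m.2⟩ :
      M.deg d) = m := Subtype.ext (one_smul _ _)
    rw [h2] at h1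
    have h3 := congrArg h (map_fr (sgl_le_right i j) (mem_sgl (lam := lam) j) m)
    have h4 := hh (fr M (mem_sgl (lam := lam) i) d m)
    rw [map_fr (sgl_le_left i j) (mem_sgl (lam := lam) i) m] at h4
    refine h3.trans ((congrArg h h1.symm).trans ((map_smul h _ _).trans ?_))
    refine (congrArg _ h4).trans ?_
    rw [hg, hg]
    exact gammaComp_mem f m i j)
  exact ⟨G, fun i d m => (hG i _).trans (hg i d m)⟩

/-- The adjunction between descent data and graded modules, on morphisms. -/
def gammaEquiv (M : GrMod n lam) (D : DMod lam) :
    (lambdaObj M ⟶ D) ≃ (M ⟶ (gammaFam D).grMod) where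
  toFun := toGamma
  invFun f := (exists_ofGamma f).choose
  left_inv g := lambda_hom_ext fun i d m => by
    rw [(exists_ofGamma (toGamma g)).choose_spec, gammaComp_toGamma]
  right_inv f := gamma_hom_ext fun i d m => by
    rw [gammaComp_toGamma, (exists_ofGamma f).choose_spec]

theorem app_gammaEquiv_symm (f : M ⟶ (gammaFam D).grMod) (i : Fin n) (d : ℤ) (m : M.deg d) :
    DMod.Hom.app ((gammaEquiv M D).symm f) (sgl lam i) (fr M (mem_sgl (lam := lam) i) d m) =
      gammaComp f i d m := (exists_ofGamma f).choose_spec i d m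

theorem gammaEquiv_naturality {M' M : GrMod n lam} (D : DMod lam) (f : M' ⟶ M)
    (g : lambdaObj M ⟶ D) :
    gammaEquiv M' D (lambdaMap f ≫ g) = f ≫ gammaEquiv M D g :=
  gamma_hom_ext fun i d m => by
    refine (gammaComp_toGamma _ i d m).trans (Eq.trans ?_
      (gammaComp_toGamma g i d ⟨GrMod.Hom.lin f m, GrMod.Hom.map_deg f d m m.2⟩).symm)
    exact congrArg (DMod.Hom.app g _) (lambdaMap_fr f _ m)

variable (lam)

/-- The functor of sections of twists. -/
def gamma : DMod lam ⥤ GrMod n lam :=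
  Adjunction.rightAdjointOfEquiv (F := lambda lam) (G_obj := fun D => (gammaFam D).grMod)
    gammaEquiv (fun _ _ Y f g => gammaEquiv_naturality Y f g)

/-- The adjunction between graded modules and descent data. -/
def lambdaGammaAdj : lambda lam ⊣ gamma lam :=
  Adjunction.adjunctionOfEquivRight (F := lambda lam) (G_obj := fun D => (gammaFam D).grMod)
    gammaEquiv (fun _ _ Y f g => gammaEquiv_naturality Y f g)

end Gamma

/-! ### The counit of the adjunction -/

section Counit

open SkewPoly

variable {n : ℕ} {lam : Fin n → Fin n → ℂ}

theorem Mon.exists_eq_mul_pow (hlam : ∀ i j : Fin n, i < j → lam i j ≠ 0)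
    {A B : Set (SkewPoly n lam)} {i : Fin n} (hB : B ⊆ insert (SkewPoly.x lam i) A) {e : ℕ}
    {y : SkewPoly n lam} (hy : Mon B e y) :
    ∃ a b y', Mon A a y' ∧ e = a + b ∧ y = y' * SkewPoly.x lam i ^ b := by
  induction hy with
  | @const c hc => exact ⟨0, 0, _, .const hc, rfl, by simp⟩
  | @mul j hj d y _ ih =>
    obtain ⟨a, b, y', hy', rfl, rfl⟩ := ih
    rcases hB hj with h | h
    · obtain ⟨c, hc, e⟩ := (Mon.x (A := Set.univ) (i := i) trivial).mul_comm' hlam hy'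
      refine ⟨a, b + 1, c • y', hy'.smul hc, by ring, ?_⟩
      rw [h, ← mul_assoc, e, pow_succ', ← mul_assoc, smul_mul_assoc, smul_mul_assoc, smul_mul_assoc]
    · exact ⟨a + 1, b, _, .mul h hy', by ring, by rw [mul_assoc]⟩

variable [hlam : Fact (∀ i j : Fin n, i < j → lam i j ≠ 0)]

/-- When B adds only x_i to A, all other factors of a denominator are already units. Clearing
denominators thus means multiplying by a power of x_i. -/
theorem eq_tw_of_mem_den {A B : Idx lam} {i : Fin n} (hB : B.1 ⊆ insert (x lam i) A.1)
    {j : Fin n} (hj : x lam j ∈ A.1) {u : RA A} (hu : u ∈ den hlam.out hj B) :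
    ∃ (b : ℕ) (v : RA A), IsUnit v ∧ u = v * tw hj hj (HDeg.xpow 0 i b) := by
  obtain ⟨e, y, hy, hu⟩ := hu
  obtain ⟨a, b, y', hy', rfl, rfl⟩ := hy.exists_eq_mul_pow hlam.out hB
  have h' : HDeg (0 + (b : ℤ)) (a + b : ℕ) y' := ⟨a, hy'.mem_deg, by push_cast; ring⟩
  refine ⟨b, tw hj hj h', isUnit_tw hj hj hy' _ (by push_cast; ring), ?_⟩
  rw [tw_mul_tw, eq_divx hj hy.mem_deg hu]
  refine Subtype.ext ?_
  simp [tw, divx]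

/-- Changing the degree d alters the twist only by a nonzero constant, so one exponent serves for
all degrees. -/
theorem tw_xpow_of_le {A : Idx lam} {i j : Fin n} (hj : x lam j ∈ A.1) {b k : ℕ} (h : b ≤ k)
    (d : ℤ) : ∃ v : RA A, tw hj hj (HDeg.xpow d i k) = v * tw hj hj (HDeg.xpow 0 i b) := by
  obtain ⟨l, rfl⟩ := Nat.exists_eq_add_of_le' h
  obtain ⟨c, _, hc⟩ := exists_tw_eq hj hlam.out (Mon.xpow (A := Set.univ) (i := i) trivial (l + b)) 0 d
  have h' : HDeg (0 + (b : ℤ)) (0 + (l + b : ℕ)) (x lam i ^ l) :=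
    ⟨l, (Mon.xpow (A := Set.univ) trivial l).mem_deg, by push_cast; ring⟩
  refine ⟨constA A c * tw hj hj h', ?_⟩
  rw [mul_assoc, tw_mul_tw]
  exact hc.trans (congrArg _ (tw_congr _ _ (pow_add _ _ _) _ _))

variable (D : DMod lam)

/-- Holding for all large k, this and the next lemma can be used with a common exponent for finitely
many charts. -/
theorem eventually_smul_eq_zero {A B : Idx lam} (h : A ≤ B) {i : Fin n}
    (hB : B.1 ⊆ insert (x lam i) A.1) {j : Fin n} (hj : x lam j ∈ A.1) {m : D.obj A}
    (hm : D.map h m = 0) :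
    ∀ᶠ k : ℕ in Filter.atTop, ∀ d, tw hj hj (HDeg.xpow d i k) • m = 0 := by
  obtain ⟨u, hu, hum⟩ := (isOre_res hlam.out h hj).ker_of_isBC (D.isBC h) hm
  obtain ⟨b, v, hv, rfl⟩ := eq_tw_of_mem_den hB hj hu
  rw [mul_smul, hv.smul_eq_zero] at hum
  filter_upwards [Filter.eventually_ge_atTop b] with k hk d
  obtain ⟨w, hw⟩ := tw_xpow_of_le (i := i) hj hk d
  rw [hw, mul_smul, hum, smul_zero]

theorem eventually_exists_map_eq {A B : Idx lam} (h : A ≤ B) {i : Fin n}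
    (hB : B.1 ⊆ insert (x lam i) A.1) {j : Fin n} (hj : x lam j ∈ A.1) (m : D.obj B) :
    ∀ᶠ k : ℕ in Filter.atTop, ∀ d, ∃ m' : D.obj A,
      D.map h m' = tw (A := B) (h hj) (h hj) (HDeg.xpow d i k) • m := by
  obtain ⟨u, hu, m', hum⟩ := (isOre_res hlam.out h hj).frac_of_isBC (D.isBC h) m
  obtain ⟨b, v, hv, rfl⟩ := eq_tw_of_mem_den hB hj hu
  obtain ⟨v, rfl⟩ := hv
  filter_upwards [Filter.eventually_ge_atTop b] with k hk d
  obtain ⟨w, hw⟩ := tw_xpow_of_le (i := i) hj hk d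
  refine ⟨(w * ↑v⁻¹) • m', ?_⟩
  rw [(D.isBC h).map_smul, ← hum, smul_smul, ← map_mul, ← mul_assoc, mul_assoc w, Units.inv_mul,
    mul_one, ← hw, res_tw]

variable {D}

omit hlam in
theorem map_pr_self {i : Fin n} (m : D.obj (sgl lam i)) :
    D.map (pr_le (mem_sgl i) (mem_sgl i)) (D.map (sgl_le_right i i) m) = m :=
  (D.map_map _ _ _).trans (D.map_refl _ _)

omit hlam in
theorem tw_mul_tw_one {A : Idx lam} {i j k : Fin n} (hi : x lam i ∈ A.1) (hj : x lam j ∈ A.1)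
    (hk : x lam k ∈ A.1) (d : ℤ) :
    tw hj hk (HDeg.one d) * tw hi hj (HDeg.one d) = tw hi hk (HDeg.one d) := by
  rw [tw_mul_tw]
  exact tw_congr _ _ (one_mul 1) _ _

omit hlam in
-- In degree 0 both sides are x_j⁻ᵏ x_iᵏ: multiplication by x_iᵏ seen on chart j is the transition
-- function of the k-th twist from chart i to chart j.
theorem tw_xpow_eq_tw_one {A : Idx lam} {i j : Fin n} (hi : x lam i ∈ A.1) (hj : x lam j ∈ A.1)
    (k : ℕ) : tw hj hj (HDeg.xpow 0 i k) = tw hi hj (HDeg.one (0 + (k : ℤ))) := by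
  have h1 := tw_mul_tw hi hj hj (HDeg.xpow 0 i k) (HDeg.one 0)
  have h2 := tw_mul_tw hi hi hj (HDeg.one (0 + (k : ℤ))) (HDeg.xpow 0 i k)
  have h3 : tw hi hj (HDeg.one (lam := lam) 0) = 1 := Subtype.ext (by simp [tw])
  rw [h3, mul_one] at h1
  rw [tw_xpow, mul_one] at h2
  rw [h1, h2]
  exact tw_congr _ _ (by rw [mul_one, one_mul]) _ _

/-- Sections over a chart extend to global sections of a twist. -/
theorem exists_gamma_eq (i : Fin n) (m : D.obj (sgl lam i)) :
    ∃ (d : ℤ) (σ : gammaDeg D d), σ.1 i = m := by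
  -- First exponent K: the section x_iᴷ m of the K-th twist extends from each overlap with chart j
  -- to a section s_j over chart j.
  have h1 : ∀ j, ∀ᶠ k : ℕ in Filter.atTop, ∃ m' : D.obj (sgl lam j),
      D.map (sgl_le_right i j) m' =
        tw (mem_pr_left (lam := lam) i j) (mem_pr_right (lam := lam) i j)
          (HDeg.one (0 + (k : ℤ))) • D.map (sgl_le_left i j) m := fun j => by
    filter_upwards [eventually_exists_map_eq D (sgl_le_right i j) (i := i) (fun _ h => h)
      (mem_sgl j) (D.map (sgl_le_left i j) m)] with k hk
    obtain ⟨m', h⟩ := hk 0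
    exact ⟨m', by rw [h, tw_xpow_eq_tw_one (mem_pr_left i j)]⟩
  obtain ⟨K, hK⟩ := (Filter.eventually_all.mpr h1).exists
  choose s hs using hK
  -- Second exponent L: the discrepancy of s_j and s_k vanishes once x_i is inverted as well, since
  -- both come from m there. So a power of x_i kills it.
  have h2 : ∀ j k, ∀ᶠ l : ℕ in Filter.atTop, ∀ d,
      tw (mem_pr_right (lam := lam) j k) (mem_pr_right (lam := lam) j k) (HDeg.xpow d i l) •
        (tw (mem_pr_left (lam := lam) j k) (mem_pr_right (lam := lam) j k)
          (HDeg.one (0 + (K : ℤ))) • D.map (sgl_le_left j k) (s j) -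
          D.map (sgl_le_right j k) (s k)) = 0 := fun j k => by
    let T := (sgl lam i).union (pr lam j k)
    have hi : x lam i ∈ T.1 := Idx.le_union_left _ _ (mem_sgl i)
    have hjk : pr lam j k ≤ T := Idx.le_union_right _ _
    have hT : ∀ a (ha : x lam a ∈ T.1), D.map (sgl_le ha) (s a) =
        tw hi ha (HDeg.one (0 + (K : ℤ))) • D.map (sgl_le hi) m := fun a ha => by
      have := congrArg (D.map (pr_le hi ha)) (hs a)
      rwa [D.map_map, (D.isBC _).map_smul, D.map_map, res_tw] at this
    refine eventually_smul_eq_zero D hjk (i := i) (fun _ h => h) _ ?_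
    rw [map_sub, (D.isBC _).map_smul, D.map_map, D.map_map, res_tw, sub_eq_zero,
      hT j (hjk (mem_pr_left j k)), hT k (hjk (mem_pr_right j k)), smul_smul, tw_mul_tw_one]
  obtain ⟨L, hL⟩ := (Filter.eventually_all.mpr fun j => Filter.eventually_all.mpr (h2 j)).exists
  -- The global section is x_iᴸ s_j on chart j. On chart i itself the powers of x_i act trivially,
  -- so the component there is m.
  refine ⟨0 + K + L, ⟨fun j => tw (mem_sgl (lam := lam) j) (mem_sgl (lam := lam) j)
    (HDeg.xpow (0 + (K : ℤ)) i L) • s j, fun j k => ?_⟩, ?_⟩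
  · have h3 := hL j k (0 + (K : ℤ))
    rw [smul_sub, sub_eq_zero, smul_smul, tw_mul_tw] at h3
    rw [(D.isBC _).map_smul, (D.isBC _).map_smul, res_tw, res_tw, ← h3, smul_smul, tw_mul_tw]
    exact congrArg (· • _) (tw_congr _ _ (by rw [mul_one, one_mul]) _ _)
  · change tw (mem_sgl (lam := lam) i) (mem_sgl (lam := lam) i) (HDeg.xpow (0 + (K : ℤ)) i L) • s i = m
    rw [tw_xpow, one_smul]
    have h3 := congrArg (D.map (pr_le (mem_sgl i) (mem_sgl i))) (hs i)
    rw [tw_one, one_smul] at h3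
    exact (map_pr_self _).symm.trans (h3.trans (map_pr_self m))

/-- Each component σ_j restricts to zero on the overlap with chart i, so high powers of x_i kill it;
there are finitely many charts. -/
theorem eventually_op_eq_zero {i : Fin n} {d : ℤ} {σ : gammaDeg D d} (h : σ.1 i = 0) :
    ∀ᶠ k : ℕ in Filter.atTop, (gammaFam D).op (HDeg.xpow d i k) σ = (0 : gammaDeg D (d + k)) := by
  have h1 : ∀ j, ∀ᶠ k : ℕ in Filter.atTop, ∀ e,
      tw (mem_sgl (lam := lam) j) (mem_sgl (lam := lam) j) (HDeg.xpow e i k) • σ.1 j = 0 :=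
    fun j => by
      refine eventually_smul_eq_zero D (sgl_le_right i j) (i := i) (fun _ h => h) (mem_sgl j) ?_
      rw [← σ.2 i j, h, map_zero, smul_zero]
  filter_upwards [Filter.eventually_all.mpr h1] with k hk
  exact Subtype.ext (funext fun j => hk j d)

variable (D)

omit hlam in
theorem gammaComp_id {i : Fin n} {d : ℤ} (σ : gammaDeg D d) :
    gammaComp (𝟙 (gammaFam D).grMod) i d
      ((gammaFam D).toTotDeg d σ) = σ.1 i := by
  have : GrFam.comp (𝟙 (gammaFam D).grMod) d ((gammaFam D).toTotDeg d σ) = σ :=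
    DirectSum.of_eq_same (β := (gammaFam D).obj) d σ
  exact congrArg (fun t : gammaDeg D d => t.1 i) this

/-- On the i-th chart the counit sends σ/x_iᵈ to the component σ_i. Injectivity and surjectivity are
the two preceding statements of Serre type. -/
instance isIso_counit : IsIso ((gammaEquiv (gammaFam D).grMod D).symm (𝟙 _)) := by
  refine DMod.isIso_of_sgl fun i => ⟨?_, fun m => ?_⟩
  · refine (injective_iff_map_eq_zero _).mpr fun t ht => ?_
    obtain ⟨d, m, rfl⟩ := exists_eq_fr t
    rw [app_gammaEquiv_symm] at ht
    obtain ⟨_, σ, rfl⟩ := m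
    have h0 : σ.1 i = 0 := (gammaComp_id D σ).symm.trans ht
    obtain ⟨k, hk⟩ := (eventually_op_eq_zero h0).exists
    refine fr_eq_zero_iff.mpr ⟨k, ?_⟩
    refine ((gammaFam D).smul_of (HDeg.xpow d i k) σ).trans ?_
    rw [hk]
    exact map_zero (DirectSum.of (gammaFam D).obj _)
  · obtain ⟨d, σ, rfl⟩ := exists_gamma_eq i m
    exact ⟨fr (gammaFam D).grMod (mem_sgl i) d ((gammaFam D).toTotDeg d σ),
      (app_gammaEquiv_symm _ _ _ _).trans (gammaComp_id D σ)⟩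

instance : IsIso (lambdaGammaAdj lam).counit := by
  refine (NatTrans.isIso_iff_isIso_app _).mpr fun D => isIso_counit D

end Counit

/-! ### Torsion and the equivalence of categories -/

section Torsion

open SkewPoly

variable {n : ℕ} {lam : Fin n → Fin n → ℂ}

theorem mem_span_mon {d : ℕ} {r : SkewPoly n lam} (hr : r ∈ deg n lam d) :
    r ∈ Submodule.span ℂ {y | Mon (x lam '' (Finset.univ : Finset (Fin n))) d y} := by
  refine deg_induction (p := fun d r => r ∈ Submodule.span ℂ
    {y | Mon (x lam '' (Finset.univ : Finset (Fin n))) d y}) (fun c => ?_)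
    (fun _ _ _ => add_mem) (fun d i a ha => ?_) (fun _ => zero_mem _)
    (fun _ c _ => Submodule.smul_mem _ c) hr
  · rw [Algebra.algebraMap_eq_smul_one]
    exact Submodule.smul_mem _ _ (Submodule.subset_span Mon.one)
  · induction ha using Submodule.span_induction with
    | mem y hy => exact Submodule.subset_span (Mon.mul (Set.mem_image_of_mem _ (by simp)) hy)
    | zero => rw [mul_zero]; exact zero_mem _
    | add a b _ _ ha hb => rw [mul_add]; exact add_mem ha hb
    | smul c a _ ha => rw [mul_smul_comm]; exact Submodule.smul_mem _ _ ha

variable [hlam : Fact (∀ i j : Fin n, i < j → lam i j ≠ 0)]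

section

variable {V : Type} [AddCommGroup V] [Module (SkewPoly n lam) V]

/-- A monomial of large degree contains a high power of some generator, and up to a scalar that
power can be moved next to m. -/
theorem exists_mon_smul_eq_zero {m : V} (h : ∀ i, ∃ k : ℕ, x lam i ^ k • m = 0)
    (S : Finset (Fin n)) :
    ∃ N : ℕ, ∀ d, N ≤ d → ∀ y, Mon (x lam '' S) d y → y • m = 0 := by
  classical
  induction S using Finset.induction_on with
  | empty =>
    refine ⟨1, fun d hd y hy => ?_⟩
    cases hy with
    | const _ => omega
    | mul hi _ => simp at hi
  | insert i S _ ih =>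
    obtain ⟨N, hN⟩ := ih
    obtain ⟨k, hk⟩ := h i
    refine ⟨N + k, fun d hd y hy => ?_⟩
    obtain ⟨a, b, z, hz, rfl, rfl⟩ := hy.exists_eq_mul_pow hlam.out (A := x lam '' S) (i := i) (by
      rw [Finset.coe_insert, Set.image_insert_eq])
    -- Either the power of the new generator already kills m, or the remaining factor has degree at
    -- least N and does so.
    rcases le_or_gt k b with hb | hb
    · obtain ⟨l, rfl⟩ := Nat.exists_eq_add_of_le' hb
      rw [pow_add, mul_smul, mul_smul, hk, smul_zero, smul_zero]
    · obtain ⟨c, _, hc⟩ := hz.mul_comm' hlam.out (Mon.xpow (A := Set.univ) (i := i) trivial b)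
      rw [hc, ← smul_mul_assoc, mul_smul, hN a (by omega) z hz, smul_zero]

/-- An element is torsion if and only if it is killed by powers of all generators. -/
theorem tors_iff {m : V} :
    (∃ N : ℕ, ∀ d : ℕ, N ≤ d → ∀ r ∈ deg n lam d, r • m = 0) ↔
      ∀ i, ∃ k : ℕ, x lam i ^ k • m = 0 := by
  constructor
  · rintro ⟨N, hN⟩ i
    exact ⟨N, hN N le_rfl _ (Mon.xpow (A := Set.univ) trivial N).mem_deg⟩
  · intro h
    obtain ⟨N, hN⟩ := exists_mon_smul_eq_zero h Finset.univ
    refine ⟨N, fun d hd r hr => ?_⟩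
    replace hr := mem_span_mon hr
    induction hr using Submodule.span_induction with
    | mem y hy => exact hN d hd y hy
    | zero => exact zero_smul _ _
    | add a b _ _ ha hb => rw [add_smul, ha, hb, add_zero]
    | smul c a _ ha => rw [Algebra.smul_def, mul_smul, ha, smul_zero]

theorem isTors_iff : IsTors n lam V ↔ ∀ (m : V) (i : Fin n), ∃ k : ℕ, x lam i ^ k • m = 0 :=
  forall_congr' fun _ => tors_iff

omit hlam in
/-- The elements which are multiplied into a submodule by a power of `x_i`. -/
theorem exists_pow_smul_mem_add {S : Submodule (SkewPoly n lam) V} {i : Fin n} {a b : V}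
    (ha : ∃ k : ℕ, x lam i ^ k • a ∈ S) (hb : ∃ k : ℕ, x lam i ^ k • b ∈ S) :
    ∃ k : ℕ, x lam i ^ k • (a + b) ∈ S := by
  obtain ⟨k, hk⟩ := ha
  obtain ⟨l, hl⟩ := hb
  refine ⟨k + l, ?_⟩
  rw [smul_add]
  refine add_mem ?_ ?_
  · rw [add_comm, pow_add, mul_smul]
    exact S.smul_mem _ hk
  · rw [pow_add, mul_smul]
    exact S.smul_mem _ hl

theorem isTors_quotient_iff {S : Submodule (SkewPoly n lam) V} :
    IsTors n lam (V ⧸ S) ↔ ∀ (m : V) (i : Fin n), ∃ k : ℕ, x lam i ^ k • m ∈ S := by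
  rw [isTors_iff]
  constructor
  · intro h m i
    obtain ⟨k, hk⟩ := h (S.mkQ m) i
    refine ⟨k, ?_⟩
    rwa [← map_smul, Submodule.mkQ_apply, Submodule.Quotient.mk_eq_zero] at hk
  · intro h m i
    obtain ⟨m, rfl⟩ := S.mkQ_surjective m
    obtain ⟨k, hk⟩ := h m i
    refine ⟨k, ?_⟩
    rwa [← map_smul, Submodule.mkQ_apply, Submodule.Quotient.mk_eq_zero]

theorem isTors_submodule_iff {S : Submodule (SkewPoly n lam) V} :
    IsTors n lam S ↔ ∀ m ∈ S, ∀ i : Fin n, ∃ k : ℕ, x lam i ^ k • m = 0 := by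
  rw [isTors_iff]
  constructor
  · intro h m hm i
    obtain ⟨k, hk⟩ := h ⟨m, hm⟩ i
    exact ⟨k, congrArg Subtype.val hk⟩
  · intro h m i
    obtain ⟨k, hk⟩ := h m m.2 i
    exact ⟨k, Subtype.ext hk⟩

end

variable {M N : GrMod n lam}

theorem exists_pow_smul_eq_of_fr_eq {i : Fin n} {d d' : ℤ} {m : M.deg d} {m' : M.deg d'}
    (h : fr M (mem_sgl i) d m = fr M (mem_sgl i) d' m') :
    ∃ k k' : ℕ, x lam i ^ k • (m : M.carrier) = x lam i ^ k' • (m' : M.carrier) := by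
  have shift : ∀ (d e : ℤ) (m : M.deg d), d ≤ e → ∃ (k : ℕ) (m' : M.deg e),
      (m' : M.carrier) = x lam i ^ k • (m : M.carrier) ∧
        fr M (mem_sgl i) e m' = fr M (mem_sgl i) d m := by
    intro d e m h
    obtain ⟨k, rfl⟩ := Int.le.dest h
    exact ⟨k, _, rfl, fr_xpow (mem_sgl i) m k⟩
  obtain ⟨a, m₁, h₁, e₁⟩ := shift d (max d d') m (le_max_left _ _)
  obtain ⟨b, m₂, h₂, e₂⟩ := shift d' (max d d') m' (le_max_right _ _)
  have h0 : fr M (mem_sgl i) _ (m₁ - m₂) = 0 := by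
    rw [map_sub, e₁, e₂, h, sub_self]
  obtain ⟨k, hk⟩ := fr_eq_zero_iff.mp h0
  refine ⟨k + a, k + b, ?_⟩
  rw [pow_add, pow_add, mul_smul, mul_smul, ← h₁, ← h₂, ← sub_eq_zero, ← smul_sub]
  exact hk

variable (f : M ⟶ N)

/-- A fraction m/x_iᵈ vanishes exactly when a power of x_i kills m, so injectivity on all charts
says that powers of all generators kill the homogeneous kernel elements. The kernel is stable under
projection to components. -/
theorem injective_lambdaMap_iff :
    (∀ i, Function.Injective (DMod.Hom.app (lambdaMap f) (sgl lam i))) ↔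
      IsTors n lam (LinearMap.ker (GrMod.Hom.lin f)) := by
  rw [isTors_submodule_iff]
  constructor
  · intro h m hm i
    have hproj : ∀ d, ∃ k : ℕ, x lam i ^ k • (M.proj d m : M.carrier) ∈
        (⊥ : Submodule (SkewPoly n lam) M.carrier) := fun d => by
      refine fr_eq_zero_iff.mp (h i ?_)
      rw [lambdaMap_fr, map_zero, ← map_zero (fr N (mem_sgl i) d)]
      refine congrArg _ (Subtype.ext ?_)
      change GrMod.Hom.lin f (M.proj d m) = 0
      rw [GrMod.lin_proj, LinearMap.mem_ker.mp hm, map_zero]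
      rfl
    obtain ⟨s, hs⟩ := GrMod.eq_sum_proj m
    rw [hs]
    clear hs
    classical
    induction s using Finset.induction_on with
    | empty => exact ⟨0, by simp⟩
    | insert d s hd ih =>
      rw [Finset.sum_insert hd]
      exact exists_pow_smul_mem_add (S := ⊥) (hproj d) ih
  · intro h i
    refine (injective_iff_map_eq_zero _).mpr fun t ht => ?_
    obtain ⟨d, m, rfl⟩ := exists_eq_fr t
    rw [lambdaMap_fr] at ht
    obtain ⟨k, hk⟩ := fr_eq_zero_iff.mp ht
    obtain ⟨l, hl⟩ := h (x lam i ^ k • (m : M.carrier))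
      (LinearMap.mem_ker.mpr ((map_smul _ _ _).trans hk)) i
    exact fr_eq_zero_iff.mpr ⟨l + k, by rw [pow_add, mul_smul, hl]⟩

theorem surjective_lambdaMap_iff :
    (∀ i, Function.Surjective (DMod.Hom.app (lambdaMap f) (sgl lam i))) ↔
      IsTors n lam (_ ⧸ LinearMap.range (GrMod.Hom.lin f)) := by
  rw [isTors_quotient_iff]
  constructor
  · intro h m i
    induction m using GrMod.homogeneous_induction with
    | hdeg d m hm =>
      obtain ⟨t, ht⟩ := h i (fr N (mem_sgl i) d ⟨m, hm⟩)
      obtain ⟨e, m', rfl⟩ := exists_eq_fr t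
      rw [lambdaMap_fr] at ht
      obtain ⟨k, k', hk⟩ := exists_pow_smul_eq_of_fr_eq ht
      exact ⟨k', x lam i ^ k • (m' : M.carrier), (map_smul _ _ _).trans hk⟩
    | hadd a b ha hb => exact exists_pow_smul_mem_add ha hb
  · intro h i t
    obtain ⟨d, m, rfl⟩ := exists_eq_fr t
    obtain ⟨k, m', hm'⟩ := h m i
    -- The preimage m' of x_iᵏ m need not be homogeneous; its component of degree d + k is again a
    -- preimage.
    refine ⟨fr M (mem_sgl i) (d + k) (M.proj _ m'), ?_⟩
    rw [lambdaMap_fr, ← fr_xpow (mem_sgl i) m k]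
    refine congrArg _ (Subtype.ext ?_)
    change GrMod.Hom.lin f (M.proj _ m') = _
    rw [GrMod.lin_proj, hm', GrMod.proj_of_mem]
    exact GrMod.smul_mem' (HDeg.xpow _ i k) m.2

variable (n lam)

theorem torsIso_eq :
    torsIso n lam = (MorphismProperty.isomorphisms (DMod lam)).inverseImage (lambda lam) := by
  ext M N f
  rw [torsIso, ← injective_lambdaMap_iff, ← surjective_lambdaMap_iff]
  constructor
  · rintro ⟨h1, h2⟩
    exact DMod.isIso_of_sgl fun i => ⟨h1 i, h2 i⟩
  · intro h
    have : IsIso (lambdaMap f) := h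
    have hb := fun i => DMod.bijective_of_isIso (lambdaMap f) (sgl lam i)
    exact ⟨fun i => (hb i).1, fun i => (hb i).2⟩

/-- As the counit is invertible, `gamma` is fully faithful; a functor with a fully faithful right
adjoint is a localization at the morphisms it inverts. -/
instance isLocalization_lambda : (lambda lam).IsLocalization (torsIso n lam) := by
  rw [torsIso_eq]
  have := (lambdaGammaAdj lam).fullyFaithfulROfIsIsoCounit
  have : (gamma lam).Full := this.full
  have : (gamma lam).Faithful := (lambdaGammaAdj lam).fullyFaithfulROfIsIsoCounit.faithful
  exact (lambdaGammaAdj lam).isLocalization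

/-- Quasicoherent sheaves are equivalent to graded modules modulo torsion. -/
def qcohEquivalence : Qcoh (ncProj n lam) ≌ GrModModTors n lam :=
  (toDMod lam).asEquivalence.trans
    (Localization.equivalenceFromModel (lambda lam) (torsIso n lam)).symm

end Torsion

end NCGeom

end

theorem proposition9p16 (n : ℕ) (lam : Fin n → Fin n → ℂ)
    (hlam : ∀ i j : Fin n, i < j → lam i j ≠ 0) :
    Nonempty (NCGeom.Qcoh (NCGeom.ncProj n lam) ≌ NCGeom.GrModModTors n lam) := by
  have : Fact (∀ i j : Fin n, i < j → lam i j ≠ 0) := ⟨hlam⟩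
  exact ⟨NCGeom.qcohEquivalence n lam⟩
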